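/- Let $\alpha\in[0,1)$ and $\mathcal H=\ell^2(\mathbb Z,L^2(\mathbb R,\mathrm dx))$, where $L^2(\mathbb R)\cong L^2(\mathbb R^-)\oplus L^2(\mathbb R^+)$. Let $\mathscr H_\alpha$ be the operator in $\mathcal H$ whose domain consists of all $\psi=(\psi_k)_{k\in\mathbb Z}$ of the form $$\psi_k(x)=\int_0^{2\pi}\frac{e^{-\mathrm iky}}{\sqrt{2\pi}}\,\phi(x,y)\,\mathrm dy,\qquad \phi\in C^\infty_c\big((\mathbb R\setminus\{0\})\times\mathbb S^1\big),$$ and which acts as $$\mathscr H_\alpha\psi=\Big(\Big(-\frac{\mathrm d^2}{\mathrm dx^2}+k^2|x|^{2\alpha}+\frac{\alpha(2+\alpha)}{4x^2}\Big)\psi_k\Big)_{k\in\mathbb Z}.$$ Let $\mathscr H_\alpha^*$, $\overline{\mathscr H_\alpha}$ and $\mathscr H_{\alpha,F}$ be its adjoint, its closure and its Friedrichs extension, and let $\mathbf 1_0$ be the operator on $\mathcal H$ that is the identity on the fibre $k=0$ and zero on the other fibres. **(i)** Let $\mu_k=|k|^{-\frac2{1+\alpha}}$ for $k\neq0$ and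 $\mu_0=1$, and let $\ell^2(\mathbb Z,\mathbb C^2,\mu_k)$ be the Hilbert space of the sequences $(c_k^-,c_k^+)_{k\in\mathbb Z}$ with $\sum_k\mu_k(|c_k^-|^2+|c_k^+|^2)<\infty$. For $x>0$ put $$\Phi_{\alpha,k}(x)=\sqrt{\tfrac{\pi(1+\alpha)}{2|k|}}\;x^{-\frac\alpha2}\,e^{-\frac{|k|}{1+\alpha}x^{1+\alpha}}\quad(k\neq0),\qquad \Phi_{\alpha,0}(x)=\sqrt x\,K_{\frac{1+\alpha}2}(x),$$ where $K_\nu$ is the modified Bessel function of the second kind. Then $(c_k^-,c_k^+)_k\mapsto(\psi_k)_k$, where $\psi_k(x)=c_k^-\Phi_{\alpha,k}(|x|)$ for $x<0$ and $\psi_k(x)=c_k^+\Phi_{\alpha,k}(x)$ for $x>0$, is a linear homeomorphism of $\ell^2(\mathbb Z,\mathbb C^2,\mu_k)$ onto $\ker(\mathscr H_\alpha^*+\mathbf 1_0)$; and these two Hilbert spaces are also unitarily isomorphic. **(ii)** The operator $\mathscr H_{\alpha,F}+\mathbf 1_0$ has an everywhere defined bounded inverse, and there is a one-to-one correspondence $S\leftrightarrow\mathscr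 H_\alpha^S$ between the self-adjoint operators $S$ acting in Hilbert subspaces (closed subspaces, including $\{0\}$) of $\ker(\mathscr H_\alpha^*+\mathbf 1_0)$ and the self-adjoint extensions $\mathscr H_\alpha^S$ of $\mathscr H_\alpha$ in $\mathcal H$, where $\mathscr H_\alpha^S$ is given by $$\mathcal D(\mathscr H_\alpha^S)=\Big\{\psi=\widetilde\varphi+(\mathscr H_{\alpha,F}+\mathbf 1_0)^{-1}(Sv+w)+v\;\Big|\;\widetilde\varphi\in\mathcal D(\overline{\mathscr H_\alpha}),\ v\in\mathcal D(S),\ w\in\ker(\mathscr H_\alpha^*+\mathbf 1_0)\cap\mathcal D(S)^\perp\Big\},$$ $$(\mathscr H_\alpha^S+\mathbf 1_0)\psi=(\overline{\mathscr H_\alpha}+\mathbf 1_0)\widetilde\varphi+Sv+w .$$ -/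

import Mathlib

open MeasureTheory Filter Topology LinearPMap
open scoped ContDiff ENNReal

/-! ### Generalities on unbounded operators in a complex Hilbert space -/

section Abstract

variable {H : Type*} [NormedAddCommGroup H] [InnerProductSpace ℂ H]

/-- The kernel of an unbounded operator, as a subspace of the ambient space. -/
def opKer (T : H →ₗ.[ℂ] H) : Submodule ℂ H :=
  (LinearMap.ker T.toFun).map T.domain.subtype

theorem mem_opKer_iff (T : H →ₗ.[ℂ] H) (x : H) :
    x ∈ opKer T ↔ ∃ hx : x ∈ T.domain, T ⟨x, hx⟩ = 0 := by
  constructor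
  · rintro ⟨y, hy, rfl⟩
    exact ⟨y.2, hy⟩
  · rintro ⟨hx, h⟩
    exact ⟨⟨x, hx⟩, h, rfl⟩

/-- `x` is approximated, in the ambient norm, by a sequence in the domain of `T` which is Cauchy
with respect to the quadratic form `u ↦ ⟪u, T u⟫`. -/
def IsFormLimit (T : H →ₗ.[ℂ] H) (x : H) : Prop :=
  ∃ u : ℕ → T.domain, Tendsto (fun n => (u n : H)) atTop (𝓝 x) ∧
    Tendsto (fun p : ℕ × ℕ => inner ℂ ((u p.1 - u p.2 : T.domain) : H) (T (u p.1 - u p.2)))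
      atTop (𝓝 0)

/-- The form domain of an operator `T` that is bounded from below: the domain of the closure of
the quadratic form `u ↦ ⟪u, T u⟫`. For symmetric `T` bounded from below it consists precisely of
the form limits, see `mem_formDomain_iff`; the span only serves to have a subspace for every `T`. -/
def formDomain (T : H →ₗ.[ℂ] H) : Submodule ℂ H :=
  Submodule.span ℂ {x | IsFormLimit T x}

/-- The Friedrichs extension of a densely defined symmetric operator `T` bounded from below: the
restriction of the adjoint `T†` to those elements of its domain that lie in the form domain. -/
noncomputable def friedrichs [CompleteSpace H] (T : H →ₗ.[ℂ] H) : H →ₗ.[ℂ] H :=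
  (T†).domRestrict (formDomain T)

/-- `R` is an everywhere defined bounded inverse of the unbounded operator `T`. -/
def IsBoundedInverse (T : H →ₗ.[ℂ] H) (R : H →L[ℂ] H) : Prop :=
  (∀ y : H, ∃ hy : R y ∈ T.domain, T ⟨R y, hy⟩ = y) ∧ ∀ x : T.domain, R (T x) = x

/-- A self-adjoint operator acting in a Hilbert subspace of `N`: a complete subspace `space` of `N`
together with a (densely defined, possibly unbounded) self-adjoint operator in the Hilbert
space `space`. -/
structure SelfAdjointInSubspace (N : Submodule ℂ H) where
  space : Submodule ℂ H
  space_le : space ≤ N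
  [complete : CompleteSpace space]
  op : space →ₗ.[ℂ] space
  isSelfAdjoint : IsSelfAdjoint op

theorem mem_formDomain_iff (T : H →ₗ.[ℂ] H) (hsymm : T.IsFormalAdjoint T) (m : ℝ)
    (hm : ∀ x : T.domain, m * ‖(x : H)‖ ^ 2 ≤ (inner ℂ (x : H) (T x)).re) (x : H) :
    x ∈ formDomain T ↔ IsFormLimit T x := by
  have real_form : ∀ x : T.domain,
      inner ℂ (x : H) (T x) = ((inner ℂ (x : H) (T x)).re : ℂ) := by
    intro x
    apply (Complex.conj_eq_iff_re.mp _).symm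
    rw [inner_conj_symm, hsymm]
  have key : ∀ u : ℕ → T.domain,
      Tendsto (fun p : ℕ × ℕ => inner ℂ ((u p.1 - u p.2 : T.domain) : H) (T (u p.1 - u p.2)))
        atTop (𝓝 0) ↔
      Tendsto (fun p : ℕ × ℕ => (inner ℂ ((u p.1 - u p.2 : T.domain) : H)
        (T (u p.1 - u p.2))).re) atTop (𝓝 0) := by
    intro u
    constructor
    · intro h
      have h2 := (Complex.continuous_re.tendsto (0 : ℂ)).comp h
      rwa [Complex.zero_re] at h2
    · intro h
      have h2 := (Complex.continuous_ofReal.tendsto (0 : ℝ)).comp h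
      rw [Complex.ofReal_zero] at h2
      refine h2.congr fun p => ?_
      simp only [Function.comp_apply]
      exact (real_form _).symm
  refine ⟨fun hx => ?_, fun hx => Submodule.subset_span hx⟩
  induction hx using Submodule.span_induction with
  | mem x h => exact h
  | zero =>
    refine ⟨fun _ => 0, ?_, ?_⟩ <;> simp
  | smul c x _ h =>
    obtain ⟨u, hu, hc⟩ := h
    refine ⟨fun n => c • u n, by simpa using hu.const_smul c, ?_⟩
    have h3 := hc.const_mul (c * (starRingEnd ℂ) c)
    rw [mul_zero] at h3
    refine h3.congr fun p => ?_
    rw [← smul_sub, LinearPMap.map_smul, Submodule.coe_smul, inner_smul_left, inner_smul_right]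
    ring
  | add x y _ _ hx hy =>
    obtain ⟨u, hu, hc⟩ := hx
    obtain ⟨v, hv, hd⟩ := hy
    refine ⟨fun n => u n + v n, by simpa using hu.add hv, ?_⟩
    rw [key] at hc hd
    refine (key fun n => u n + v n).mpr ?_
    have hsub : ∀ (w : ℕ → T.domain) (z : H), Tendsto (fun n => (w n : H)) atTop (𝓝 z) →
        Tendsto (fun p : ℕ × ℕ => (w p.1 : H) - w p.2) atTop (𝓝 0) := by
      intro w z hw
      rw [← prod_atTop_atTop_eq]
      have := (hw.comp tendsto_fst).sub (hw.comp (tendsto_snd (f := (atTop : Filter ℕ))))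
      simpa using this
    have hn : Tendsto (fun p : ℕ × ℕ => m * ‖((u p.1 : H) - u p.2) - ((v p.1 : H) - v p.2)‖ ^ 2)
        atTop (𝓝 0) := by
      have := ((((hsub u x hu).sub (hsub v y hv)).norm).pow 2).const_mul m
      simpa using this
    have hn' : Tendsto (fun p : ℕ × ℕ => m * ‖((u p.1 : H) - u p.2) + ((v p.1 : H) - v p.2)‖ ^ 2)
        atTop (𝓝 0) := by
      have := ((((hsub u x hu).add (hsub v y hv)).norm).pow 2).const_mul m
      simpa using this
    have par : ∀ a b : T.domain, (inner ℂ ((a + b : T.domain) : H) (T (a + b))).re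
        + (inner ℂ ((a - b : T.domain) : H) (T (a - b))).re
        = 2 * (inner ℂ (a : H) (T a)).re + 2 * (inner ℂ (b : H) (T b)).re := by
      intro a b
      simp only [LinearPMap.map_add, LinearPMap.map_sub, Submodule.coe_add, Submodule.coe_sub,
        inner_add_left, inner_add_right, inner_sub_left, inner_sub_right, Complex.add_re,
        Complex.sub_re]
      ring
    have hup : Tendsto (fun p : ℕ × ℕ =>
        2 * (inner ℂ ((u p.1 - u p.2 : T.domain) : H) (T (u p.1 - u p.2))).re
        + 2 * (inner ℂ ((v p.1 - v p.2 : T.domain) : H) (T (v p.1 - v p.2))).re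
        - m * ‖((u p.1 : H) - u p.2) - ((v p.1 : H) - v p.2)‖ ^ 2) atTop (𝓝 0) := by
      simpa using ((hc.const_mul 2).add (hd.const_mul 2)).sub hn
    refine tendsto_of_tendsto_of_tendsto_of_le_of_le hn' hup (fun p => ?_) (fun p => ?_)
    · have := hm ((u p.1 - u p.2) + (v p.1 - v p.2))
      rw [add_sub_add_comm]
      simpa using this
    · have h1 : m * ‖((u p.1 : H) - u p.2) - ((v p.1 : H) - v p.2)‖ ^ 2 ≤
          (inner ℂ (((u p.1 - u p.2) - (v p.1 - v p.2) : T.domain) : H)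
            (T ((u p.1 - u p.2) - (v p.1 - v p.2)))).re :=
        hm ((u p.1 - u p.2) - (v p.1 - v p.2))
      have h2 := par (u p.1 - u p.2) (v p.1 - v p.2)
      have h3 : (u p.1 + v p.1) - (u p.2 + v p.2) = (u p.1 - u p.2) + (v p.1 - v p.2) :=
        add_sub_add_comm _ _ _ _
      show (inner ℂ (((u p.1 + v p.1) - (u p.2 + v p.2) : T.domain) : H)
        (T ((u p.1 + v p.1) - (u p.2 + v p.2)))).re ≤ _
      rw [h3]
      linarith

end Abstract

/-! ### The Hilbert space and the operator -/

/-- The fibre `L²(ℝ, dx) ≅ L²(ℝ⁻, dx) ⊕ L²(ℝ⁺, dx)`. -/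
abbrev Fibre : Type := Lp ℂ 2 (volume : Measure ℝ)

/-- The Hilbert space `ℓ²(ℤ, L²(ℝ, dx))`. -/
abbrev FibredSpace : Type := lp (fun _ : ℤ => Fibre) 2

/-- Elements of `C_c^∞((ℝ ∖ {0}) × 𝕊¹)`, as functions on `ℝ × ℝ` that are `2π`-periodic in the
second variable and vanish unless the first variable is in a compact subset of `ℝ ∖ {0}`. -/
structure IsCylinderTest (φ : ℝ × ℝ → ℂ) : Prop where
  smooth : ContDiff ℝ ∞ φ
  periodic : ∀ x y, φ (x, y + 2 * Real.pi) = φ (x, y)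
  support : ∃ K : Set ℝ, IsCompact K ∧ (0 : ℝ) ∉ K ∧ ∀ x ∉ K, ∀ y, φ (x, y) = 0

/-- `e_k(y) = e^{iky} / √(2π)`. -/
noncomputable def fourierMode (k : ℤ) (y : ℝ) : ℂ :=
  Complex.exp (Complex.I * k * y) / (Real.sqrt (2 * Real.pi) : ℂ)

/-- The `k`-th Fourier coefficient in the second variable, a function of the first one. -/
noncomputable def partialFourier (φ : ℝ × ℝ → ℂ) (k : ℤ) (x : ℝ) : ℂ :=
  ∫ y in (0 : ℝ)..(2 * Real.pi), (starRingEnd ℂ) (fourierMode k y) * φ (x, y)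

/-- The differential expression `-d²/dx² + k²|x|^{2α} + α(2+α)/(4x²)`. -/
noncomputable def fibreExpr (α : ℝ) (k : ℤ) (f : ℝ → ℂ) (x : ℝ) : ℂ :=
  -deriv (deriv f) x
    + (((k : ℝ) ^ 2 * |x| ^ (2 * α) + α * (2 + α) / (4 * x ^ 2) : ℝ) : ℂ) * f x

theorem hasDerivAt_integral_of_smooth {G : ℝ × ℝ → ℂ} (hG : ContDiff ℝ ∞ G) (a b x : ℝ) :
    HasDerivAt (fun x => ∫ y in a..b, G (x, y)) (∫ y in a..b, fderiv ℝ G (x, y) (1, 0)) x := by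
  have hG' : Continuous (fun p : ℝ × ℝ => fderiv ℝ G p (1, 0)) :=
    (hG.continuous_fderiv (by simp)).clm_apply continuous_const
  obtain ⟨C, hC⟩ := ((isCompact_closedBall x 1).prod (isCompact_uIcc (a := a) (b := b))
    ).exists_bound_of_continuousOn hG'.continuousOn
  refine (intervalIntegral.hasDerivAt_integral_of_dominated_loc_of_deriv_le
    (F := fun x y => G (x, y)) (F' := fun x y => fderiv ℝ G (x, y) (1, 0))
    (bound := fun _ => C) (Metric.closedBall_mem_nhds x one_pos) ?_ ?_ ?_ ?_ ?_ ?_).2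
  · exact Eventually.of_forall fun z =>
      (hG.continuous.comp (by fun_prop : Continuous fun y : ℝ => (z, y))).aestronglyMeasurable
  · exact (hG.continuous.comp (by fun_prop : Continuous fun y : ℝ => (x, y))).intervalIntegrable _ _
  · exact (hG'.comp (by fun_prop : Continuous fun y : ℝ => (x, y))).aestronglyMeasurable
  · exact Eventually.of_forall fun y hy z hz => hC (z, y) ⟨hz, Set.uIoc_subset_uIcc hy⟩
  · exact intervalIntegrable_const
  · refine Eventually.of_forall fun y _ z _ => ?_
    have h1 : HasFDerivAt G (fderiv ℝ G (z, y)) (z, y) :=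
      (hG.differentiable (by simp) _).hasFDerivAt
    have h2 : HasDerivAt (fun t : ℝ => (t, y)) ((1 : ℝ), (0 : ℝ)) z :=
      (hasDerivAt_id z).prodMk (hasDerivAt_const z y)
    exact h1.comp_hasDerivAt z h2

theorem contDiff_conj_fourierMode_mul {φ : ℝ × ℝ → ℂ} (hφ : ContDiff ℝ ∞ φ) (k : ℤ) :
    ContDiff ℝ ∞ (fun p : ℝ × ℝ => (starRingEnd ℂ) (fourierMode k p.2) * φ p) := by
  refine ContDiff.mul ?_ hφ
  refine Complex.conjCLE.contDiff.comp ?_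
  unfold fourierMode
  refine ContDiff.div_const (Complex.contDiff_exp.comp ?_) _
  exact contDiff_const.mul (Complex.ofRealCLM.contDiff.comp contDiff_snd)

theorem partialFourier_differentiable {φ : ℝ × ℝ → ℂ} (hφ : ContDiff ℝ ∞ φ) (k : ℤ) :
    Differentiable ℝ (partialFourier φ k) := fun x =>
  (hasDerivAt_integral_of_smooth (contDiff_conj_fourierMode_mul hφ k) _ _ x).differentiableAt

theorem deriv_partialFourier_differentiable {φ : ℝ × ℝ → ℂ} (hφ : ContDiff ℝ ∞ φ) (k : ℤ) :
    Differentiable ℝ (deriv (partialFourier φ k)) := by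
  have hG := contDiff_conj_fourierMode_mul hφ k
  have h : deriv (partialFourier φ k) = fun x => ∫ y in (0 : ℝ)..(2 * Real.pi),
      fderiv ℝ (fun p : ℝ × ℝ => (starRingEnd ℂ) (fourierMode k p.2) * φ p) (x, y) (1, 0) :=
    funext fun x => (hasDerivAt_integral_of_smooth hG _ _ x).deriv
  rw [h]
  intro x
  refine (hasDerivAt_integral_of_smooth
    (G := fun q => fderiv ℝ (fun p : ℝ × ℝ => (starRingEnd ℂ) (fourierMode k p.2) * φ p) q (1, 0))
    ?_ _ _ x).differentiableAt
  exact (hG.fderiv_right (m := ∞) (by simp)).clm_apply contDiff_const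

theorem partialFourier_add {φ χ : ℝ × ℝ → ℂ} (hφ : ContDiff ℝ ∞ φ) (hχ : ContDiff ℝ ∞ χ) (k : ℤ) :
    partialFourier (φ + χ) k = partialFourier φ k + partialFourier χ k := by
  funext x
  have hc : Continuous fun y : ℝ => (x, y) := by fun_prop
  simp only [partialFourier, Pi.add_apply, mul_add]
  exact intervalIntegral.integral_add
    (((contDiff_conj_fourierMode_mul hφ k).continuous.comp hc).intervalIntegrable _ _)
    (((contDiff_conj_fourierMode_mul hχ k).continuous.comp hc).intervalIntegrable _ _)

theorem partialFourier_smul (c : ℂ) (φ : ℝ × ℝ → ℂ) (k : ℤ) :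
    partialFourier (c • φ) k = c • partialFourier φ k := by
  funext x
  simp only [partialFourier, Pi.smul_apply, smul_eq_mul]
  rw [← intervalIntegral.integral_const_mul]
  congr 1
  funext y
  ring

theorem fibreExpr_add (α : ℝ) (k : ℤ) {f g : ℝ → ℂ} (hf : Differentiable ℝ f)
    (hf' : Differentiable ℝ (deriv f)) (hg : Differentiable ℝ g)
    (hg' : Differentiable ℝ (deriv g)) :
    fibreExpr α k (f + g) = fibreExpr α k f + fibreExpr α k g := by
  have h : deriv (f + g) = deriv f + deriv g := funext fun x => deriv_add (hf x) (hg x)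
  funext x
  simp only [fibreExpr, h, Pi.add_apply, deriv_add (hf' x) (hg' x)]
  ring

theorem fibreExpr_smul (α : ℝ) (k : ℤ) (c : ℂ) (f : ℝ → ℂ) :
    fibreExpr α k (c • f) = c • fibreExpr α k f := by
  have h : ∀ g : ℝ → ℂ, deriv (c • g) = c • deriv g :=
    fun g => funext fun x => deriv_const_smul_field c g
  funext x
  simp only [fibreExpr, h, Pi.smul_apply, smul_eq_mul]
  ring

/-- The graph of the minimal operator: the pairs `(ψ, η)` in `ℓ²(ℤ, L²(ℝ, dx))` such that `ψ` is
the partial Fourier transform of some `φ ∈ C_c^∞((ℝ ∖ {0}) × 𝕊¹)` and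
`η_k = (-d²/dx² + k²|x|^{2α} + α(2+α)/(4x²)) ψ_k` for every `k`. -/
noncomputable def grushinGraph (α : ℝ) : Submodule ℂ (FibredSpace × FibredSpace) where
  carrier := {p | ∃ φ : ℝ × ℝ → ℂ, IsCylinderTest φ ∧ ∀ k : ℤ,
    (p.1 k : ℝ → ℂ) =ᵐ[volume] partialFourier φ k ∧
    (p.2 k : ℝ → ℂ) =ᵐ[volume] fibreExpr α k (partialFourier φ k)}
  zero_mem' := by
    have h0 : ∀ k, partialFourier (0 : ℝ × ℝ → ℂ) k = 0 := by
      intro k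
      simpa using partialFourier_smul 0 (0 : ℝ × ℝ → ℂ) k
    have h1 : ∀ k, fibreExpr α k (0 : ℝ → ℂ) = 0 := by
      intro k
      simpa using fibreExpr_smul α k 0 (0 : ℝ → ℂ)
    refine ⟨0, ⟨contDiff_const, fun _ _ => rfl, ∅, isCompact_empty, by simp, fun _ _ _ => rfl⟩,
      fun k => ?_⟩
    rw [h0, h1]
    exact ⟨Lp.coeFn_zero _ _ _, Lp.coeFn_zero _ _ _⟩
  add_mem' := by
    rintro ⟨p, p'⟩ ⟨q, q'⟩ ⟨φ, hφ, hp⟩ ⟨χ, hχ, hq⟩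
    obtain ⟨K, hK, hK0, hKφ⟩ := hφ.support
    obtain ⟨L, hL, hL0, hLχ⟩ := hχ.support
    refine ⟨φ + χ, ⟨hφ.smooth.add hχ.smooth, fun x y => ?_, K ∪ L, hK.union hL, ?_, ?_⟩,
      fun k => ?_⟩
    · simp [hφ.periodic, hχ.periodic]
    · simp [hK0, hL0]
    · intro x hx y
      simp only [Set.mem_union, not_or] at hx
      simp [hKφ x hx.1 y, hLχ x hx.2 y]
    · rw [partialFourier_add hφ.smooth hχ.smooth, fibreExpr_add α k
        (partialFourier_differentiable hφ.smooth k)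
        (deriv_partialFourier_differentiable hφ.smooth k)
        (partialFourier_differentiable hχ.smooth k)
        (deriv_partialFourier_differentiable hχ.smooth k)]
      exact ⟨(Lp.coeFn_add (p k) (q k)).trans ((hp k).1.add (hq k).1),
        (Lp.coeFn_add (p' k) (q' k)).trans ((hp k).2.add (hq k).2)⟩
  smul_mem' := by
    rintro c ⟨p, p'⟩ ⟨φ, hφ, hp⟩
    obtain ⟨K, hK, hK0, hKφ⟩ := hφ.support
    refine ⟨c • φ, ⟨hφ.smooth.const_smul c, fun x y => ?_, K, hK, hK0, ?_⟩, fun k => ?_⟩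
    · simp [hφ.periodic]
    · intro x hx y
      simp [hKφ x hx y]
    · rw [partialFourier_smul, fibreExpr_smul]
      exact ⟨(Lp.coeFn_smul c (p k)).trans ((hp k).1.const_smul c),
        (Lp.coeFn_smul c (p' k)).trans ((hp k).2.const_smul c)⟩

theorem grushinGraph_functional (α : ℝ) (p : FibredSpace × FibredSpace) (hp : p ∈ grushinGraph α)
    (h0 : p.1 = 0) : p.2 = 0 := by
  obtain ⟨φ, hφ, h⟩ := hp
  ext1
  funext k
  have h1 : partialFourier φ k =ᵐ[volume] (0 : ℝ → ℂ) := by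
    refine (h k).1.symm.trans ?_
    rw [h0]
    exact Lp.coeFn_zero _ _ _
  have h2 : partialFourier φ k = 0 :=
    ((partialFourier_differentiable hφ.smooth k).continuous.ae_eq_iff_eq volume
      continuous_const).mp h1
  have h3 : fibreExpr α k (0 : ℝ → ℂ) = 0 := by
    simpa using fibreExpr_smul α k 0 (0 : ℝ → ℂ)
  have h4 := (h k).2
  rw [h2, h3] at h4
  exact Lp.ext (h4.trans (Lp.coeFn_zero _ _ _).symm)

/-- The minimal operator `𝓗_α` in `ℓ²(ℤ, L²(ℝ, dx))`. -/
noncomputable def grushin (α : ℝ) : FibredSpace →ₗ.[ℂ] FibredSpace :=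
  (grushinGraph α).toLinearPMap

theorem grushin_graph (α : ℝ) : (grushin α).graph = grushinGraph α :=
  Submodule.toLinearPMap_graph_eq _ (grushinGraph_functional α)

/-- The operator `𝟙₀`: the identity on the fibre `k = 0` and zero on all other fibres. -/
noncomputable def zeroMode : FibredSpace →ₗ[ℂ] FibredSpace where
  toFun ψ := lp.single 2 (0 : ℤ) (ψ 0)
  map_add' ψ χ := by simp
  map_smul' c ψ := by simp

/-- The deficiency space `ker (𝓗_α^* + 𝟙₀)`. -/
noncomputable def deficiencySpace (α : ℝ) : Submodule ℂ FibredSpace :=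
  opKer (zeroMode +ᵥ (grushin α)†)

/-! ### The weighted sequence space and the functions spanning the deficiency space -/

/-- The weight `μ_k = |k|^{-2/(1+α)}` for `k ≠ 0`, and `μ_0 = 1`. -/
noncomputable def modeWeight (α : ℝ) (k : ℤ) : ℝ :=
  if k = 0 then 1 else |(k : ℝ)| ^ (-(2 / (1 + α)))

/-- The measure on `ℤ` with mass `μ_k` at `k`. -/
noncomputable def modeMeasure (α : ℝ) : Measure ℤ :=
  Measure.sum fun k : ℤ => ENNReal.ofReal (modeWeight α k) • Measure.dirac k

/-- The Hilbert space `ℓ²(ℤ, ℂ², μ_k)`. The coordinates `0` and `1` of `ℂ²` correspond to the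
left half-line `x < 0` and to the right half-line `x > 0`. -/
abbrev WeightedSeq (α : ℝ) : Type := Lp (EuclideanSpace ℂ (Fin 2)) 2 (modeMeasure α)

/-- The modified Bessel function `K_ν(x) = ∫₀^∞ e^{-x cosh t} cosh (ν t) dt`, for `x > 0`. -/
noncomputable def besselK (ν x : ℝ) : ℝ :=
  ∫ t in Set.Ioi (0 : ℝ), Real.exp (-x * Real.cosh t) * Real.cosh (ν * t)

/-- `√|x| K_{(1+α)/2}(|x|)` for `k = 0`, and for `k ≠ 0` the function
`√|x| K_{1/2}(|k| |x|^{1+α} / (1+α))`, in its elementary form. -/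
noncomputable def deficiencyFun (α : ℝ) (k : ℤ) (x : ℝ) : ℝ :=
  if k = 0 then Real.sqrt |x| * besselK ((1 + α) / 2) |x|
  else Real.sqrt (Real.pi * (1 + α) / (2 * |(k : ℝ)|)) * |x| ^ (-(α / 2))
    * Real.exp (-(|(k : ℝ)| / (1 + α)) * |x| ^ (1 + α))

/-- `c^- Φ_{α,k}` on the left half-line and `c^+ Φ_{α,k}` on the right half-line. -/
noncomputable def deficiencyVec (α : ℝ) (k : ℤ) (c : EuclideanSpace ℂ (Fin 2)) (x : ℝ) : ℂ :=
  (if x < 0 then c 0 else c 1) * (deficiencyFun α k x : ℂ)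

/-! Write `T` for the minimal operator and `P` for `𝟙₀`. The argument has an abstract half and a
concrete half, which meet in the space `N = ker (T† + P)`.

Abstract half. If `⟪x, (T + P) x⟫ ≥ m ‖x‖²` with `m > 0`, complete the domain of `T` in the form
norm and let `J` be the bounded map from the completion to `H`. Then `R = J J†` is symmetric and
inverts the Friedrichs extension plus `P` (`exists_friedrichs_inverse`). Every `(x, y)` in the graph
of `T†` has two boundary values in `N`: the vector `x - R (y + P x)` and the orthogonal projection
of `y + P x` onto `N`. Both vanish on the closure of `T`, every pair in `N × N` is attained, and the
boundary form `⟪y, x'⟫ - ⟪x, y'⟫` becomes the standard skew form on `N × N` (`inner_sub_inner`,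
`inner_eq_iff_trace`). Self-adjoint extensions of `T` therefore correspond to self-adjoint linear
relations in `N`. Such a relation is a self-adjoint operator `S` in the closure `K` of its domain
together with the multivalued part `N ∩ Kᗮ`, the source of the vectors `w`
(`mem_relation_iff_inner`, `exists_relation_eq`). This gives `exists_equiv_extensions`.

Concrete half. The potentials with `k ≠ 0` have a common positive lower bound and the fibre `k = 0`
is lifted by `𝟙₀`, so the form bound holds. Testing against single Fourier modes splits `N` into
fibres, and test functions vanishing near `0` split each fibre into two half-lines. On `(0, ∞)` the
equation is `u'' = q u` with `q ≥ 0`. The explicit function `Φ` is a positive square integrable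
solution, while `Φ ∫ Φ⁻²` grows at least linearly, so the square integrable weak solutions are the
multiples of `Φ` (`exists_ae_eq_const_mul`). Scaling shows that the squared norm of the `k`-th
function is a constant times `|k|^(-2/(1+α))` for `k ≠ 0` (`integral_sq_deficiencyFun`). The
parametrization of `N` by the weighted sequences is thus bounded above and below, and rescaling each
fibre makes it unitary. -/

/-! ### Inverse of the Friedrichs extension from the form completion -/

section FormInverse

variable {H : Type*} [NormedAddCommGroup H] [InnerProductSpace ℂ H] [CompleteSpace H]

/-- If `j : D → H` is a bounded map from an inner product space into a Hilbert space and `J` is its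
extension to the completion of `D`, then `J J†` is described by sequences in `D`. -/
theorem exists_form_inverse {D : Type*} [NormedAddCommGroup D] [InnerProductSpace ℂ D]
    (j : D →L[ℂ] H) :
    ∃ R : H →L[ℂ] H, R.toLinearMap.IsSymmetric ∧
      (∀ y, ∃ u : ℕ → D, CauchySeq u ∧ Tendsto (fun n => j (u n)) atTop (𝓝 (R y)) ∧
        ∀ d, Tendsto (fun n => inner ℂ d (u n)) atTop (𝓝 (inner ℂ (j d) y))) ∧
      ∀ (u : ℕ → D) (x z : H), CauchySeq u → Tendsto (fun n => j (u n)) atTop (𝓝 x) →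
        (∀ d, Tendsto (fun n => inner ℂ d (u n)) atTop (𝓝 (inner ℂ (j d) z))) → R z = x := by
  let V := UniformSpace.Completion D
  let ι : D →L[ℂ] V := UniformSpace.Completion.toComplL
  have hι : ∀ d, ι d = (d : V) := fun d => rfl
  let J : V →L[ℂ] H := j.extend ι
  have hJ : ∀ d : D, J d = j d := fun d =>
    ContinuousLinearMap.extend_eq _ (UniformSpace.Completion.denseRange_coe)
      (UniformSpace.Completion.isUniformInducing_coe D) d
  have hdense : ∀ v w : V, (∀ d : D, inner ℂ (d : V) v = inner ℂ (d : V) w) → v = w := by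
    intro v w h
    refine ext_inner_left ℂ fun x => ?_
    induction x using UniformSpace.Completion.induction_on with
    | hp => exact isClosed_eq (by fun_prop) (by fun_prop)
    | ih a => exact h a
  refine ⟨J ∘L J.adjoint, ?_, ?_, ?_⟩
  · intro x y
    simp only [ContinuousLinearMap.coe_coe, ContinuousLinearMap.comp_apply]
    rw [← ContinuousLinearMap.adjoint_inner_left J, ← ContinuousLinearMap.adjoint_inner_right J]
  · intro y
    obtain ⟨w, hw, hlim⟩ := mem_closure_iff_seq_limit.mp
      (UniformSpace.Completion.denseRange_coe (α := D) (J.adjoint y))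
    choose u hu using hw
    have hlim' : Tendsto (fun n => (u n : V)) atTop (𝓝 (J.adjoint y)) := by simpa [hu] using hlim
    refine ⟨u, ?_, ?_, ?_⟩
    · exact (UniformSpace.Completion.isUniformInducing_coe D).cauchy_map_iff.mp hlim'.cauchySeq
    · have := (J.continuous.tendsto _).comp hlim'
      exact this.congr fun n => hJ (u n)
    · intro d
      have h1 : Tendsto (fun n => inner ℂ (d : V) (u n : V)) atTop
          (𝓝 (inner ℂ (d : V) (J.adjoint y))) := tendsto_const_nhds.inner hlim'
      rw [ContinuousLinearMap.adjoint_inner_right, hJ] at h1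
      exact h1.congr fun n => UniformSpace.Completion.inner_coe _ _
  · intro u x z hu hx hz
    have hu' : CauchySeq fun n => (u n : V) :=
      (hu.map (UniformSpace.Completion.uniformContinuous_coe D) :)
    obtain ⟨v, hv⟩ := cauchySeq_tendsto_of_complete hu'
    have hvx : J v = x := tendsto_nhds_unique
      (((J.continuous.tendsto v).comp hv).congr fun n => hJ (u n)) hx
    -- Both vectors have the same inner products with the dense image of `D` in its completion.
    have hvz : J.adjoint z = v := by
      refine hdense _ _ fun d => ?_
      rw [ContinuousLinearMap.adjoint_inner_right, hJ]
      refine tendsto_nhds_unique (hz d) ?_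
      have h1 : Tendsto (fun n => inner ℂ (d : V) (u n : V)) atTop (𝓝 (inner ℂ (d : V) v)) :=
        tendsto_const_nhds.inner hv
      exact h1.congr fun n => UniformSpace.Completion.inner_coe _ _
    rw [ContinuousLinearMap.comp_apply, hvz, hvx]

/-- An operator domain already carries the norm of `H`. Passing the form as a `Core` on a bare
module keeps the form norm from clashing with it. The lower bound gives `j` norm at most `m^(-1/2)`
in the form norm. -/
theorem exists_core_inverse {D : Type*} [AddCommGroup D] [Module ℂ D]
    (c : InnerProductSpace.Core ℂ D) (j : D →ₗ[ℂ] H) {m : ℝ} (hm : 0 < m)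
    (hj : ∀ x, m * ‖j x‖ ^ 2 ≤ (c.inner x x).re) :
    ∃ R : H →L[ℂ] H, R.toLinearMap.IsSymmetric ∧
      (∀ y, ∃ u : ℕ → D, Tendsto (fun p : ℕ × ℕ => c.inner (u p.1 - u p.2) (u p.1 - u p.2))
          atTop (𝓝 0) ∧ Tendsto (fun n => j (u n)) atTop (𝓝 (R y)) ∧
        ∀ d, Tendsto (fun n => c.inner d (u n)) atTop (𝓝 (inner ℂ (j d) y))) ∧
      ∀ (u : ℕ → D) (x z : H), Tendsto (fun p : ℕ × ℕ => c.inner (u p.1 - u p.2) (u p.1 - u p.2))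
          atTop (𝓝 0) → Tendsto (fun n => j (u n)) atTop (𝓝 x) →
        (∀ d, Tendsto (fun n => c.inner d (u n)) atTop (𝓝 (inner ℂ (j d) z))) → R z = x := by
  let : NormedAddCommGroup D := c.toNormedAddCommGroup
  let : InnerProductSpace ℂ D := InnerProductSpace.ofCore c.toCore
  have hin : ∀ x y : D, c.inner x y = inner ℂ x y := fun x y => rfl
  let j' : D →L[ℂ] H := LinearMap.mkContinuous j (Real.sqrt m)⁻¹ (by
    intro x
    have h := hj x
    rw [hin, ← RCLike.re_to_complex, inner_self_eq_norm_sq] at h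
    rw [inv_mul_eq_div, le_div_iff₀ (Real.sqrt_pos.mpr hm)]
    refine le_of_sq_le_sq ?_ (norm_nonneg x)
    rw [mul_pow, Real.sq_sqrt hm.le, mul_comm]
    exact h)
  have hcauchy : ∀ u : ℕ → D, CauchySeq u ↔
      Tendsto (fun p : ℕ × ℕ => c.inner (u p.1 - u p.2) (u p.1 - u p.2)) atTop (𝓝 0) := by
    intro u
    rw [cauchySeq_iff_tendsto_dist_atTop_0]
    simp only [dist_eq_norm, hin, inner_self_eq_norm_sq_to_K]
    constructor
    · intro h
      have := (Complex.continuous_ofReal.tendsto _).comp h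
      simpa using this.pow 2
    · intro h
      have h3 := h.norm
      simp only [norm_pow, norm_zero] at h3
      have h4 := (Real.continuous_sqrt.tendsto _).comp h3
      rw [Real.sqrt_zero] at h4
      refine h4.congr fun p => ?_
      simp
  obtain ⟨R, h1, h2, h3⟩ := exists_form_inverse j'
  simp only [hcauchy] at h2 h3
  exact ⟨R, h1, h2, h3⟩

/-- The inner product `⟪x, (T + P) y⟫` on the domain of `T`. -/
@[reducible] noncomputable def formCore (T : H →ₗ.[ℂ] H) (P : H →ₗ[ℂ] H)
    (hT : T.IsFormalAdjoint T) (hP : P.IsSymmetric) {m : ℝ} (hm : 0 < m)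
    (hb : ∀ x : T.domain, m * ‖(x : H)‖ ^ 2 ≤ (inner ℂ (x : H) (T x + P x)).re) :
    InnerProductSpace.Core ℂ T.domain where
  inner x y := inner ℂ (x : H) (T y + P y)
  conj_inner_symm x y := by
    rw [inner_conj_symm, inner_add_left, inner_add_right, hT, hP]
  re_inner_nonneg x := (by positivity : 0 ≤ m * ‖(x : H)‖ ^ 2).trans (hb x)
  add_left x y z := by rw [Submodule.coe_add, inner_add_left]
  smul_left x y r := by rw [Submodule.coe_smul, inner_smul_left]
  definite x hx := by
    have h := hb x
    rw [hx, Complex.zero_re] at h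
    have h2 : ‖(x : H)‖ ^ 2 = 0 := le_antisymm (by
      by_contra hc
      have := mul_pos hm (not_le.mp hc)
      linarith) (sq_nonneg _)
    simpa using h2

theorem mem_adjoint_graph_iff {T : H →ₗ.[ℂ] H} (hd : Dense (T.domain : Set H)) (x y : H) :
    (x, y) ∈ T†.graph ↔ ∀ z : T.domain, inner ℂ y (z : H) = inner ℂ x (T z) := by
  rw [mem_graph_iff]
  constructor
  · rintro ⟨⟨x', hx'⟩, rfl, rfl⟩ z
    exact adjoint_isFormalAdjoint hd ⟨x', hx'⟩ z
  · intro h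
    exact ⟨⟨x, mem_adjoint_domain_of_exists x ⟨y, h⟩⟩, rfl, adjoint_apply_eq hd _ h⟩

/-- The form pairing of `d` with `u n` equals `⟪(T + P) d, u n⟫`, which is continuous in the norm of
`H`. So the limit relation that characterizes `R y` says exactly that `R y` is in the domain of `T†`
and `(T† + P) (R y) = y`. The same identity, read backwards, gives the left inverse without a
separate proof that the form is closable. -/
theorem exists_friedrichs_inverse (T : H →ₗ.[ℂ] H) (P : H →ₗ[ℂ] H)
    (hd : Dense (T.domain : Set H)) (hT : T.IsFormalAdjoint T) (hP : P.IsSymmetric) {m : ℝ}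
    (hm : 0 < m) (hb : ∀ x : T.domain, m * ‖(x : H)‖ ^ 2 ≤ (inner ℂ (x : H) (T x + P x)).re) :
    ∃ R : H →L[ℂ] H, R.toLinearMap.IsSymmetric ∧ IsBoundedInverse (P +ᵥ friedrichs T) R := by
  -- Hellinger–Toeplitz: an everywhere defined symmetric operator is bounded. Hence `T` itself is
  -- bounded below by `m - ‖P‖`, and adding `P` does not change which convergent sequences are
  -- Cauchy for the form.
  have hPc : Continuous P := hP.continuous
  let P' : H →L[ℂ] H := ⟨P, hPc⟩
  have hform : ∀ x, x ∈ formDomain T ↔ IsFormLimit T x := by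
    refine mem_formDomain_iff T hT (m - ‖P'‖) fun x => ?_
    have h1 := hb x
    rw [inner_add_right, Complex.add_re] at h1
    have h2 : (inner ℂ (x : H) (P x)).re ≤ ‖P'‖ * ‖(x : H)‖ ^ 2 := by
      calc (inner ℂ (x : H) (P x)).re ≤ ‖(x : H)‖ * ‖P' x‖ :=
            re_inner_le_norm (𝕜 := ℂ) (x : H) (P x)
        _ ≤ ‖(x : H)‖ * (‖P'‖ * ‖(x : H)‖) := by gcongr; exact P'.le_opNorm _
        _ = _ := by ring
    linarith
  let c := formCore T P hT hP hm hb
  have hin : ∀ x y : T.domain, c.inner x y = inner ℂ (x : H) (T y + P y) := fun x y => rfl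
  obtain ⟨R, hRs, hR1, hR2⟩ := exists_core_inverse c T.domain.subtype hm hb
  have hcauchy : ∀ (u : ℕ → T.domain) (x : H), Tendsto (fun n => (u n : H)) atTop (𝓝 x) →
      (Tendsto (fun p : ℕ × ℕ => c.inner (u p.1 - u p.2) (u p.1 - u p.2)) atTop (𝓝 0) ↔
        Tendsto (fun p : ℕ × ℕ =>
          inner ℂ ((u p.1 - u p.2 : T.domain) : H) (T (u p.1 - u p.2))) atTop (𝓝 0)) := by
    intro u x hu
    have hdiff : Tendsto (fun p : ℕ × ℕ => ((u p.1 - u p.2 : T.domain) : H)) atTop (𝓝 0) := by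
      rw [← prod_atTop_atTop_eq]
      have := (hu.comp tendsto_fst).sub (hu.comp (tendsto_snd (f := (atTop : Filter ℕ))))
      simpa using this
    have hPd : Tendsto (fun p : ℕ × ℕ => inner ℂ ((u p.1 - u p.2 : T.domain) : H)
        (P ((u p.1 - u p.2 : T.domain) : H))) atTop (𝓝 0) := by
      have := hdiff.inner (𝕜 := ℂ) ((hPc.tendsto 0).comp hdiff)
      rwa [inner_zero_left] at this
    simp only [hin, inner_add_right]
    constructor
    · intro h
      have h1 := h.sub hPd
      rw [sub_zero] at h1
      exact h1.congr fun p => add_sub_cancel_right _ _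
    · intro h
      have h1 := h.add hPd
      rwa [add_zero] at h1
  have hinR : ∀ (u : ℕ → T.domain) (x : H), Tendsto (fun n => (u n : H)) atTop (𝓝 x) →
      ∀ d : T.domain, Tendsto (fun n => c.inner d (u n)) atTop
        (𝓝 (inner ℂ (T d + P d) x)) := by
    intro u x hu d
    have h1 : Tendsto (fun n => inner ℂ (T d + P d) (u n : H)) atTop
      (𝓝 (inner ℂ (T d + P d) x)) := tendsto_const_nhds.inner hu
    refine h1.congr fun n => ?_
    rw [hin, inner_add_left, inner_add_right, hT, hP]
  refine ⟨R, hRs, fun y => ?_, fun x => ?_⟩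
  · obtain ⟨u, hu, hlim, hd'⟩ := hR1 y
    have hF : R y ∈ formDomain T :=
      (hform _).mpr ⟨u, hlim, (hcauchy u _ hlim).mp hu⟩
    have hA : (R y, y - P (R y)) ∈ T†.graph := by
      rw [mem_adjoint_graph_iff hd]
      intro d
      have h1 := tendsto_nhds_unique (hinR u _ hlim d) (hd' d)
      have h2 := congrArg (starRingEnd ℂ) h1
      rw [inner_conj_symm, inner_conj_symm, inner_add_right] at h2
      rw [inner_sub_left, ← Submodule.subtype_apply, ← h2, hP, Submodule.subtype_apply]
      ring
    have hdom : R y ∈ T†.domain := mem_domain_of_mem_graph hA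
    refine ⟨⟨hF, hdom⟩, ?_⟩
    have h3 : T† ⟨R y, hdom⟩ = y - P (R y) :=
      mem_graph_snd_inj _ (mem_graph _ ⟨R y, hdom⟩) hA rfl
    rw [vadd_apply]
    have h4 : friedrichs T ⟨R y, ⟨hF, hdom⟩⟩ = T† ⟨R y, hdom⟩ :=
      domRestrict_apply (f := T†) rfl
    erw [h4, h3]
    simp
  · obtain ⟨x, hxF, hxA⟩ := x
    obtain ⟨u, hu, hc⟩ := (hform x).mp hxF
    have h4 : friedrichs T ⟨x, ⟨hxF, hxA⟩⟩ = T† ⟨x, hxA⟩ :=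
      domRestrict_apply (f := T†) rfl
    rw [vadd_apply]
    erw [h4]
    refine hR2 u _ _ ((hcauchy u x hu).mpr hc) hu fun d => ?_
    have h5 := hinR u x hu d
    have h6 : inner ℂ (T d + P d) x = inner ℂ (d : H) (P x + T† ⟨x, hxA⟩) := by
      have h7 := (adjoint_isFormalAdjoint hd ⟨x, hxA⟩ d)
      have h8 := congrArg (starRingEnd ℂ) h7
      rw [inner_conj_symm, inner_conj_symm] at h8
      rw [inner_add_left, inner_add_right, h8, hP]
      ring
    rw [h6] at h5
    exact h5

end FormInverse

/-! ### Self-adjoint operators in subspaces as self-adjoint relations -/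

section Birman

variable {H : Type*} [NormedAddCommGroup H] [InnerProductSpace ℂ H]

theorem SelfAdjointInSubspace.ext_of_graph {N : Submodule ℂ H} {S S' : SelfAdjointInSubspace N}
    (h : S.space = S'.space)
    (h' : ∀ (v w : H) (hv : v ∈ S.space) (hw : w ∈ S.space) (hv' : v ∈ S'.space)
      (hw' : w ∈ S'.space), ((⟨v, hv⟩, ⟨w, hw⟩) : S.space × S.space) ∈ S.op.graph ↔
        ((⟨v, hv'⟩, ⟨w, hw'⟩) : S'.space × S'.space) ∈ S'.op.graph) : S = S' := by
  obtain ⟨K, hK, A, hA⟩ := S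
  obtain ⟨K', hK', A', hA'⟩ := S'
  simp only at h h'
  subst h
  have : A = A' := by
    apply eq_of_eq_graph
    ext ⟨⟨v, hv⟩, ⟨w, hw⟩⟩
    exact h' v w hv hw hv hw
  subst this
  rfl

/-- The self-adjoint linear relation `{(v, S v + w) | v ∈ D(S), w ∈ N ∩ D(S)ᗮ}` in `N`. -/
def SelfAdjointInSubspace.relation {N : Submodule ℂ H} (S : SelfAdjointInSubspace N) :
    Submodule ℂ (H × H) where
  carrier := {p | ∃ (v : S.op.domain) (w : H), w ∈ N ∧
    (∀ u : S.op.domain, inner ℂ ((u : S.space) : H) w = 0) ∧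
    p.1 = ((v : S.space) : H) ∧ p.2 = (S.op v : H) + w}
  zero_mem' := ⟨0, 0, N.zero_mem, by simp, by simp, by simp⟩
  add_mem' := by
    rintro ⟨a, b⟩ ⟨a', b'⟩ ⟨v, w, hw, hu, rfl, rfl⟩ ⟨v', w', hw', hu', rfl, rfl⟩
    refine ⟨v + v', w + w', N.add_mem hw hw', fun u => ?_, by simp, ?_⟩
    · rw [inner_add_right, hu, hu', add_zero]
    · simp only [LinearPMap.map_add, Prod.mk_add_mk, Submodule.coe_add]
      abel
  smul_mem' := by
    rintro c ⟨a, b⟩ ⟨v, w, hw, hu, rfl, rfl⟩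
    refine ⟨c • v, c • w, N.smul_mem c hw, fun u => ?_, by simp, ?_⟩
    · rw [inner_smul_right, hu, mul_zero]
    · simp [LinearPMap.map_smul]

variable {N : Submodule ℂ H}

theorem SelfAdjointInSubspace.inner_eq_zero_of_mem (S : SelfAdjointInSubspace N) {w : H}
    (hw : ∀ u : S.op.domain, inner ℂ ((u : S.space) : H) w = 0) {k : H} (hk : k ∈ S.space) :
    inner ℂ k w = 0 := by
  have := S.complete
  have hd : Dense (S.op.domain : Set S.space) := S.isSelfAdjoint.dense_domain
  have h1 : ∀ k : S.space, inner ℂ (k : H) w = 0 := by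
    intro k
    refine hd.induction (P := fun k : S.space => inner ℂ (k : H) w = 0) (fun u hu => hw ⟨u, hu⟩)
      ?_ k
    exact isClosed_eq (by fun_prop) continuous_const
  exact h1 ⟨k, hk⟩

/-- The relation is its own adjoint inside `N`. For the nontrivial inclusion, testing against the
pairs `(0, w)` forces `a` to be orthogonal to `N ∩ D(S)ᗮ`, hence to lie in `S.space`. Testing
against the graph of `S` then puts `a` and the projection of `b` into the graph of `S† = S`. -/
theorem SelfAdjointInSubspace.mem_relation_iff_inner (S : SelfAdjointInSubspace N) (a b : H) :
    (a, b) ∈ S.relation ↔ a ∈ N ∧ b ∈ N ∧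
      ∀ q ∈ S.relation, inner ℂ b q.1 = inner ℂ a q.2 := by
  have := S.complete
  have hd : Dense (S.op.domain : Set S.space) := S.isSelfAdjoint.dense_domain
  have hsa : S.op† = S.op := isSelfAdjoint_def.mp S.isSelfAdjoint
  have hsym : ∀ u v : S.op.domain,
      inner ℂ (S.op u : H) ((v : S.space) : H) = inner ℂ ((u : S.space) : H) (S.op v : H) := by
    have h := adjoint_isFormalAdjoint hd
    rw [hsa] at h
    exact fun u v => h u v
  constructor
  · rintro ⟨v, w, hw, hu, rfl, rfl⟩
    refine ⟨S.space_le (v : S.space).2, N.add_mem (S.space_le (S.op v).2) hw, ?_⟩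
    rintro ⟨a', b'⟩ ⟨v', w', hw', hu', rfl, rfl⟩
    simp only [inner_add_left, inner_add_right, hsym, hu', add_zero]
    rw [← inner_conj_symm w, hu, _root_.map_zero, add_zero]
  · rintro ⟨ha, hb, h⟩
    have hrel : ∀ w ∈ N, (∀ u : S.op.domain, inner ℂ ((u : S.space) : H) w = 0) →
        inner ℂ a w = 0 := by
      intro w hw hu
      have h1 := h (0, w) ⟨0, w, hw, hu, by simp, by simp⟩
      simpa using h1.symm
    have haK : a ∈ S.space := by
      let w := a - S.space.starProjection a
      have hwK : ∀ k ∈ S.space, inner ℂ k w = 0 := fun k hk =>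
        Submodule.inner_right_of_mem_orthogonal hk
          (Submodule.sub_starProjection_mem_orthogonal a)
      have hwN : w ∈ N := N.sub_mem ha (S.space_le (Submodule.starProjection_apply_mem _ _))
      have h1 := hrel w hwN fun u => hwK _ (u : S.space).2
      have h2 : inner ℂ w w = 0 := by
        nth_rewrite 1 [show w = a - S.space.starProjection a from rfl]
        rw [inner_sub_left, h1, hwK _ (Submodule.starProjection_apply_mem _ _), sub_zero]
      have h3 : a = S.space.starProjection a := sub_eq_zero.mp (inner_self_eq_zero.mp h2)
      rw [h3]
      exact Submodule.starProjection_apply_mem _ _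
    let c := S.space.starProjection b
    have hc : c ∈ S.space := Submodule.starProjection_apply_mem _ _
    have hbc : ∀ k ∈ S.space, inner ℂ k (b - c) = 0 := fun k hk =>
      Submodule.inner_right_of_mem_orthogonal hk (Submodule.sub_starProjection_mem_orthogonal b)
    have hg : ((⟨a, haK⟩, ⟨c, hc⟩) : S.space × S.space) ∈ S.op.graph := by
      rw [← hsa, mem_adjoint_graph_iff hd]
      intro z
      have h1 := h (((z : S.space) : H), (S.op z : H)) ⟨z, 0, N.zero_mem, by simp, rfl, by simp⟩
      simp only at h1
      have h2 := congrArg (starRingEnd ℂ) (hbc _ (z : S.space).2)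
      rw [inner_conj_symm, _root_.map_zero, inner_sub_left, sub_eq_zero] at h2
      exact h2.symm.trans h1
    obtain ⟨v, hv1, hv2⟩ := (mem_graph_iff _).mp hg
    refine ⟨v, b - c, N.sub_mem hb (S.space_le hc), fun u => hbc _ (u : S.space).2, ?_, ?_⟩
    · simp [hv1]
    · simp [hv2]

/-- With the next lemma this recovers `S` from its relation: the space is the closure of the first
components, and the operator is what remains of the relation inside that space. -/
theorem SelfAdjointInSubspace.mem_space_iff (S : SelfAdjointInSubspace N) (x : H) :
    x ∈ S.space ↔ x ∈ (S.relation.map (LinearMap.fst ℂ H H)).topologicalClosure := by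
  have := S.complete
  have hd : Dense (S.op.domain : Set S.space) := S.isSelfAdjoint.dense_domain
  constructor
  · intro hx
    have h1 : ∀ k : S.space,
        (k : H) ∈ (S.relation.map (LinearMap.fst ℂ H H)).topologicalClosure := by
      intro k
      refine hd.induction (P := fun k : S.space =>
        (k : H) ∈ (S.relation.map (LinearMap.fst ℂ H H)).topologicalClosure) (fun u hu => ?_) ?_ k
      · exact Submodule.le_topologicalClosure _ ⟨(u, S.op ⟨u, hu⟩),
          ⟨⟨u, hu⟩, 0, N.zero_mem, by simp, rfl, by simp⟩, rfl⟩
      · exact (Submodule.isClosed_topologicalClosure _).preimage continuous_subtype_val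
    exact h1 ⟨x, hx⟩
  · intro hx
    refine Submodule.topologicalClosure_minimal _ ?_
      (completeSpace_coe_iff_isComplete.mp S.complete).isClosed hx
    rintro _ ⟨⟨a, b⟩, ⟨v, w, -, -, h, -⟩, rfl⟩
    have h' : a = ((v : S.space) : H) := h
    exact (congrArg (· ∈ S.space) h').mpr (v : S.space).2

theorem SelfAdjointInSubspace.mem_graph_iff_mem_relation (S : SelfAdjointInSubspace N)
    (x y : S.space) : (x, y) ∈ S.op.graph ↔ ((x : H), (y : H)) ∈ S.relation := by
  constructor
  · intro h
    obtain ⟨v, rfl, rfl⟩ := (mem_graph_iff _).mp h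
    exact ⟨v, 0, N.zero_mem, by simp, rfl, by simp⟩
  · rintro ⟨v, w, hw, hu, h1, h2⟩
    change (x : H) = ((v : S.space) : H) at h1
    change (y : H) = (S.op v : H) + w at h2
    have hwS : w ∈ S.space := by
      have : w = y - S.op v := by rw [h2]; simp
      rw [this]
      exact S.space.sub_mem y.2 (S.op v).2
    have hw0 : w = 0 := inner_self_eq_zero.mp (S.inner_eq_zero_of_mem hu hwS)
    rw [mem_graph_iff]
    refine ⟨v, Subtype.ext h1.symm, Subtype.ext ?_⟩
    simp [h2, hw0]

theorem SelfAdjointInSubspace.relation_injective :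
    Function.Injective (SelfAdjointInSubspace.relation (N := N)) := by
  intro S S' h
  refine SelfAdjointInSubspace.ext_of_graph ?_ ?_
  · ext x
    rw [mem_space_iff, mem_space_iff, h]
  · intro v w hv hw hv' hw'
    rw [mem_graph_iff_mem_relation, mem_graph_iff_mem_relation, h]

/-- Splitting of a self-adjoint relation. Let `K` be the closure of the set of first components. The
second components are determined up to the multivalued part `N ∩ Kᗮ`, so projecting them onto `K`
gives a single-valued, densely defined operator in `K`, and self-adjointness of `L` passes to it. -/
theorem SelfAdjointInSubspace.exists_relation_eq [CompleteSpace H] (hN : IsClosed (N : Set H))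
    (L : Submodule ℂ (H × H))
    (hL : ∀ a b, (a, b) ∈ L ↔ a ∈ N ∧ b ∈ N ∧ ∀ q ∈ L, inner ℂ b q.1 = inner ℂ a q.2) :
    ∃ S : SelfAdjointInSubspace N, S.relation = L := by
  let D := L.map (LinearMap.fst ℂ H H)
  let K := D.topologicalClosure
  have hDK : D ≤ K := Submodule.le_topologicalClosure _
  have hKN : K ≤ N := by
    refine Submodule.topologicalClosure_minimal _ ?_ hN
    rintro _ ⟨⟨a, b⟩, hab, rfl⟩
    exact ((hL a b).mp hab).1
  have horth : ∀ w, (∀ q ∈ L, inner ℂ q.1 w = 0) → ∀ k ∈ K, inner ℂ k w = 0 := by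
    intro w hw k hk
    refine closure_minimal (s := (D : Set H)) (t := {k | inner ℂ k w = 0}) ?_
      (isClosed_eq (by fun_prop) continuous_const) hk
    rintro _ ⟨q, hq, rfl⟩
    exact hw q hq
  -- Maximality of `L`: vectors of `N` orthogonal to the first components belong to the multivalued
  -- part.
  have hmul : ∀ w ∈ N, (∀ q ∈ L, inner ℂ q.1 w = 0) → ((0 : H), w) ∈ L := by
    intro w hw h
    refine (hL _ _).mpr ⟨N.zero_mem, hw, fun q hq => ?_⟩
    rw [← inner_conj_symm, h q hq, _root_.map_zero, inner_zero_left]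
  have hproj : ∀ a b, (a, b) ∈ L → (a, K.starProjection b) ∈ L := by
    intro a b hab
    have h1 : ((0 : H), b - K.starProjection b) ∈ L := by
      refine hmul _ (N.sub_mem ((hL a b).mp hab).2.1
        (hKN (Submodule.starProjection_apply_mem _ _))) fun q hq => ?_
      exact Submodule.inner_right_of_mem_orthogonal (hDK ⟨q, hq, rfl⟩)
        (Submodule.sub_starProjection_mem_orthogonal b)
    have h2 := L.sub_mem hab h1
    simpa using h2
  let G : Submodule ℂ (K × K) := L.comap (K.subtype.prodMap K.subtype)
  have hG : ∀ x y : K, (x, y) ∈ G ↔ ((x : H), (y : H)) ∈ L := fun x y => Iff.rfl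
  let A : K →ₗ.[ℂ] K := G.toLinearPMap
  have hA : A.graph = G := by
    refine Submodule.toLinearPMap_graph_eq _ ?_
    rintro ⟨x, y⟩ hxy hx
    simp only at hx
    subst hx
    have h1 := ((hL _ _).mp ((hG _ _).mp hxy)).2.2
    have h2 : inner ℂ (y : H) (y : H) = 0 := by
      refine horth _ (fun q hq => ?_) _ y.2
      rw [← inner_conj_symm, h1 q hq]
      simp
    exact Subtype.ext (inner_self_eq_zero.mp h2)
  have hdom : ∀ a b (h : (a, b) ∈ L), (⟨a, hDK ⟨_, h, rfl⟩⟩ : K) ∈ A.domain := by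
    intro a b h
    refine mem_domain_of_mem_graph
      (y := ⟨K.starProjection b, Submodule.starProjection_apply_mem _ _⟩) ?_
    rw [hA, hG]
    exact hproj a b h
  have hdense : Dense (A.domain : Set K) := by
    rw [Submodule.dense_iff_topologicalClosure_eq_top, Submodule.topologicalClosure_eq_top_iff,
      Submodule.eq_bot_iff]
    intro k hk
    have h2 : inner ℂ (k : H) (k : H) = 0 := by
      refine horth _ ?_ _ k.2
      rintro ⟨a, b⟩ hab
      exact (Submodule.mem_orthogonal _ _).mp hk _ (hdom a b hab)
    exact Subtype.ext (inner_self_eq_zero.mp h2)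
  have hsa : IsSelfAdjoint A := by
    rw [isSelfAdjoint_def]
    apply eq_of_eq_graph
    ext ⟨x, y⟩
    rw [mem_adjoint_graph_iff hdense, hA, hG, hL]
    constructor
    · intro h
      refine ⟨hKN x.2, hKN y.2, ?_⟩
      rintro ⟨a, b⟩ hab
      have h1 := h ⟨_, hdom a b hab⟩
      have h2 : A ⟨_, hdom a b hab⟩ = ⟨K.starProjection b, Submodule.starProjection_apply_mem _ _⟩ := by
        refine mem_graph_snd_inj A (mem_graph _ _) ?_ rfl
        rw [hA, hG]
        exact hproj a b hab
      rw [h2] at h1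
      have h3 : inner ℂ (x : H) (b - K.starProjection b) = 0 :=
        Submodule.inner_right_of_mem_orthogonal x.2
          (Submodule.sub_starProjection_mem_orthogonal b)
      rw [inner_sub_right, sub_eq_zero] at h3
      exact h1.trans h3.symm
    · rintro ⟨-, -, h⟩ z
      have h1 : ((z : K), A z) ∈ G := hA ▸ mem_graph A z
      exact h _ ((hG _ _).mp h1)
  refine ⟨⟨K, hKN, A, hsa⟩, ?_⟩
  ext ⟨a, b⟩
  constructor
  · rintro ⟨v, w, hw, hu, h1, h2⟩
    simp only at v h1 h2 hu
    subst h1 h2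
    have h3 : ((v : K), A v) ∈ G := hA ▸ mem_graph A v
    have h4 : ((0 : H), w) ∈ L := by
      refine hmul w hw ?_
      rintro ⟨a, b⟩ hab
      exact hu ⟨_, hdom a b hab⟩
    have h5 := L.add_mem ((hG _ _).mp h3) h4
    simpa using h5
  · intro hab
    have h2 : A ⟨_, hdom a b hab⟩ = ⟨K.starProjection b, Submodule.starProjection_apply_mem _ _⟩ := by
      refine mem_graph_snd_inj A (mem_graph _ _) ?_ rfl
      rw [hA, hG]
      exact hproj a b hab
    refine ⟨⟨_, hdom a b hab⟩, b - K.starProjection b, N.sub_mem ((hL a b).mp hab).2.1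
        (hKN (Submodule.starProjection_apply_mem _ _)), fun u => ?_, rfl, ?_⟩
    · exact Submodule.inner_right_of_mem_orthogonal (u : K).2
        (Submodule.sub_starProjection_mem_orthogonal b)
    · simp only [h2]
      simp

end Birman

/-! ### Boundary values and the Kreĭn–Višik–Birman correspondence -/

section BirmanExtension

variable {H : Type*} [NormedAddCommGroup H] [InnerProductSpace ℂ H] [CompleteSpace H]

/-- `R` is the inverse of `A + P` for a self-adjoint extension `A` of the symmetric operator `T`,
and `N` is the kernel of `T† + P`. -/
structure IsBirmanInverse (T : H →ₗ.[ℂ] H) (P : H →ₗ[ℂ] H) (R : H →L[ℂ] H)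
    (N : Submodule ℂ H) : Prop where
  dense : Dense (T.domain : Set H)
  symm : T.IsFormalAdjoint T
  symm_left : P.IsSymmetric
  symm_right : R.toLinearMap.IsSymmetric
  mem_iff : ∀ x, x ∈ N ↔ (x, -P x) ∈ T†.graph
  graph_mem : ∀ y, (R y, y - P (R y)) ∈ T†.graph
  left_inv : ∀ x : T.domain, R (T x + P x) = x

variable {T : H →ₗ.[ℂ] H} {P : H →ₗ[ℂ] H} {R : H →L[ℂ] H} {N : Submodule ℂ H}

namespace IsBirmanInverse

variable (h : IsBirmanInverse T P R N)
include h

theorem mem_iff_inner (x : H) : x ∈ N ↔ ∀ z : T.domain, inner ℂ x (T z + P z) = 0 := by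
  rw [h.mem_iff, mem_adjoint_graph_iff h.dense]
  refine forall_congr' fun z => ?_
  rw [inner_neg_left, inner_add_right, h.symm_left, neg_eq_iff_add_eq_zero, add_comm]

theorem isClosed_space : IsClosed (N : Set H) := by
  have : (N : Set H) = ⋂ z : T.domain, {x | inner ℂ x (T z + P z) = 0} := by
    ext x
    simp [h.mem_iff_inner]
  rw [this]
  exact isClosed_iInter fun z => isClosed_eq (by fun_prop) continuous_const

theorem le_adjoint : T ≤ T† := h.symm.le_adjoint h.dense

theorem graph_closure : (T.closure.graph : Set (H × H)) = _root_.closure (T.graph : Set (H × H)) := by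
  have hc : T.IsClosable := (adjoint_isClosed h.dense).isClosable.leIsClosable h.le_adjoint
  rw [← hc.graph_closure_eq_closure_graph, Submodule.topologicalClosure_coe]

theorem closure_graph_le : T.closure.graph ≤ T†.graph := by
  intro p hp
  have h1 : p ∈ _root_.closure (T.graph : Set (H × H)) := h.graph_closure ▸ hp
  exact closure_minimal (le_graph_of_le h.le_adjoint) (adjoint_isClosed h.dense) h1

/-- Both boundary values vanish on the graph of `T`, and these are closed conditions because `R` and
`P` are continuous. -/
theorem of_mem_closure {x y : H} (hxy : (x, y) ∈ T.closure.graph) :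
    R (y + P x) = x ∧ ∀ n ∈ N, inner ℂ n (y + P x) = 0 := by
  have hP := h.symm_left.continuous
  have h1 : (x, y) ∈ _root_.closure (T.graph : Set (H × H)) := h.graph_closure ▸ hxy
  have h2 : _root_.closure (T.graph : Set (H × H)) ⊆
      {p | R (p.2 + P p.1) = p.1 ∧ ∀ n ∈ N, inner ℂ n (p.2 + P p.1) = 0} := by
    refine closure_minimal ?_ ?_
    · rintro ⟨a, b⟩ hab
      obtain ⟨a, rfl, rfl⟩ := (mem_graph_iff _).mp hab
      exact ⟨h.left_inv a, fun n hn => (h.mem_iff_inner n).mp hn a⟩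
    · simp only [Set.ofPred_and, Set.ofPred_forall]
      refine (isClosed_eq (by fun_prop) (by fun_prop)).inter ?_
      exact isClosed_iInter fun n => isClosed_iInter fun _ => isClosed_eq (by fun_prop)
        continuous_const
  exact h2 h1

/-- Since `N` is the orthogonal complement of the range of `T + P`, such a `y` is a limit of vectors
`(T + P) (u n)`. Then `u n = R ((T + P) (u n))` converges to `R y` by continuity of `R`. -/
theorem mem_closure_of_orthogonal {y : H} (hy : ∀ n ∈ N, inner ℂ n y = 0) :
    (R y, y - P (R y)) ∈ T.closure.graph := by
  have hP := h.symm_left.continuous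
  let W : Submodule ℂ H := LinearMap.range (T.toFun + P ∘ₗ T.domain.subtype)
  have hW : y ∈ W.topologicalClosure := by
    rw [← Submodule.orthogonal_orthogonal_eq_closure, Submodule.mem_orthogonal]
    intro n hn
    refine hy n ((h.mem_iff_inner n).mpr fun z => ?_)
    exact (Submodule.mem_orthogonal' _ _).mp hn _ ⟨z, rfl⟩
  obtain ⟨w, hw, hlim⟩ := mem_closure_iff_seq_limit.mp
    (show y ∈ _root_.closure (W : Set H) from hW)
  choose u hu using hw
  have hu' : ∀ n, T (u n) + P (u n) = w n := hu
  have hRu : ∀ n, (u n : H) = R (w n) := fun n => by rw [← hu', h.left_inv]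
  have h1 : (R y, y - P (R y)) ∈ _root_.closure (T.graph : Set (H × H)) := by
    refine mem_closure_of_tendsto (b := atTop) (f := fun n => (R (w n), w n - P (R (w n)))) ?_
      (Eventually.of_forall fun n => ?_)
    · exact ((by fun_prop : Continuous fun z => (R z, z - P (R z))).tendsto y).comp hlim
    · rw [← hRu, ← hu', add_sub_cancel_right]
      exact mem_graph T (u n)
  rwa [← h.graph_closure] at h1

/-- Abstract Green identity: the symmetric terms containing `P` and `R` cancel. -/
theorem inner_sub_inner (p q : H × H) :
    inner ℂ p.2 q.1 - inner ℂ p.1 q.2 =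
      inner ℂ (p.2 + P p.1) (q.1 - R (q.2 + P q.1)) -
        inner ℂ (p.1 - R (p.2 + P p.1)) (q.2 + P q.1) := by
  have h1 : inner ℂ (R (p.2 + P p.1)) (q.2 + P q.1) = inner ℂ (p.2 + P p.1) (R (q.2 + P q.1)) :=
    h.symm_right _ _
  rw [inner_sub_left, inner_sub_right, h1, inner_add_left p.2 (P p.1) q.1, inner_add_right p.1,
    h.symm_left]
  ring

/-- The vectors `p.1` and `R (p.2 + P p.1)` have the same image under `T† + P`. -/
theorem sub_mem {p : H × H} (hp : p ∈ T†.graph) : p.1 - R (p.2 + P p.1) ∈ N := by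
  rw [h.mem_iff]
  have h1 := T†.graph.sub_mem hp (h.graph_mem (p.2 + P p.1))
  convert h1 using 1
  ext
  · rfl
  · simp only [Prod.snd_sub, _root_.map_sub]
    abel

theorem add_mem_graph {a b : H} (ha : a ∈ N) :
    (R b + a, b - P (R b + a)) ∈ T†.graph := by
  have h1 := T†.graph.add_mem (h.graph_mem b) ((h.mem_iff a).mp ha)
  convert h1 using 1
  ext
  · rfl
  · simp only [Prod.snd_add, _root_.map_add]
    abel

omit h in
/-- The operator `T†` restricted to `{φ + R b + a | φ ∈ D(T̄), (a, b) ∈ L}`. -/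
noncomputable def _root_.relationExtension (T : H →ₗ.[ℂ] H) (R : H →L[ℂ] H)
    (L : Submodule ℂ (H × H)) : H →ₗ.[ℂ] H :=
  T†.domRestrict (T.closure.domain ⊔
    L.map (LinearMap.fst ℂ H H + R.toLinearMap ∘ₗ LinearMap.snd ℂ H H))

omit h in
theorem mem_relationExtension_graph_iff (L : Submodule ℂ (H × H)) (p : H × H) :
    p ∈ (relationExtension T R L).graph ↔ p ∈ T†.graph ∧
      ∃ φ ∈ T.closure.domain, ∃ q ∈ L, p.1 = φ + R q.2 + q.1 := by
  have hdom : ∀ x, x ∈ (T.closure.domain ⊔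
      L.map (LinearMap.fst ℂ H H + R.toLinearMap ∘ₗ LinearMap.snd ℂ H H)) ↔
      ∃ φ ∈ T.closure.domain, ∃ q ∈ L, x = φ + R q.2 + q.1 := by
    intro x
    rw [Submodule.mem_sup]
    constructor
    · rintro ⟨φ, hφ, _, ⟨q, hq, rfl⟩, rfl⟩
      refine ⟨φ, hφ, q, hq, ?_⟩
      simp only [LinearMap.add_apply, LinearMap.fst_apply, LinearMap.comp_apply,
        LinearMap.snd_apply, ContinuousLinearMap.coe_coe]
      abel
    · rintro ⟨φ, hφ, q, hq, rfl⟩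
      refine ⟨φ, hφ, _, ⟨q, hq, rfl⟩, ?_⟩
      simp only [LinearMap.add_apply, LinearMap.fst_apply, LinearMap.comp_apply,
        LinearMap.snd_apply, ContinuousLinearMap.coe_coe]
      abel
  rw [mem_graph_iff]
  constructor
  · rintro ⟨⟨x, hx1, hx2⟩, hp1, hp2⟩
    refine ⟨?_, ?_⟩
    · rw [mem_graph_iff]
      exact ⟨⟨x, hx2⟩, hp1, (domRestrict_apply (f := T†) rfl).symm.trans hp2⟩
    · rw [← hp1]
      exact (hdom x).mp hx1
  · rintro ⟨hp, hx⟩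
    obtain ⟨x, hx1, hx2⟩ := (mem_graph_iff _).mp hp
    refine ⟨⟨x, ⟨(hdom x).mpr (hx1 ▸ hx), x.2⟩⟩, hx1, ?_⟩
    exact (domRestrict_apply (f := T†) rfl).trans hx2

variable {L : Submodule ℂ (H × H)}

/-- The summand from the closure of `T` has zero boundary values, and the summand `R b + a` has
boundary values `(a, b)`. Conversely, split `p.2 + P p.1` along `N` and `Nᗮ`: applying `R` to the
part in `Nᗮ` gives the vector of the closed domain. -/
theorem mem_relationExtension_iff_trace [CompleteSpace N] (hL : ∀ q ∈ L, q.1 ∈ N ∧ q.2 ∈ N)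
    {p : H × H} (hp : p ∈ T†.graph) : p ∈ (relationExtension T R L).graph ↔
      (p.1 - R (p.2 + P p.1), N.starProjection (p.2 + P p.1)) ∈ L := by
  rw [mem_relationExtension_graph_iff, and_iff_right hp]
  constructor
  · rintro ⟨φ, hφ, q, hq, hpq⟩
    have hφ' := mem_graph T.closure ⟨φ, hφ⟩
    set χ := T.closure ⟨φ, hφ⟩
    have h1 := T†.graph.add_mem (h.closure_graph_le hφ') (h.add_mem_graph (b := q.2) (hL q hq).1)
    have h2 : p.2 = χ + (q.2 - P (R q.2 + q.1)) :=
      mem_graph_snd_inj _ hp h1 (by rw [hpq]; simp [add_assoc])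
    have h3 : p.2 + P p.1 = (χ + P φ) + q.2 := by
      rw [h2, hpq]
      simp only [_root_.map_add]
      abel
    obtain ⟨h4, h5⟩ : R (χ + P φ) = φ ∧ ∀ n ∈ N, inner ℂ n (χ + P φ) = 0 := h.of_mem_closure hφ'
    have h6 : N.starProjection (χ + P φ) = 0 :=
      (Submodule.starProjection_apply_eq_zero_iff _).mpr ((Submodule.mem_orthogonal _ _).mpr h5)
    rw [h3, _root_.map_add R, _root_.map_add N.starProjection, h4, h6, zero_add,
      Submodule.starProjection_eq_self_iff.mpr (hL q hq).2, hpq]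
    convert hq using 1
    ext
    · simp only
      abel
    · rfl
  · intro hq
    set y := p.2 + P p.1
    have h1 : (R (y - N.starProjection y), _) ∈ T.closure.graph :=
      h.mem_closure_of_orthogonal (y := y - N.starProjection y) fun n hn =>
        Submodule.inner_right_of_mem_orthogonal hn (Submodule.sub_starProjection_mem_orthogonal y)
    refine ⟨_, mem_domain_of_mem_graph h1, _, hq, ?_⟩
    simp

theorem mem_relationExtension_of_mem (hL : ∀ q ∈ L, q.1 ∈ N) {q : H × H} (hq : q ∈ L) :
    (R q.2 + q.1, q.2 - P (R q.2 + q.1)) ∈ (relationExtension T R L).graph := by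
  rw [mem_relationExtension_graph_iff]
  refine ⟨h.add_mem_graph (hL q hq), 0, Submodule.zero_mem _, q, hq, ?_⟩
  simp

theorem le_relationExtension : T ≤ relationExtension T R L := by
  apply le_of_le_graph
  rintro ⟨x, y⟩ hp
  rw [mem_relationExtension_graph_iff]
  refine ⟨le_graph_of_le h.le_adjoint hp, x, T.le_closure.1 (mem_domain_of_mem_graph hp), 0,
    L.zero_mem, ?_⟩
  simp

omit h in
theorem _root_.isSelfAdjoint_iff_graph {A : H →ₗ.[ℂ] H} (hA : Dense (A.domain : Set H)) :
    IsSelfAdjoint A ↔ ∀ p, p ∈ A.graph ↔ ∀ q ∈ A.graph, inner ℂ p.2 q.1 = inner ℂ p.1 q.2 := by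
  have h1 : ∀ p : H × H, p ∈ A†.graph ↔ ∀ q ∈ A.graph, inner ℂ p.2 q.1 = inner ℂ p.1 q.2 := by
    rintro ⟨x, y⟩
    rw [mem_adjoint_graph_iff hA]
    constructor
    · rintro h ⟨a, b⟩ hab
      obtain ⟨z, rfl, rfl⟩ := (mem_graph_iff _).mp hab
      exact h z
    · exact fun h z => h _ (mem_graph A z)
  simp only [← h1]
  rw [isSelfAdjoint_def]
  exact ⟨fun h p => by rw [h], fun h => eq_of_eq_graph (Submodule.ext fun p => (h p).symm)⟩

/-- The first boundary values lie in `N`, so in the Green identity the other factors may be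
projected onto `N`. -/
theorem inner_eq_iff_trace [CompleteSpace N] {p q : H × H} (hp : p ∈ T†.graph)
    (hq : q ∈ T†.graph) : inner ℂ p.2 q.1 = inner ℂ p.1 q.2 ↔
      inner ℂ (N.starProjection (p.2 + P p.1)) (q.1 - R (q.2 + P q.1)) =
        inner ℂ (p.1 - R (p.2 + P p.1)) (N.starProjection (q.2 + P q.1)) := by
  have h1 : ∀ a ∈ N, ∀ b, inner ℂ a (N.starProjection b) = inner ℂ a b := by
    intro a ha b
    have := Submodule.inner_right_of_mem_orthogonal ha
      (Submodule.sub_starProjection_mem_orthogonal b)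
    rw [inner_sub_right, sub_eq_zero] at this
    exact this.symm
  have h2 : ∀ a ∈ N, ∀ b, inner ℂ (N.starProjection b) a = inner ℂ b a := by
    intro a ha b
    rw [← inner_conj_symm, h1 a ha, inner_conj_symm]
  rw [h1 _ (h.sub_mem hp), h2 _ (h.sub_mem hq), ← sub_eq_zero, h.inner_sub_inner,
    sub_eq_zero]

/-- The boundary map is onto `N × N` and turns the adjoint pairing of graphs into that of relations.
Hence the extension is its own adjoint when `L` is its own adjoint in `N`. -/
theorem isSelfAdjoint_relationExtension [CompleteSpace N]
    (hL : ∀ a b, (a, b) ∈ L ↔ a ∈ N ∧ b ∈ N ∧ ∀ q ∈ L, inner ℂ b q.1 = inner ℂ a q.2) :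
    IsSelfAdjoint (relationExtension T R L) := by
  have hLN : ∀ q ∈ L, q.1 ∈ N ∧ q.2 ∈ N := fun q hq =>
    ⟨((hL q.1 q.2).mp hq).1, ((hL q.1 q.2).mp hq).2.1⟩
  have hle : T ≤ relationExtension T R L := h.le_relationExtension
  rw [isSelfAdjoint_iff_graph (h.dense.mono hle.1)]
  intro p
  constructor
  · intro hp q hq
    have hp' := ((mem_relationExtension_graph_iff _ _).mp hp).1
    have hq' := ((mem_relationExtension_graph_iff _ _).mp hq).1
    rw [h.inner_eq_iff_trace hp' hq']
    exact ((hL _ _).mp ((h.mem_relationExtension_iff_trace hLN hp').mp hp)).2.2 _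
      ((h.mem_relationExtension_iff_trace hLN hq').mp hq)
  · intro hp
    have hp' : p ∈ T†.graph := by
      rw [← Prod.mk.eta (p := p), mem_adjoint_graph_iff h.dense]
      exact fun z => hp _ (le_graph_of_le hle (mem_graph T z))
    rw [h.mem_relationExtension_iff_trace hLN hp', hL]
    refine ⟨h.sub_mem hp', Submodule.starProjection_apply_mem _ _, fun q hq => ?_⟩
    have hq' := h.add_mem_graph (b := q.2) (hLN q hq).1
    have h1 := hp _ (h.mem_relationExtension_of_mem (fun q hq => (hLN q hq).1) hq)
    rw [h.inner_eq_iff_trace hp' hq'] at h1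
    simp only [sub_add_cancel, add_sub_cancel_left] at h1
    rwa [Submodule.starProjection_eq_self_iff.mpr (hLN q hq).2] at h1

theorem relationExtension_injOn [CompleteSpace N] {L L' : Submodule ℂ (H × H)}
    (hL : ∀ q ∈ L, q.1 ∈ N ∧ q.2 ∈ N) (hL' : ∀ q ∈ L', q.1 ∈ N ∧ q.2 ∈ N)
    (heq : relationExtension T R L = relationExtension T R L') : L ≤ L' := by
  intro q hq
  have h1 := h.mem_relationExtension_of_mem (fun q hq => (hL q hq).1) hq
  rw [heq, h.mem_relationExtension_iff_trace hL' (h.add_mem_graph (hL q hq).1)] at h1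
  simp only [sub_add_cancel, add_sub_cancel_left] at h1
  rwa [Submodule.starProjection_eq_self_iff.mpr (hL q hq).2] at h1

/-- A self-adjoint extension lies between the closure of `T` and `T†`, so it is determined by its
set of boundary values, and that set is the required `L`. -/
theorem exists_relationExtension_eq [CompleteSpace N] {B : H →ₗ.[ℂ] H} (hTB : T ≤ B)
    (hB : IsSelfAdjoint B) : ∃ L : Submodule ℂ (H × H), relationExtension T R L = B ∧
      ∀ a b, (a, b) ∈ L ↔ a ∈ N ∧ b ∈ N ∧ ∀ q ∈ L, inner ℂ b q.1 = inner ℂ a q.2 := by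
  have hBg := (isSelfAdjoint_iff_graph hB.dense_domain).mp hB
  have hBT : B.graph ≤ T†.graph := by
    rintro ⟨x, y⟩ hp
    rw [mem_adjoint_graph_iff h.dense]
    exact fun z => (hBg _).mp hp _ (le_graph_of_le hTB (mem_graph T z))
  have hcB : T.closure.graph ≤ B.graph := by
    intro p hp
    have h1 : p ∈ _root_.closure (T.graph : Set (H × H)) := h.graph_closure ▸ hp
    exact closure_minimal (le_graph_of_le hTB) hB.isClosed h1
  -- On `N × N` this is a right inverse of the boundary map. Pulling the graph of `B` back along it
  -- describes the set of boundary values of `B` as a submodule.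
  let F : H × H →ₗ[ℂ] H × H :=
    { toFun := fun q => (R q.2 + q.1, q.2 - P (R q.2 + q.1))
      map_add' := fun p q => by
        ext
        · simp only [Prod.fst_add, Prod.snd_add, _root_.map_add]
          abel
        · simp only [Prod.fst_add, Prod.snd_add, _root_.map_add]
          abel
      map_smul' := fun c q => by
        ext <;> simp [smul_sub, smul_add] }
  let L : Submodule ℂ (H × H) := B.graph.comap F ⊓ N.prod N
  have hLmem : ∀ a b, (a, b) ∈ L ↔
      (R b + a, b - P (R b + a)) ∈ B.graph ∧ a ∈ N ∧ b ∈ N := fun a b => Iff.rfl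
  have hLN : ∀ q ∈ L, q.1 ∈ N ∧ q.2 ∈ N := fun q hq => hq.2
  have htr : ∀ p ∈ T†.graph, p ∈ B.graph ↔
      (p.1 - R (p.2 + P p.1), N.starProjection (p.2 + P p.1)) ∈ L := by
    intro p hp
    set y := p.2 + P p.1 with hy
    have h1 : (R (y - N.starProjection y), _) ∈ T.closure.graph :=
      h.mem_closure_of_orthogonal (y := y - N.starProjection y) fun n hn =>
        Submodule.inner_right_of_mem_orthogonal hn (Submodule.sub_starProjection_mem_orthogonal y)
    have h2 := hcB h1
    -- An element of the graph of `T†` is an element of the graph of the closure plus `F` of its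
    -- boundary values. The first summand is in `B`, so membership in `B` depends only on the
    -- second.
    have h3 : p = (R (y - N.starProjection y),
        y - N.starProjection y - P (R (y - N.starProjection y))) +
        F (p.1 - R y, N.starProjection y) := by
      ext
      · simp only [F, LinearMap.coe_mk, AddHom.coe_mk, Prod.fst_add, _root_.map_sub]
        abel
      · simp only [F, LinearMap.coe_mk, AddHom.coe_mk, Prod.snd_add, _root_.map_add,
          _root_.map_sub, hy]
        abel
    rw [hLmem, and_iff_left ⟨h.sub_mem hp, Submodule.starProjection_apply_mem _ _⟩]
    nth_rewrite 1 [h3]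
    exact B.graph.add_mem_iff_right h2
  refine ⟨L, ?_, ?_⟩
  · apply eq_of_eq_graph
    ext p
    constructor
    · intro hp
      have hp' := ((mem_relationExtension_graph_iff _ _).mp hp).1
      rw [htr p hp', ← h.mem_relationExtension_iff_trace hLN hp']
      exact hp
    · intro hp
      rwa [h.mem_relationExtension_iff_trace hLN (hBT hp), ← htr p (hBT hp)]
  · intro a b
    constructor
    · intro hab
      have hF := ((hLmem a b).mp hab).1
      refine ⟨hab.2.1, hab.2.2, ?_⟩
      rintro ⟨a', b'⟩ hab'
      have hF' := ((hLmem a' b').mp hab').1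
      have h1 := (hBg _).mp hF _ hF'
      rw [h.inner_eq_iff_trace (hBT hF) (hBT hF')] at h1
      simp only [sub_add_cancel, add_sub_cancel_left] at h1
      rwa [Submodule.starProjection_eq_self_iff.mpr hab.2.2,
        Submodule.starProjection_eq_self_iff.mpr hab'.2.2] at h1
    · rintro ⟨ha, hb, hab⟩
      refine (hLmem a b).mpr ⟨?_, ha, hb⟩
      have hF := h.add_mem_graph (b := b) ha
      rw [hBg]
      intro q hq
      rw [h.inner_eq_iff_trace hF (hBT hq)]
      simp only [sub_add_cancel, add_sub_cancel_left]
      rw [Submodule.starProjection_eq_self_iff.mpr hb]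
      exact hab _ ((htr q (hBT hq)).mp hq)

/-- The Kreĭn–Višik–Birman correspondence between the self-adjoint operators in Hilbert subspaces
of `ker (T† + P)` and the self-adjoint extensions of `T`. -/
theorem exists_equiv_extensions :
    ∃ e : SelfAdjointInSubspace N ≃ {B : H →ₗ.[ℂ] H // T ≤ B ∧ IsSelfAdjoint B},
      ∀ S : SelfAdjointInSubspace N,
        (∀ ψ : H, ψ ∈ (e S).1.domain ↔
          ∃ (φ : T.closure.domain) (v : S.op.domain) (w : H), w ∈ N ∧
            (∀ u : S.op.domain, inner ℂ ((u : S.space) : H) w = 0) ∧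
            ψ = φ + R ((S.op v : H) + w) + ((v : S.space) : H)) ∧
        (∀ (φ : T.closure.domain) (v : S.op.domain) (w : H), w ∈ N →
          (∀ u : S.op.domain, inner ℂ ((u : S.space) : H) w = 0) →
          ∀ ψ : (e S).1.domain,
            (ψ : H) = φ + R ((S.op v : H) + w) + ((v : S.space) : H) →
            (e S).1 ψ + P ψ = (T.closure φ + P φ) + (S.op v : H) + w) := by
  have : CompleteSpace N := h.isClosed_space.completeSpace_coe
  have hLN : ∀ (S : SelfAdjointInSubspace N), ∀ q ∈ S.relation, q.1 ∈ N ∧ q.2 ∈ N := fun S q hq =>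
    ⟨((S.mem_relation_iff_inner q.1 q.2).mp hq).1, ((S.mem_relation_iff_inner q.1 q.2).mp hq).2.1⟩
  let f : SelfAdjointInSubspace N → {B : H →ₗ.[ℂ] H // T ≤ B ∧ IsSelfAdjoint B} := fun S =>
    ⟨relationExtension T R S.relation, h.le_relationExtension,
      h.isSelfAdjoint_relationExtension S.mem_relation_iff_inner⟩
  have hf : Function.Bijective f := by
    constructor
    · intro S S' hS
      have hS' : relationExtension T R S.relation = relationExtension T R S'.relation :=
        congrArg Subtype.val hS
      exact SelfAdjointInSubspace.relation_injective (le_antisymm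
        (h.relationExtension_injOn (hLN S) (hLN S') hS')
        (h.relationExtension_injOn (hLN S') (hLN S) hS'.symm))
    · rintro ⟨B, hTB, hB⟩
      obtain ⟨L, hL, hL'⟩ := h.exists_relationExtension_eq hTB hB
      obtain ⟨S, hS⟩ := SelfAdjointInSubspace.exists_relation_eq h.isClosed_space L hL'
      exact ⟨S, Subtype.ext ((congrArg _ hS).trans hL)⟩
  refine ⟨Equiv.ofBijective f hf, fun S => ⟨fun ψ => ?_, fun φ v w hw hu ψ hψ => ?_⟩⟩
  · change ψ ∈ (relationExtension T R S.relation).domain ↔ _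
    rw [mem_domain_iff]
    constructor
    · rintro ⟨y, hy⟩
      obtain ⟨-, φ, hφ, ⟨a, b⟩, ⟨v, w, hw, hu, h1, h2⟩, h3⟩ :=
        (mem_relationExtension_graph_iff _ _).mp hy
      simp only at h1 h2 h3
      exact ⟨⟨φ, hφ⟩, v, w, hw, hu, by rw [h3, h1, h2]⟩
    · rintro ⟨φ, v, w, hw, hu, rfl⟩
      have h1 := h.closure_graph_le (mem_graph _ φ)
      have h2 := h.add_mem_graph (b := (S.op v : H) + w) (S.space_le (v : S.space).2)
      have h3 := T†.graph.add_mem h1 h2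
      rw [add_assoc]
      exact ⟨_, (mem_relationExtension_graph_iff _ _).mpr ⟨h3, φ, φ.2,
        (((v : S.space) : H), (S.op v : H) + w), ⟨v, w, hw, hu, rfl, rfl⟩,
        (add_assoc _ _ _).symm⟩⟩
  · have h1 := h.closure_graph_le (mem_graph _ φ)
    have h2 := h.add_mem_graph (b := (S.op v : H) + w) (S.space_le (v : S.space).2)
    have h3 := T†.graph.add_mem h1 h2
    have h4 := ((mem_relationExtension_graph_iff _ _).mp
      (mem_graph (relationExtension T R S.relation) ψ)).1
    have h5 := mem_graph_snd_inj _ h4 h3 (by rw [hψ]; simp [add_assoc])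
    have h6 : ((Equiv.ofBijective f hf) S).1 ψ = _ := h5
    rw [h6, hψ]
    simp only [_root_.map_add]
    abel

end IsBirmanInverse

theorem exists_birman_correspondence (T : H →ₗ.[ℂ] H) (P : H →ₗ[ℂ] H)
    (hd : Dense (T.domain : Set H)) (hT : T.IsFormalAdjoint T) (hP : P.IsSymmetric) {m : ℝ}
    (hm : 0 < m) (hb : ∀ x : T.domain, m * ‖(x : H)‖ ^ 2 ≤ (inner ℂ (x : H) (T x + P x)).re) :
    ∃ R : H →L[ℂ] H, IsBoundedInverse (P +ᵥ friedrichs T) R ∧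
      IsBirmanInverse T P R (opKer (P +ᵥ T†)) := by
  obtain ⟨R, hRs, hR⟩ := exists_friedrichs_inverse T P hd hT hP hm hb
  refine ⟨R, hR, hd, hT, hP, hRs, fun x => ?_, fun y => ?_, fun x => ?_⟩
  · rw [mem_opKer_iff, mem_graph_iff]
    constructor
    · rintro ⟨hx, h0⟩
      rw [vadd_apply] at h0
      exact ⟨⟨x, hx⟩, rfl, eq_neg_of_add_eq_zero_right h0⟩
    · rintro ⟨⟨x', hx⟩, rfl, h0⟩
      refine ⟨hx, ?_⟩
      rw [vadd_apply]
      exact (congrArg (P x' + ·) h0).trans (add_neg_cancel _)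
  · obtain ⟨hy, h0⟩ := hR.1 y
    have hy2 : R y ∈ T†.domain := hy.2
    rw [vadd_apply] at h0
    have h1 : friedrichs T ⟨R y, hy⟩ = T† ⟨R y, hy2⟩ := domRestrict_apply (f := T†) rfl
    rw [mem_graph_iff]
    refine ⟨⟨R y, hy2⟩, rfl, ?_⟩
    rw [← h1, eq_sub_iff_add_eq, add_comm]
    exact h0
  · have hle := hT.le_adjoint hd
    have hx : (x : H) ∈ (friedrichs T).domain := by
      refine ⟨Submodule.subset_span ⟨fun _ => x, tendsto_const_nhds, ?_⟩, hle.1 x.2⟩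
      simp
    have h1 : friedrichs T ⟨x, hx⟩ = T† ⟨x, hle.1 x.2⟩ := domRestrict_apply (f := T†) rfl
    have h2 : T x = T† ⟨x, hle.1 x.2⟩ := hle.2 rfl
    have h3 := hR.2 ⟨x, hx⟩
    rw [vadd_apply] at h3
    rw [h2, ← h1, add_comm]
    exact h3

end BirmanExtension

/-! ### Test functions and the quadratic form on one fibre -/

section FibreTest

/-- Elements of `C_c^∞(ℝ ∖ {0})`. -/
structure IsFibreTest (f : ℝ → ℂ) : Prop where
  smooth : ContDiff ℝ ∞ f
  support : ∃ K : Set ℝ, IsCompact K ∧ (0 : ℝ) ∉ K ∧ ∀ x ∉ K, f x = 0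

/-- The potential `k²|x|^{2α} + α(2+α)/(4x²)`. -/
noncomputable def modePotential (α : ℝ) (k : ℤ) (x : ℝ) : ℝ :=
  (k : ℝ) ^ 2 * |x| ^ (2 * α) + α * (2 + α) / (4 * x ^ 2)

theorem fibreExpr_eq (α : ℝ) (k : ℤ) (f : ℝ → ℂ) (x : ℝ) :
    fibreExpr α k f x = -deriv (deriv f) x + (modePotential α k x : ℂ) * f x := rfl

namespace IsFibreTest

variable {f g : ℝ → ℂ}

theorem hasCompactSupport (hf : IsFibreTest f) : HasCompactSupport f := by
  obtain ⟨K, hK, -, h⟩ := hf.support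
  exact HasCompactSupport.intro hK h

theorem eventually_eq_zero (hf : IsFibreTest f) : ∀ᶠ x in 𝓝 (0 : ℝ), f x = 0 := by
  obtain ⟨K, hK, h0, h⟩ := hf.support
  filter_upwards [hK.isClosed.isOpen_compl.mem_nhds h0] with x hx using h x hx

theorem differentiable (hf : IsFibreTest f) : Differentiable ℝ f := hf.smooth.differentiable (by simp)

theorem deriv (hf : IsFibreTest f) : IsFibreTest (deriv f) := by
  refine ⟨(contDiff_infty_iff_deriv.mp hf.smooth).2, ?_⟩
  obtain ⟨K, hK, h0, h⟩ := hf.support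
  refine ⟨K, hK, h0, fun x hx => ?_⟩
  have : f =ᶠ[𝓝 x] fun _ => 0 := by
    filter_upwards [hK.isClosed.isOpen_compl.mem_nhds hx] with y hy using h y hy
  rw [this.deriv_eq, deriv_const]

theorem of_real {g : ℝ → ℝ} (hg : ContDiff ℝ ∞ g) (hc : HasCompactSupport g)
    (h0 : (0 : ℝ) ∉ tsupport g) : IsFibreTest (fun x => (g x : ℂ)) :=
  ⟨Complex.ofRealCLM.contDiff.comp hg, tsupport g, hc, h0, fun x hx => by
    rw [image_eq_zero_of_notMem_tsupport hx, Complex.ofReal_zero]⟩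

/-- Test functions vanish near `0`, so a singularity of `V` there is harmless. -/
theorem continuous_mul (hf : IsFibreTest f) {V : ℝ → ℂ} (hV : ∀ x ≠ 0, ContinuousAt V x) :
    Continuous (fun x => V x * f x) := by
  rw [continuous_iff_continuousAt]
  intro x
  by_cases hx : x = 0
  · subst hx
    have : (fun x => V x * f x) =ᶠ[𝓝 0] fun _ => 0 := by
      filter_upwards [hf.eventually_eq_zero] with x hx
      rw [hx, mul_zero]
    exact continuousAt_const.congr this.symm
  · exact (hV x hx).mul hf.smooth.continuous.continuousAt

end IsFibreTest

theorem continuousAt_modePotential (α : ℝ) (k : ℤ) {x : ℝ} (hx : x ≠ 0) :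
    ContinuousAt (modePotential α k) x := by
  unfold modePotential
  refine ContinuousAt.add ?_ ?_
  · exact continuousAt_const.mul
      (continuous_abs.continuousAt.rpow_const (Or.inl (abs_ne_zero.mpr hx)))
  · exact continuousAt_const.div (by fun_prop) (by positivity)

variable {f g : ℝ → ℂ} (α : ℝ) (k : ℤ)

theorem IsFibreTest.continuous_potential_mul (hf : IsFibreTest f) :
    Continuous (fun x => (modePotential α k x : ℂ) * f x) :=
  hf.continuous_mul fun _ hx =>
    Complex.continuous_ofReal.continuousAt.comp (continuousAt_modePotential α k hx)

theorem IsFibreTest.continuous_fibreExpr (hf : IsFibreTest f) : Continuous (fibreExpr α k f) :=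
  hf.deriv.deriv.smooth.continuous.neg.add (hf.continuous_potential_mul α k)

theorem IsFibreTest.hasCompactSupport_fibreExpr (hf : IsFibreTest f) :
    HasCompactSupport (fibreExpr α k f) :=
  HasCompactSupport.add hf.deriv.deriv.hasCompactSupport.neg hf.hasCompactSupport.mul_left

theorem IsFibreTest.memLp (hf : IsFibreTest f) : MemLp f 2 volume :=
  hf.smooth.continuous.memLp_of_hasCompactSupport hf.hasCompactSupport

theorem IsFibreTest.memLp_fibreExpr (hf : IsFibreTest f) : MemLp (fibreExpr α k f) 2 volume :=
  (hf.continuous_fibreExpr α k).memLp_of_hasCompactSupport (hf.hasCompactSupport_fibreExpr α k)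

open ComplexConjugate in
-- Integration by parts without boundary terms. The right-hand side is Hermitian in `f` and `g`,
-- which gives both symmetry and the lower bound.
theorem integral_conj_mul_fibreExpr (hf : IsFibreTest f) (hg : IsFibreTest g) :
    ∫ x, conj (f x) * fibreExpr α k g x =
      ∫ x, (conj (deriv f x) * deriv g x + conj (f x) * ((modePotential α k x : ℂ) * g x)) := by
  have hcf : Continuous fun x => conj (f x) := Complex.continuous_conj.comp hf.smooth.continuous
  have hcf' : Continuous fun x => conj (deriv f x) :=
    Complex.continuous_conj.comp hf.deriv.smooth.continuous
  have hsf : HasCompactSupport fun x => conj (f x) :=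
    hf.hasCompactSupport.comp_left (map_zero _)
  have hsf' : HasCompactSupport fun x => conj (deriv f x) :=
    hf.deriv.hasCompactSupport.comp_left (map_zero _)
  have i1 : Integrable fun x => conj (f x) * deriv (deriv g) x :=
    (hcf.mul hg.deriv.deriv.smooth.continuous).integrable_of_hasCompactSupport hsf.mul_right
  have i2 : Integrable fun x => conj (deriv f x) * deriv g x :=
    (hcf'.mul hg.deriv.smooth.continuous).integrable_of_hasCompactSupport hsf'.mul_right
  have i3 : Integrable fun x => conj (f x) * deriv g x :=
    (hcf.mul hg.deriv.smooth.continuous).integrable_of_hasCompactSupport hsf.mul_right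
  have i4 : Integrable fun x => conj (f x) * ((modePotential α k x : ℂ) * g x) :=
    (hcf.mul (hg.continuous_potential_mul α k)).integrable_of_hasCompactSupport hsf.mul_right
  have key := integral_mul_deriv_eq_deriv_mul_of_integrable (u := fun x => conj (f x))
    (v := deriv g) (u' := fun x => conj (deriv f x)) (v' := deriv (deriv g))
    (fun x _ => (Complex.conjCLE.hasFDerivAt.comp_hasDerivAt x (hf.differentiable x).hasDerivAt))
    (fun x _ => (hg.deriv.differentiable x).hasDerivAt) i1 i2 i3
  rw [integral_add i2 i4, ← neg_eq_iff_eq_neg.mpr key, ← integral_neg,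
    ← integral_add (f := fun x => -(conj (f x) * deriv (deriv g) x)) i1.neg i4]
  refine integral_congr_ae (Eventually.of_forall fun x => ?_)
  simp only [fibreExpr_eq]
  ring

open ComplexConjugate in
theorem Fibre.inner_eq_integral {u v : Fibre} (hu : (u : ℝ → ℂ) =ᵐ[volume] f)
    (hv : (v : ℝ → ℂ) =ᵐ[volume] g) : inner ℂ u v = ∫ x, conj (f x) * g x := by
  rw [L2.inner_def]
  refine integral_congr_ae ?_
  filter_upwards [hu, hv] with x h1 h2
  rw [h1, h2, RCLike.inner_apply, mul_comm]

open ComplexConjugate in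
theorem integral_conj_fibreExpr_mul (hf : IsFibreTest f) (hg : IsFibreTest g) :
    ∫ x, conj (fibreExpr α k f x) * g x = ∫ x, conj (f x) * fibreExpr α k g x := by
  have h1 : ∫ x, conj (fibreExpr α k f x) * g x =
      conj (∫ x, conj (g x) * fibreExpr α k f x) := by
    rw [← integral_conj]
    refine integral_congr_ae (Eventually.of_forall fun x => ?_)
    simp [mul_comm]
  rw [h1, integral_conj_mul_fibreExpr α k hg hf, integral_conj_mul_fibreExpr α k hf hg,
    ← integral_conj]
  refine integral_congr_ae (Eventually.of_forall fun x => ?_)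
  simp only [_root_.map_add, map_mul, Complex.conj_conj, Complex.conj_ofReal]
  ring

open ComplexConjugate in
theorem le_re_integral_conj_mul_fibreExpr {m : ℝ} (hm : ∀ x ≠ 0, m ≤ modePotential α k x)
    (hf : IsFibreTest f) :
    m * ∫ x, ‖f x‖ ^ 2 ≤ (∫ x, conj (f x) * fibreExpr α k f x).re := by
  have i2 : Integrable fun x => ‖f x‖ ^ 2 := hf.memLp.integrable_norm_pow (by simp)
  have hcont : Continuous fun x =>
      (conj (deriv f x) * deriv f x + conj (f x) * ((modePotential α k x : ℂ) * f x)) :=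
    ((Complex.continuous_conj.comp hf.deriv.smooth.continuous).mul
      hf.deriv.smooth.continuous).add ((Complex.continuous_conj.comp hf.smooth.continuous).mul
      (hf.continuous_potential_mul α k))
  have hsupp : HasCompactSupport fun x =>
      (conj (deriv f x) * deriv f x + conj (f x) * ((modePotential α k x : ℂ) * f x)) :=
    hf.deriv.hasCompactSupport.mul_left.add hf.hasCompactSupport.mul_left.mul_left
  have i1 := hcont.integrable_of_hasCompactSupport hsupp (μ := volume)
  rw [integral_conj_mul_fibreExpr α k hf hf, ← RCLike.re_to_complex, ← integral_re i1,
    ← integral_const_mul]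
  refine integral_mono_ae (i2.const_mul m) i1.re ?_
  have h0 : ∀ᵐ x : ℝ, x ≠ 0 := by simp [ae_iff, measure_singleton]
  filter_upwards [h0] with x hx
  have e : ∀ z : ℂ, conj z * z = ((‖z‖ ^ 2 : ℝ) : ℂ) := fun z => by
    rw [mul_comm, Complex.mul_conj, Complex.normSq_eq_norm_sq]
  have h1 : conj (f x) * ((modePotential α k x : ℂ) * f x) =
      ((modePotential α k x * ‖f x‖ ^ 2 : ℝ) : ℂ) := by
    rw [mul_left_comm, e, ← Complex.ofReal_mul]
  rw [h1, e, ← Complex.ofReal_add, RCLike.re_to_complex, Complex.ofReal_re]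
  have := mul_le_mul_of_nonneg_right (hm x hx) (sq_nonneg ‖f x‖)
  have := sq_nonneg ‖deriv f x‖
  linarith

end FibreTest

/-! ### Partial Fourier transform and single modes -/

section PartialFourier

theorem contDiff_integral_of_smooth (a b : ℝ) {G : ℝ × ℝ → ℂ} (hG : ContDiff ℝ ∞ G) :
    ContDiff ℝ ∞ (fun x => ∫ y in a..b, G (x, y)) := by
  rw [contDiff_infty]
  intro n
  induction n generalizing G with
  | zero =>
    rw [Nat.cast_zero, contDiff_zero]
    exact continuous_iff_continuousAt.mpr fun x =>
      (hasDerivAt_integral_of_smooth hG a b x).continuousAt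
  | succ n ih =>
    have hG' : ContDiff ℝ ∞ (fun p : ℝ × ℝ => fderiv ℝ G p (1, 0)) :=
      (hG.fderiv_right (m := ∞) (by simp)).clm_apply contDiff_const
    rw [Nat.cast_add, Nat.cast_one, contDiff_succ_iff_deriv]
    refine ⟨fun x => (hasDerivAt_integral_of_smooth hG a b x).differentiableAt, by simp, ?_⟩
    rw [funext fun x => (hasDerivAt_integral_of_smooth hG a b x).deriv]
    exact ih hG'

theorem IsCylinderTest.isFibreTest_partialFourier {φ : ℝ × ℝ → ℂ} (hφ : IsCylinderTest φ) (k : ℤ) :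
    IsFibreTest (partialFourier φ k) := by
  refine ⟨contDiff_integral_of_smooth _ _ (contDiff_conj_fourierMode_mul hφ.smooth k), ?_⟩
  obtain ⟨K, hK, h0, h⟩ := hφ.support
  refine ⟨K, hK, h0, fun x hx => ?_⟩
  simp [partialFourier, h x hx]

theorem fourierMode_periodic (k : ℤ) (y : ℝ) :
    fourierMode k (y + 2 * Real.pi) = fourierMode k y := by
  unfold fourierMode
  congr 1
  rw [Complex.exp_eq_exp_iff_exists_int]
  exact ⟨k, by push_cast; ring⟩

theorem contDiff_fourierMode (k : ℤ) : ContDiff ℝ ∞ (fourierMode k) := by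
  unfold fourierMode
  refine ContDiff.div_const (Complex.contDiff_exp.comp ?_) _
  exact contDiff_const.mul Complex.ofRealCLM.contDiff

open ComplexConjugate in
theorem integral_conj_fourierMode_mul (k l : ℤ) :
    ∫ y in (0 : ℝ)..(2 * Real.pi), conj (fourierMode l y) * fourierMode k y =
      if l = k then 1 else 0 := by
  have hpi : (Real.sqrt (2 * Real.pi) : ℂ) * (Real.sqrt (2 * Real.pi) : ℂ) = 2 * Real.pi := by
    rw [← Complex.ofReal_mul, Real.mul_self_sqrt (by positivity)]
    push_cast
    ring
  have hpi0 : (Real.pi : ℂ) ≠ 0 := Complex.ofReal_ne_zero.mpr Real.pi_ne_zero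
  have h1 : ∀ y : ℝ, conj (fourierMode l y) * fourierMode k y =
      (2 * Real.pi : ℂ)⁻¹ * Complex.exp ((Complex.I * (k - l)) * y) := by
    intro y
    unfold fourierMode
    rw [map_div₀, ← Complex.exp_conj, Complex.conj_ofReal, div_mul_div_comm, hpi,
      ← Complex.exp_add, div_eq_inv_mul]
    congr 2
    simp
    ring
  simp only [h1]
  rw [intervalIntegral.integral_const_mul]
  split_ifs with h
  · subst h
    simp
    field_simp
  · have hne : Complex.I * ((k : ℂ) - l) ≠ 0 := by
      refine mul_ne_zero Complex.I_ne_zero (sub_ne_zero.mpr ?_)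
      exact_mod_cast Ne.symm h
    rw [integral_exp_mul_complex hne]
    have : Complex.exp (Complex.I * ((k : ℂ) - l) * ((2 * Real.pi : ℝ) : ℂ)) = 1 := by
      rw [Complex.exp_eq_one_iff]
      exact ⟨k - l, by push_cast; ring⟩
    rw [this]
    simp

/-- These product functions have a single nonzero Fourier coefficient and allow each fibre to be
tested separately. -/
theorem IsFibreTest.isCylinderTest_mode {f : ℝ → ℂ} (hf : IsFibreTest f) (k : ℤ) :
    IsCylinderTest (fun p => f p.1 * fourierMode k p.2) := by
  refine ⟨(hf.smooth.comp contDiff_fst).mul ((contDiff_fourierMode k).comp contDiff_snd),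
    fun x y => by simp only [fourierMode_periodic], ?_⟩
  obtain ⟨K, hK, h0, h⟩ := hf.support
  exact ⟨K, hK, h0, fun x hx y => by simp [h x hx]⟩

theorem partialFourier_mode (f : ℝ → ℂ) (k l : ℤ) :
    partialFourier (fun p => f p.1 * fourierMode k p.2) l = if l = k then f else 0 := by
  funext x
  unfold partialFourier
  simp only [mul_left_comm _ (f x)]
  rw [intervalIntegral.integral_const_mul, integral_conj_fourierMode_mul]
  split_ifs <;> simp

end PartialFourier

/-! ### Symmetry, density, lower bound, and fibrewise form of the deficiency equation -/

section GrushinOperator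

variable (α : ℝ)

theorem mem_grushin_graph_iff (p : FibredSpace × FibredSpace) :
    p ∈ (grushin α).graph ↔ ∃ φ : ℝ × ℝ → ℂ, IsCylinderTest φ ∧ ∀ k : ℤ,
      (p.1 k : ℝ → ℂ) =ᵐ[volume] partialFourier φ k ∧
      (p.2 k : ℝ → ℂ) =ᵐ[volume] fibreExpr α k (partialFourier φ k) := by
  rw [grushin_graph]
  rfl

theorem exists_fibreTest (x : (grushin α).domain) (k : ℤ) : ∃ f : ℝ → ℂ, IsFibreTest f ∧
    ((x : FibredSpace) k : ℝ → ℂ) =ᵐ[volume] f ∧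
    (grushin α x k : ℝ → ℂ) =ᵐ[volume] fibreExpr α k f := by
  obtain ⟨φ, hφ, h⟩ := (mem_grushin_graph_iff α _).mp (mem_graph (grushin α) x)
  exact ⟨_, hφ.isFibreTest_partialFourier k, (h k).1, (h k).2⟩

theorem single_mem_grushin_graph (k : ℤ) {f : ℝ → ℂ} (hf : IsFibreTest f) :
    ((lp.single 2 k (hf.memLp.toLp f), lp.single 2 k ((hf.memLp_fibreExpr α k).toLp _)) :
      FibredSpace × FibredSpace) ∈ (grushin α).graph := by
  rw [mem_grushin_graph_iff]
  refine ⟨_, hf.isCylinderTest_mode k, fun l => ?_⟩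
  rw [partialFourier_mode]
  by_cases h : l = k
  · subst h
    simp only [lp.single_apply_self, if_true]
    exact ⟨MemLp.coeFn_toLp _, MemLp.coeFn_toLp _⟩
  · have h0 : fibreExpr α l (0 : ℝ → ℂ) = 0 := by
      simpa using fibreExpr_smul α l 0 (0 : ℝ → ℂ)
    simp only [lp.single_apply_ne _ _ _ h, if_neg h, h0]
    exact ⟨Lp.coeFn_zero _ _ _, Lp.coeFn_zero _ _ _⟩

theorem grushin_isFormalAdjoint : (grushin α).IsFormalAdjoint (grushin α) := by
  intro x y
  refine (lp.hasSum_inner _ _).unique ?_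
  convert lp.hasSum_inner (𝕜 := ℂ) (x : FibredSpace) (grushin α y) using 2 with k
  obtain ⟨f, hf, hf1, hf2⟩ := exists_fibreTest α x k
  obtain ⟨g, hg, hg1, hg2⟩ := exists_fibreTest α y k
  rw [Fibre.inner_eq_integral hf2 hg1, Fibre.inner_eq_integral hf1 hg2,
    integral_conj_fibreExpr_mul α k hf hg]

theorem zeroMode_apply (ψ : FibredSpace) : zeroMode ψ = lp.single 2 (0 : ℤ) (ψ 0) := rfl

theorem zeroMode_isSymmetric : zeroMode.IsSymmetric := by
  intro x y
  rw [zeroMode_apply, zeroMode_apply, lp.inner_single_left, lp.inner_single_right]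

/-- For `α > 0` the growing term is at least `1` where `|x| ≥ 1`, and the inverse square term is at
least `α(2+α)/4` where `|x| ≤ 1`. For `α = 0` the potential is `k² ≥ 1`. The bound `m ≤ 1` is kept
so that the same `m` serves the fibre `k = 0`. -/
theorem exists_pos_le_modePotential {α : ℝ} (hα : 0 ≤ α) :
    ∃ m : ℝ, 0 < m ∧ m ≤ 1 ∧ ∀ k : ℤ, k ≠ 0 → ∀ x ≠ 0, m ≤ modePotential α k x := by
  have hk : ∀ k : ℤ, k ≠ 0 → (1 : ℝ) ≤ (k : ℝ) ^ 2 := by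
    intro k hk
    have : 1 ≤ k ^ 2 := Order.one_le_iff_pos.mpr (by positivity)
    exact_mod_cast this
  rcases hα.eq_or_lt with rfl | hα0
  · refine ⟨1, one_pos, le_rfl, fun k hk0 x hx => ?_⟩
    simpa [modePotential] using hk k hk0
  · refine ⟨min 1 (α * (2 + α) / 4), by positivity, min_le_left _ _, fun k hk0 x hx => ?_⟩
    unfold modePotential
    have hx2 : 0 < x ^ 2 := by positivity
    rcases le_total 1 |x| with h | h
    · have h1 : 1 ≤ |x| ^ (2 * α) := Real.one_le_rpow h (by positivity)
      have h2 : 0 ≤ α * (2 + α) / (4 * x ^ 2) := by positivity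
      have h3 := one_le_mul_of_one_le_of_one_le (hk k hk0) h1
      exact (min_le_left _ _).trans (by linarith)
    · have h1 : 0 ≤ (k : ℝ) ^ 2 * |x| ^ (2 * α) := by positivity
      have h2 : x ^ 2 ≤ 1 := by rw [← sq_abs]; exact pow_le_one₀ (abs_nonneg x) h
      have h3 : α * (2 + α) / 4 ≤ α * (2 + α) / (4 * x ^ 2) := by gcongr; linarith
      exact (min_le_right _ _).trans (by linarith)

theorem modePotential_nonneg {α : ℝ} (hα : 0 ≤ α) (k : ℤ) (x : ℝ) : 0 ≤ modePotential α k x := by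
  unfold modePotential
  positivity

theorem exists_lower_bound_grushin {α : ℝ} (hα : 0 ≤ α) : ∃ m : ℝ, 0 < m ∧
    ∀ x : (grushin α).domain, m * ‖(x : FibredSpace)‖ ^ 2 ≤
      (inner ℂ (x : FibredSpace) (grushin α x + zeroMode x)).re := by
  obtain ⟨m, hm, hm1, hV⟩ := exists_pos_le_modePotential hα
  refine ⟨m, hm, fun x => ?_⟩
  have h1 : HasSum (fun k => m * ‖(x : FibredSpace) k‖ ^ 2) (m * ‖(x : FibredSpace)‖ ^ 2) := by
    have := (lp.hasSum_inner (𝕜 := ℂ) (x : FibredSpace) (x : FibredSpace)).mapL Complex.reCLM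
    simp only [Complex.reCLM_apply, ← RCLike.re_to_complex, inner_self_eq_norm_sq] at this
    exact this.mul_left m
  have h2 := (lp.hasSum_inner (𝕜 := ℂ) (x : FibredSpace) (grushin α x + zeroMode x)).mapL
    Complex.reCLM
  refine hasSum_le (fun k => ?_) h1 h2
  obtain ⟨f, hf, hf1, hf2⟩ := exists_fibreTest α x k
  have hn : ‖(x : FibredSpace) k‖ ^ 2 = ∫ t, ‖f t‖ ^ 2 := by
    have h3 := inner_self_eq_norm_sq (𝕜 := ℂ) ((x : FibredSpace) k)
    rw [Fibre.inner_eq_integral hf1 hf1] at h3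
    rw [← h3]
    have h4 : ∀ t, (starRingEnd ℂ) (f t) * f t = ((‖f t‖ ^ 2 : ℝ) : ℂ) := fun t => by
      rw [mul_comm, Complex.mul_conj, Complex.normSq_eq_norm_sq]
    simp only [h4]
    rw [integral_complex_ofReal]
    rfl
  have hin : (inner ℂ ((x : FibredSpace) k) (grushin α x k)).re =
      (∫ t, (starRingEnd ℂ) (f t) * fibreExpr α k f t).re := by
    rw [Fibre.inner_eq_integral hf1 hf2]
  rw [Complex.reCLM_apply, lp.coeFn_add, Pi.add_apply, inner_add_right, Complex.add_re, hin]
  -- On this fibre the potential need not have a positive lower bound. Positivity comes from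
  -- `zeroMode`, which adds the full squared norm.
  by_cases hk : k = 0
  · subst hk
    have h3 := le_re_integral_conj_mul_fibreExpr α 0 (fun x _ => modePotential_nonneg hα 0 x) hf
    rw [zeroMode_apply, lp.single_apply_self, ← RCLike.re_to_complex (x := inner ℂ _ _),
      inner_self_eq_norm_sq]
    have h4 := mul_le_mul_of_nonneg_right hm1 (sq_nonneg ‖(x : FibredSpace) 0‖)
    linarith
  · have h3 := le_re_integral_conj_mul_fibreExpr α k (hV k hk) hf
    rw [zeroMode_apply, lp.single_apply_ne _ _ _ hk, inner_zero_right, Complex.zero_re, hn]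
    linarith

theorem Fibre.eq_zero_of_forall_integral_eq_zero {u : Fibre}
    (h : ∀ f, IsFibreTest f → ∫ x, (starRingEnd ℂ) (f x) * u x = 0) : u = 0 := by
  have h1 : ∀ᵐ x : ℝ, x ∈ ({0}ᶜ : Set ℝ) → u x = 0 := by
    refine isOpen_compl_singleton.ae_eq_zero_of_integral_contDiff_smul_eq_zero
      (((Lp.memLp u).locallyIntegrable (by norm_num)).locallyIntegrableOn _) fun g hg hc hs => ?_
    rw [← h _ (IsFibreTest.of_real hg hc fun h0 => hs h0 rfl)]
    simp
  have h0 : ∀ᵐ x : ℝ, x ≠ 0 := by simp [ae_iff, measure_singleton]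
  refine Lp.ext ?_
  filter_upwards [h1, h0, Lp.coeFn_zero ℂ 2 (volume : Measure ℝ)] with x h1 h2 h3
  rw [h1 h2, h3]
  rfl

theorem dense_grushin_domain : Dense ((grushin α).domain : Set FibredSpace) := by
  rw [Submodule.dense_iff_topologicalClosure_eq_top, Submodule.topologicalClosure_eq_top_iff,
    Submodule.eq_bot_iff]
  intro u hu
  ext1
  funext k
  refine Fibre.eq_zero_of_forall_integral_eq_zero fun f hf => ?_
  have h1 := (Submodule.mem_orthogonal _ _).mp hu _
    (mem_domain_of_mem_graph (single_mem_grushin_graph α k hf))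
  rwa [lp.inner_single_left, Fibre.inner_eq_integral (MemLp.coeFn_toLp _) EventuallyEq.rfl] at h1

/-- `u` solves `-u'' + (V_k + δ_{k0}) u = 0` weakly on `ℝ ∖ {0}`. -/
def IsWeakSolution (k : ℤ) (u : ℝ → ℂ) : Prop :=
  ∀ f, IsFibreTest f →
    ∫ x, (starRingEnd ℂ) (u x) * (fibreExpr α k f x + (if k = 0 then 1 else 0) * f x) = 0

theorem inner_grushin_add_zeroMode (ψ : FibredSpace) {k : ℤ} {f : ℝ → ℂ}
    {χ η : FibredSpace} (hχ : (χ k : ℝ → ℂ) =ᵐ[volume] f)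
    (hη : (η k : ℝ → ℂ) =ᵐ[volume] fibreExpr α k f) :
    inner ℂ (ψ k) ((η + zeroMode χ) k) = ∫ x, (starRingEnd ℂ) (ψ k x) *
      (fibreExpr α k f x + (if k = 0 then 1 else 0) * f x) := by
  refine Fibre.inner_eq_integral EventuallyEq.rfl ?_
  rw [lp.coeFn_add, Pi.add_apply]
  refine (Lp.coeFn_add _ _).trans (hη.add ?_)
  by_cases hk : k = 0
  · subst hk
    rw [zeroMode_apply, lp.single_apply_self]
    simpa using hχ
  · rw [zeroMode_apply, lp.single_apply_ne _ _ _ hk]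
    simp only [hk, if_false, zero_mul]
    exact Lp.coeFn_zero _ _ _

/-- Orthogonality to the range of `T + P` is tested on single modes in one direction. In the other,
it is summed over the Fourier coefficients of an arbitrary element of the domain, all of which are
fibre test functions. -/
theorem mem_deficiencySpace_iff_isWeakSolution {R : FibredSpace →L[ℂ] FibredSpace}
    (hR : IsBirmanInverse (grushin α) zeroMode R (deficiencySpace α)) (ψ : FibredSpace) :
    ψ ∈ deficiencySpace α ↔ ∀ k, IsWeakSolution α k (ψ k) := by
  rw [hR.mem_iff_inner]
  constructor
  · intro h k f hf
    obtain ⟨x, hx1, hx2⟩ := (mem_graph_iff _).mp (single_mem_grushin_graph α k hf)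
    have h1 := h x
    simp only at hx1 hx2
    have hχ : ((x : FibredSpace) k : ℝ → ℂ) =ᵐ[volume] f := by
      rw [hx1, lp.single_apply_self]
      exact MemLp.coeFn_toLp _
    have hη : (grushin α x k : ℝ → ℂ) =ᵐ[volume] fibreExpr α k f := by
      rw [hx2, lp.single_apply_self]
      exact MemLp.coeFn_toLp _
    rw [← inner_grushin_add_zeroMode α ψ hχ hη, ← h1]
    refine (HasSum.unique (lp.hasSum_inner _ _) ?_).symm
    refine hasSum_single k fun l hl => ?_
    have h2 : (grushin α x + zeroMode x) l = 0 := by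
      rw [lp.coeFn_add, Pi.add_apply, hx1, hx2, lp.single_apply_ne _ _ _ hl, zero_add,
        zeroMode_apply]
      by_cases hl0 : l = 0
      · subst hl0
        rw [lp.single_apply_self, lp.single_apply_ne _ _ _ hl]
      · rw [lp.single_apply_ne _ _ _ hl0]
    rw [h2, inner_zero_right]
  · intro h x
    refine (lp.hasSum_inner _ _).unique ?_
    convert hasSum_zero using 2 with k
    obtain ⟨f, hf, hf1, hf2⟩ := exists_fibreTest α x k
    rw [inner_grushin_add_zeroMode α ψ hf1 hf2]
    exact h k f hf

end GrushinOperator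

/-! ### Square integrable weak solutions on the half-line -/

section HalfLine

theorem hasDerivAt_intervalIntegral_of_continuousOn_Ioi {E : Type*} [NormedAddCommGroup E]
    [NormedSpace ℝ E] [CompleteSpace E] {w : ℝ → E} (hw : ContinuousOn w (Set.Ioi 0))
    {a x : ℝ} (ha : 0 < a) (hx : 0 < x) :
    HasDerivAt (fun x => ∫ t in a..x, w t) (w x) x := by
  refine intervalIntegral.integral_hasDerivAt_right (hw.mono ?_).intervalIntegrable
    (hw.stronglyMeasurableAtFilter isOpen_Ioi x hx) (hw.continuousAt (Ioi_mem_nhds hx))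
  intro t ht
  exact (lt_min ha hx).trans_le ht.1

/-- Smoothness of solutions of `F'' = qF + r`. -/
theorem contDiffOn_of_hasDerivAt_of_hasDerivAt {s : Set ℝ} (hs : IsOpen s) {F F' q r : ℝ → ℂ}
    (hF : ∀ x ∈ s, HasDerivAt F (F' x) x) (hF' : ∀ x ∈ s, HasDerivAt F' (q x * F x + r x) x)
    (hq : ContDiffOn ℝ ∞ q s) (hr : ContDiffOn ℝ ∞ r s) : ContDiffOn ℝ ∞ F s := by
  rw [contDiffOn_infty]
  have key : ∀ n : ℕ, ContDiffOn ℝ n F s ∧ ContDiffOn ℝ n F' s := by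
    intro n
    induction n with
    | zero =>
      rw [Nat.cast_zero, contDiffOn_zero, contDiffOn_zero]
      exact ⟨fun x hx => (hF x hx).continuousAt.continuousWithinAt,
        fun x hx => (hF' x hx).continuousAt.continuousWithinAt⟩
    | succ n ih =>
      rw [Nat.cast_add, Nat.cast_one, contDiffOn_succ_iff_deriv_of_isOpen hs,
        contDiffOn_succ_iff_deriv_of_isOpen hs]
      refine ⟨⟨fun x hx => (hF x hx).differentiableAt.differentiableWithinAt, by simp,
        ih.2.congr fun x hx => (hF x hx).deriv⟩,
        fun x hx => (hF' x hx).differentiableAt.differentiableWithinAt, by simp, ?_⟩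
      refine ContDiffOn.congr ?_ fun x hx => (hF' x hx).deriv
      exact ((hq.of_le (mod_cast le_top)).mul ih.1).add (hr.of_le (mod_cast le_top))
  exact fun n => (key n).1

/-- `C_c^∞((0, ∞))`. -/
def halfLineTests : Submodule ℂ (ℝ → ℂ) where
  carrier := {g | ContDiff ℝ ∞ g ∧ ∃ a b, 0 < a ∧ ∀ x ∉ Set.Icc a b, g x = 0}
  zero_mem' := ⟨contDiff_const, 1, 1, one_pos, fun _ _ => rfl⟩
  add_mem' := by
    rintro f g ⟨hf, a, b, ha, h⟩ ⟨hg, a', b', ha', h'⟩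
    refine ⟨hf.add hg, min a a', max b b', lt_min ha ha', fun x hx => ?_⟩
    rw [Pi.add_apply, h, h', add_zero]
    · exact fun hx' => hx ⟨(min_le_right _ _).trans hx'.1, hx'.2.trans (le_max_right _ _)⟩
    · exact fun hx' => hx ⟨(min_le_left _ _).trans hx'.1, hx'.2.trans (le_max_left _ _)⟩
  smul_mem' := by
    rintro c f ⟨hf, a, b, ha, h⟩
    refine ⟨hf.const_smul c, a, b, ha, fun x hx => ?_⟩
    rw [Pi.smul_apply, h x hx, smul_zero]

theorem isFibreTest_of_mem_halfLineTests {g : ℝ → ℂ} (hg : g ∈ halfLineTests) : IsFibreTest g := by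
  obtain ⟨hg, a, b, ha, h⟩ := hg
  exact ⟨hg, Set.Icc a b, isCompact_Icc, fun h0 => ha.not_ge h0.1, h⟩

theorem ofReal_mem_halfLineTests {g : ℝ → ℝ} (hg : ContDiff ℝ ∞ g) (hc : HasCompactSupport g)
    (h0 : tsupport g ⊆ Set.Ioi 0) : (fun x => (g x : ℂ)) ∈ halfLineTests := by
  refine ⟨Complex.ofRealCLM.contDiff.comp hg, ?_⟩
  obtain ⟨b, hb⟩ := hc.isCompact.bddAbove
  have h1 : ∀ᶠ x in 𝓝 (0 : ℝ), x ∉ tsupport g :=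
    (isClosed_tsupport g).isOpen_compl.mem_nhds fun h => lt_irrefl (0 : ℝ) (h0 h)
  obtain ⟨ε, hε, h2⟩ := Metric.eventually_nhds_iff.mp h1
  refine ⟨ε, b, hε, fun x hx => ?_⟩
  have hxs : x ∉ tsupport g := by
    intro hxs
    refine hx ⟨not_lt.mp fun hlt => h2 (y := x) ?_ hxs, hb hxs⟩
    rwa [Real.dist_0_eq_abs, abs_of_pos (h0 hxs)]
  simp [image_eq_zero_of_notMem_tsupport hxs]

theorem integrable_mul_halfLineTests {w g : ℝ → ℂ} (hw : LocallyIntegrableOn w (Set.Ioi 0))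
    (hg : g ∈ halfLineTests) : Integrable (fun x => w x * g x) := by
  obtain ⟨hg, a, b, ha, h⟩ := hg
  have h1 : IntegrableOn (fun x => w x * g x) (Set.Icc a b) :=
    (hw.integrableOn_compact_subset (fun x hx => ha.trans_le hx.1)
      isCompact_Icc).mul_continuousOn hg.continuous.continuousOn isCompact_Icc
  refine (integrableOn_iff_integrable_of_support_subset ?_).mp h1
  intro x hx
  by_contra hc
  exact hx (by simp [h x hc])

/-- The pairing of test functions with a locally integrable function. -/
noncomputable def halfLinePairing (w : ℝ → ℂ) (hw : LocallyIntegrableOn w (Set.Ioi 0)) :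
    halfLineTests →ₗ[ℂ] ℂ where
  toFun g := ∫ x, w x * (g : ℝ → ℂ) x
  map_add' f g := by
    rw [← integral_add (integrable_mul_halfLineTests hw f.2) (integrable_mul_halfLineTests hw g.2)]
    simp [mul_add]
  map_smul' c g := by
    rw [RingHom.id_apply, smul_eq_mul, ← integral_const_mul]
    simp [mul_left_comm]

/-- A positive solution of `Φ'' = qΦ` on `(0, ∞)`. -/
structure IsPositiveSolution (q Φ Φ' : ℝ → ℝ) : Prop where
  smooth : ContDiffOn ℝ ∞ q (Set.Ioi 0)
  nonneg : ∀ x, 0 < x → 0 ≤ q x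
  pos : ∀ x, 0 < x → 0 < Φ x
  hasDerivAt : ∀ x, 0 < x → HasDerivAt Φ (Φ' x) x
  hasDerivAt' : ∀ x, 0 < x → HasDerivAt Φ' (q x * Φ x) x

namespace IsPositiveSolution

variable {q Φ Φ' : ℝ → ℝ}

/-- The second solution `Φ ∫_1^x Φ⁻²`. -/
noncomputable def second (Φ : ℝ → ℝ) (x : ℝ) : ℝ := Φ x * ∫ t in (1 : ℝ)..x, (Φ t ^ 2)⁻¹

/-- The derivative of the second solution. -/
noncomputable def secondDeriv (Φ Φ' : ℝ → ℝ) (x : ℝ) : ℝ :=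
  Φ' x * (∫ t in (1 : ℝ)..x, (Φ t ^ 2)⁻¹) + (Φ x)⁻¹

variable (h : IsPositiveSolution q Φ Φ')
include h

theorem continuousOn : ContinuousOn Φ (Set.Ioi 0) := fun x hx =>
  (h.hasDerivAt x hx).continuousAt.continuousWithinAt

theorem hasDerivAt_integral {x : ℝ} (hx : 0 < x) :
    HasDerivAt (fun x => ∫ t in (1 : ℝ)..x, (Φ t ^ 2)⁻¹) ((Φ x ^ 2)⁻¹) x :=
  hasDerivAt_intervalIntegral_of_continuousOn_Ioi
    ((h.continuousOn.pow 2).inv₀ fun x hx => (pow_pos (h.pos x hx) 2).ne') one_pos hx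

theorem hasDerivAt_second {x : ℝ} (hx : 0 < x) :
    HasDerivAt (second Φ) (secondDeriv Φ Φ' x) x := by
  have := (h.hasDerivAt x hx).mul (h.hasDerivAt_integral hx)
  convert! this using 1
  have := (h.pos x hx).ne'
  rw [secondDeriv]
  field_simp

theorem hasDerivAt_secondDeriv {x : ℝ} (hx : 0 < x) :
    HasDerivAt (secondDeriv Φ Φ') (q x * second Φ x) x := by
  have h1 := ((h.hasDerivAt' x hx).mul (h.hasDerivAt_integral hx)).add
    ((h.hasDerivAt x hx).inv (h.pos x hx).ne')
  convert! h1 using 1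
  have := (h.pos x hx).ne'
  rw [second]
  field_simp
  ring

theorem wronskian {x : ℝ} (hx : 0 < x) : Φ x * secondDeriv Φ Φ' x - Φ' x * second Φ x = 1 := by
  have := (h.pos x hx).ne'
  rw [secondDeriv, second]
  field_simp
  ring

theorem continuousOn_second : ContinuousOn (second Φ) (Set.Ioi 0) := fun _ hx =>
  (h.hasDerivAt_second hx).continuousAt.continuousWithinAt

theorem second_nonneg {x : ℝ} (hx : 1 ≤ x) : 0 ≤ second Φ x := by
  refine mul_nonneg (h.pos x (by linarith)).le (intervalIntegral.integral_nonneg hx fun t ht => ?_)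
  positivity

/-- On `[1, ∞)` the second derivative `q * second Φ` is nonnegative, so the first derivative stays
above its value `(Φ 1)⁻¹` at `1`, where the function itself vanishes. -/
theorem le_second {x : ℝ} (hx : 1 ≤ x) : (Φ 1)⁻¹ * (x - 1) ≤ second Φ x := by
  have hmono : MonotoneOn (secondDeriv Φ Φ') (Set.Ici 1) := by
    refine monotoneOn_of_deriv_nonneg (convex_Ici 1) ?_ ?_ ?_
    · intro x hx
      exact (h.hasDerivAt_secondDeriv (by linarith [hx.out])).continuousAt.continuousWithinAt
    · intro x hx
      rw [interior_Ici] at hx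
      exact (h.hasDerivAt_secondDeriv
        (by linarith [hx.out])).differentiableAt.differentiableWithinAt
    · intro x hx
      rw [interior_Ici] at hx
      have hx0 : 0 < x := by linarith [hx.out]
      rw [(h.hasDerivAt_secondDeriv hx0).deriv]
      exact mul_nonneg (h.nonneg x hx0) (h.second_nonneg hx.out.le)
  have h1 : secondDeriv Φ Φ' 1 = (Φ 1)⁻¹ := by simp [secondDeriv]
  have h2 : second Φ 1 = 0 := by simp [second]
  have h3 := (convex_Ici (1 : ℝ)).mul_sub_le_image_sub_of_le_deriv (f := second Φ)
    (C := (Φ 1)⁻¹) ?_ ?_ ?_ 1 Set.self_mem_Ici x hx hx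
  · rwa [h2, sub_zero] at h3
  · exact h.continuousOn_second.mono fun x hx => by
      have : (1 : ℝ) ≤ x := hx
      exact zero_lt_one.trans_le this
  · intro x hx
    rw [interior_Ici] at hx
    exact (h.hasDerivAt_second (by linarith [hx.out])).differentiableAt.differentiableWithinAt
  · intro x hx
    rw [interior_Ici] at hx
    rw [(h.hasDerivAt_second (by linarith [hx.out])).deriv, ← h1]
    exact hmono Set.self_mem_Ici hx.out.le hx.out.le

theorem locallyIntegrableOn : LocallyIntegrableOn (fun x => (Φ x : ℂ)) (Set.Ioi 0) :=
  (Complex.continuous_ofReal.comp_continuousOn h.continuousOn).locallyIntegrableOn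
    measurableSet_Ioi

theorem locallyIntegrableOn_second : LocallyIntegrableOn (fun x => (second Φ x : ℂ)) (Set.Ioi 0) :=
  (Complex.continuous_ofReal.comp_continuousOn h.continuousOn_second).locallyIntegrableOn
    measurableSet_Ioi

/-- A test function orthogonal to both solutions is of the form `-F'' + qF` for a test function
`F`, by variation of parameters. -/
theorem exists_test_of_orthogonal {g : ℝ → ℂ} (hg : g ∈ halfLineTests)
    (h1 : ∫ x, (Φ x : ℂ) * g x = 0) (h2 : ∫ x, (second Φ x : ℂ) * g x = 0) :
    ∃ F ∈ halfLineTests, ∀ x, 0 < x → -deriv (deriv F) x + (q x : ℂ) * F x = g x := by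
  obtain ⟨hgs, a, b, ha, hab⟩ := hg
  have hcΦ : ContinuousOn (fun x => (Φ x : ℂ) * g x) (Set.Ioi 0) :=
    (Complex.continuous_ofReal.comp_continuousOn h.continuousOn).mul hgs.continuous.continuousOn
  have hcΨ : ContinuousOn (fun x => (second Φ x : ℂ) * g x) (Set.Ioi 0) :=
    (Complex.continuous_ofReal.comp_continuousOn h.continuousOn_second).mul
      hgs.continuous.continuousOn
  -- The base point `a / 2` lies inside the half-line and to the left of the support of `g`.
  -- Integrals from it vanish left of `a`, and right of `b` they equal the full integrals, which are
  -- zero by orthogonality.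
  have ha2 : 0 < a / 2 := by positivity
  let A : ℝ → ℂ := fun x => ∫ t in (a / 2)..x, (Φ t : ℂ) * g t
  let B : ℝ → ℂ := fun x => ∫ t in (a / 2)..x, (second Φ t : ℂ) * g t
  have hA : ∀ x, 0 < x → HasDerivAt A ((Φ x : ℂ) * g x) x := fun x hx =>
    hasDerivAt_intervalIntegral_of_continuousOn_Ioi hcΦ ha2 hx
  have hB : ∀ x, 0 < x → HasDerivAt B ((second Φ x : ℂ) * g x) x := fun x hx =>
    hasDerivAt_intervalIntegral_of_continuousOn_Ioi hcΨ ha2 hx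
  have hzero : ∀ w : ℝ → ℂ, ∫ x, w x * g x = 0 → ∀ x ∉ Set.Icc a b,
      ∫ t in (a / 2)..x, w t * g t = 0 := by
    intro w hw x hx
    by_cases hxa : x < a
    · have : Set.EqOn (fun t => w t * g t) (fun _ => 0) (Set.uIcc (a / 2) x) := by
        intro t ht
        have hta : t < a := ht.2.trans_lt (max_lt (by linarith) hxa)
        simp [hab t fun h => hta.not_ge h.1]
      rw [intervalIntegral.integral_congr this]
      simp
    · have hxb : b < x := by
        by_contra hc
        exact hx ⟨not_lt.mp hxa, not_lt.mp hc⟩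
      rw [intervalIntegral.integral_eq_integral_of_support_subset, hw]
      intro t ht
      have : t ∈ Set.Icc a b := by
        by_contra hc
        exact ht (by simp [hab t hc])
      exact ⟨by linarith [this.1], this.2.trans hxb.le⟩
  -- In `F'` the terms with `A'` and `B'` cancel. In `F''` they combine to `-g` because the
  -- Wronskian is `1`.
  let F : ℝ → ℂ := fun x => Φ x * B x - second Φ x * A x
  let F' : ℝ → ℂ := fun x => Φ' x * B x - secondDeriv Φ Φ' x * A x
  have hF : ∀ x, 0 < x → HasDerivAt F (F' x) x := by
    intro x hx
    have := ((h.hasDerivAt x hx).ofReal_comp.mul (hB x hx)).sub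
      ((h.hasDerivAt_second hx).ofReal_comp.mul (hA x hx))
    convert! this using 1
    simp only [F']
    ring
  have hF' : ∀ x, 0 < x → HasDerivAt F' ((q x : ℂ) * F x + -g x) x := by
    intro x hx
    have := ((h.hasDerivAt' x hx).ofReal_comp.mul (hB x hx)).sub
      ((h.hasDerivAt_secondDeriv hx).ofReal_comp.mul (hA x hx))
    convert! this using 1
    have hw : (Φ x : ℂ) * secondDeriv Φ Φ' x - Φ' x * second Φ x = 1 := by
      exact_mod_cast h.wronskian hx
    simp only [F]
    push_cast
    linear_combination g x * hw
  have hF0 : ∀ x ∉ Set.Icc a b, F x = 0 := by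
    intro x hx
    simp only [F, A, B]
    rw [hzero _ h1 x hx, hzero _ h2 x hx]
    simp
  have hs : ContDiffOn ℝ ∞ F (Set.Ioi 0) :=
    contDiffOn_of_hasDerivAt_of_hasDerivAt isOpen_Ioi hF hF'
      (Complex.ofRealCLM.contDiff.comp_contDiffOn h.smooth) hgs.neg.contDiffOn
  refine ⟨F, ⟨contDiff_iff_contDiffAt.mpr fun x => ?_, a, b, ha, hF0⟩, fun x hx => ?_⟩
  · rcases lt_or_ge x a with hxa | hxa
    · have : F =ᶠ[𝓝 x] fun _ => 0 := by
        filter_upwards [Iio_mem_nhds hxa] with y hy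
        exact hF0 y fun h => (not_le.mpr hy) h.1
      exact contDiffAt_const.congr_of_eventuallyEq this
    · exact hs.contDiffAt (Ioi_mem_nhds (ha.trans_le hxa))
  · have h3 : deriv F =ᶠ[𝓝 x] F' := by
      filter_upwards [Ioi_mem_nhds hx] with y hy using (hF y hy).deriv
    rw [h3.deriv_eq, (hF' x hx).deriv]
    ring

/-- Weak solutions are identified by linear algebra alone. By `exists_test_of_orthogonal`, pairing
with `w` vanishes on the common kernel of the pairings with the two classical solutions, so it is a
linear combination of those two functionals. -/
theorem exists_ae_eq_linear_combination {w : ℝ → ℂ} (hw : LocallyIntegrableOn w (Set.Ioi 0))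
    (hwe : ∀ F ∈ halfLineTests, ∫ x, w x * (-deriv (deriv F) x + (q x : ℂ) * F x) = 0) :
    ∃ c d : ℂ, ∀ᵐ x : ℝ, x ∈ Set.Ioi (0 : ℝ) → w x = c * Φ x + d * second Φ x := by
  let L : Fin 2 → halfLineTests →ₗ[ℂ] ℂ :=
    ![halfLinePairing _ h.locallyIntegrableOn, halfLinePairing _ h.locallyIntegrableOn_second]
  have hK : ⨅ i, LinearMap.ker (L i) ≤ LinearMap.ker (halfLinePairing w hw) := by
    intro g hg
    rw [Submodule.mem_iInf] at hg
    obtain ⟨F, hF, hFg⟩ := h.exists_test_of_orthogonal g.2 (hg 0) (hg 1)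
    rw [LinearMap.mem_ker, ← hwe F hF]
    refine integral_congr_ae (Eventually.of_forall fun x => ?_)
    rcases lt_or_ge 0 x with hx | hx
    · simp only [hFg x hx]
    · obtain ⟨-, a, b, ha, hab⟩ := hF
      obtain ⟨-, a', b', ha', hab'⟩ := g.2
      have hF0 : F =ᶠ[𝓝 x] fun _ => 0 := by
        filter_upwards [Iio_mem_nhds (hx.trans_lt ha)] with y hy
        exact hab y fun h => (not_le.mpr hy) h.1
      have hdF : deriv F =ᶠ[𝓝 x] fun _ => 0 := by
        have := hF0.deriv
        simpa using this
      have hg0 : (g : ℝ → ℂ) x = 0 := hab' x fun h => (not_le.mpr (hx.trans_lt ha')) h.1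
      simp only [hg0, hdF.deriv_eq, hF0.eq_of_nhds]
      simp
  have hspan := mem_span_of_iInf_ker_le_ker hK
  rw [Matrix.range_cons, Matrix.range_cons, Matrix.range_empty, Set.union_empty,
    Set.singleton_union, Submodule.mem_span_pair] at hspan
  obtain ⟨c, d, hcd⟩ := hspan
  refine ⟨c, d, ?_⟩
  have hloc : LocallyIntegrableOn (fun x => w x - (c * Φ x + d * second Φ x)) (Set.Ioi 0) := by
    refine hw.sub (LocallyIntegrableOn.add ?_ ?_)
    · exact (continuousOn_const.mul (Complex.continuous_ofReal.comp_continuousOn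
        h.continuousOn)).locallyIntegrableOn measurableSet_Ioi
    · exact (continuousOn_const.mul (Complex.continuous_ofReal.comp_continuousOn
        h.continuousOn_second)).locallyIntegrableOn measurableSet_Ioi
  have hae := isOpen_Ioi.ae_eq_zero_of_integral_contDiff_smul_eq_zero hloc fun g hg hc hs => by
    have hm := ofReal_mem_halfLineTests hg hc hs
    have h1 := LinearMap.congr_fun hcd ⟨_, hm⟩
    have i1 := integrable_mul_halfLineTests h.locallyIntegrableOn hm
    have i2 := integrable_mul_halfLineTests h.locallyIntegrableOn_second hm
    have i3 := integrable_mul_halfLineTests hw hm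
    change c * (∫ x, (Φ x : ℂ) * (g x : ℂ)) + d * (∫ x, (second Φ x : ℂ) * (g x : ℂ)) =
      ∫ x, w x * (g x : ℂ) at h1
    rw [← integral_const_mul, ← integral_const_mul,
      ← integral_add (i1.const_mul c) (i2.const_mul d), eq_comm, ← sub_eq_zero,
      ← integral_sub (g := fun x => c * ((Φ x : ℂ) * (g x : ℂ)) + d * ((second Φ x : ℂ) * (g x : ℂ)))
        i3 ((i1.const_mul c).add (i2.const_mul d))] at h1
    rw [← h1]
    refine integral_congr_ae (Eventually.of_forall fun x => ?_)
    simp only [Complex.real_smul]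
    ring
  filter_upwards [hae] with x hx hx0
  exact sub_eq_zero.mp (hx hx0)

/-- A square integrable weak solution of `-w'' + qw = 0` on `(0, ∞)` is a multiple of `Φ`. -/
theorem exists_ae_eq_const_mul (hΦ : MemLp Φ 2 (volume.restrict (Set.Ioi 0))) {w : ℝ → ℂ}
    (hw : MemLp w 2 (volume.restrict (Set.Ioi 0)))
    (hwe : ∀ F ∈ halfLineTests, ∫ x, w x * (-deriv (deriv F) x + (q x : ℂ) * F x) = 0) :
    ∃ c : ℂ, ∀ᵐ x : ℝ, x ∈ Set.Ioi (0 : ℝ) → w x = c * Φ x := by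
  have hloc : LocallyIntegrableOn w (Set.Ioi 0) :=
    locallyIntegrableOn_of_locallyIntegrable_restrict (hw.locallyIntegrable (by norm_num))
  obtain ⟨c, d, hcd⟩ := h.exists_ae_eq_linear_combination hloc hwe
  have hd : d = 0 := by
    by_contra hd
    have hμ : (volume.restrict (Set.Ioi (2 : ℝ))) ≤ volume.restrict (Set.Ioi 0) :=
      Measure.restrict_mono (Set.Ioi_subset_Ioi (by norm_num)) le_rfl
    have m1 : MemLp (fun x => w x - c * (Φ x : ℂ)) 2 (volume.restrict (Set.Ioi 2)) :=
      (hw.sub ((hΦ.ofReal (K := ℂ)).const_mul c)).mono_measure hμ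
    have hΦ1 : 0 < (Φ 1)⁻¹ := inv_pos.mpr (h.pos 1 one_pos)
    -- Beyond `2` the second solution is at least `(Φ 1)⁻¹`. With `d ≠ 0` a nonzero constant would
    -- be square integrable on a set of infinite measure.
    have m2 : MemLp (fun _ : ℝ => ‖d‖ * (Φ 1)⁻¹) 2 (volume.restrict (Set.Ioi 2)) := by
      refine m1.mono aestronglyMeasurable_const ?_
      have : ∀ᵐ x ∂(volume.restrict (Set.Ioi (2 : ℝ))), x ∈ Set.Ioi (2 : ℝ) :=
        ae_restrict_mem measurableSet_Ioi
      filter_upwards [this, ae_restrict_of_ae hcd] with x hx hx'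
      have hx2 : (2 : ℝ) < x := hx
      have h3 : (Φ 1)⁻¹ ≤ second Φ x := by
        refine le_trans ?_ (h.le_second (by linarith))
        exact le_mul_of_one_le_right hΦ1.le (by linarith)
      rw [hx' (by simp only [Set.mem_Ioi]; linarith), add_sub_cancel_left,
        Real.norm_of_nonneg (mul_nonneg (norm_nonneg d) hΦ1.le), norm_mul, Complex.norm_real,
        Real.norm_of_nonneg (hΦ1.le.trans h3)]
      gcongr
    rw [memLp_const_iff (by simp) (by simp)] at m2
    rcases m2 with h0 | h0
    · exact (mul_pos (norm_pos_iff.mpr hd) hΦ1).ne' h0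
    · simp at h0
  refine ⟨c, ?_⟩
  filter_upwards [hcd] with x hx hx0
  rw [hx hx0, hd]
  simp

/-- The integrand is the derivative of `Φ' f - Φ f'`, which vanishes near `0` and for large `x`
together with `f`. -/
theorem integral_Ioi_mul_eq_zero (hΦ : MemLp Φ 2 (volume.restrict (Set.Ioi 0))) {f : ℝ → ℂ}
    (hf : IsFibreTest f) (hqf : MemLp (fun x => -deriv (deriv f) x + (q x : ℂ) * f x) 2 volume) :
    ∫ x in Set.Ioi 0, (Φ x : ℂ) * (-deriv (deriv f) x + (q x : ℂ) * f x) = 0 := by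
  have h1 := integral_Ioi_of_hasDerivAt_of_tendsto (a := (0 : ℝ)) (m := (0 : ℂ))
    (f := fun x => (Φ' x : ℂ) * f x - Φ x * deriv f x)
    (f' := fun x => (Φ x : ℂ) * (-deriv (deriv f) x + (q x : ℂ) * f x)) ?_ ?_ ?_ ?_
  · rw [h1, hf.eventually_eq_zero.self_of_nhds, hf.deriv.eventually_eq_zero.self_of_nhds]
    simp
  · have : (fun x => (Φ' x : ℂ) * f x - Φ x * deriv f x) =ᶠ[𝓝 0] fun _ => 0 := by
      filter_upwards [hf.eventually_eq_zero, hf.deriv.eventually_eq_zero] with x h1 h2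
      simp [h1, h2]
    exact (continuousAt_const.congr this.symm).continuousWithinAt
  · intro x hx
    have := ((h.hasDerivAt' x hx).ofReal_comp.mul (hf.differentiable x).hasDerivAt).sub
      ((h.hasDerivAt x hx).ofReal_comp.mul (hf.deriv.differentiable x).hasDerivAt)
    convert! this using 1
    push_cast
    ring
  · exact (hΦ.ofReal (K := ℂ)).integrable_mul (hqf.restrict _)
  · obtain ⟨K, hK, -, hK0⟩ := hf.support
    obtain ⟨L, hL, -, hL0⟩ := hf.deriv.support
    refine tendsto_const_nhds.congr' ?_
    have hatTop : ∀ K : Set ℝ, IsCompact K → ∀ᶠ x in atTop, x ∉ K := fun K hK => by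
      obtain ⟨b, hb⟩ := hK.bddAbove
      filter_upwards [Ioi_mem_atTop b] with x hx hxK
      exact (not_le.mpr hx) (hb hxK)
    filter_upwards [hatTop K hK, hatTop L hL] with x h1 h2
    simp [hK0 x h1, hL0 x h2]

end IsPositiveSolution

end HalfLine

/-! ### The modified Bessel function from its integral representation -/

section Bessel

/-- `∫₀^∞ e^{-x cosh t} cosh^j t cosh (ν t) dt`. -/
noncomputable def besselMoment (ν : ℝ) (j : ℕ) (x : ℝ) : ℝ :=
  ∫ t in Set.Ioi (0 : ℝ), Real.exp (-x * Real.cosh t) * Real.cosh t ^ j * Real.cosh (ν * t)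

theorem besselMoment_zero (ν x : ℝ) : besselMoment ν 0 x = besselK ν x := by
  simp [besselMoment, besselK]

variable {ν : ℝ}

/-- The bound `e^{-z} ≤ (j+2)!/z^(j+2)` with `z = x cosh t` supplies `j + 2` powers of `cosh t`. Of
these, `j` absorb the moment, one absorbs `cosh (ν t) ≤ cosh t`, and the last gives the decay
`e^{-t}`. -/
theorem besselMoment_integrand_le (h0 : 0 ≤ ν) (h1 : ν ≤ 1) (j : ℕ) {x t : ℝ} (hx : 0 < x)
    (ht : 0 ≤ t) : Real.exp (-x * Real.cosh t) * Real.cosh t ^ j * Real.cosh (ν * t) ≤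
      ((j + 2).factorial / x ^ (j + 2) * 2) * Real.exp (-1 * t) := by
  have hc := Real.cosh_pos t
  have hν : Real.cosh (ν * t) ≤ Real.cosh t := by
    rw [Real.cosh_le_cosh, abs_of_nonneg (by positivity), abs_of_nonneg ht]
    exact mul_le_of_le_one_left ht h1
  have hexp : Real.exp (-x * Real.cosh t) ≤ (j + 2).factorial / (x * Real.cosh t) ^ (j + 2) := by
    have h2 := Real.pow_div_factorial_le_exp (x * Real.cosh t) (by positivity) (j + 2)
    rw [neg_mul, Real.exp_neg, ← one_div, div_le_div_iff₀ (Real.exp_pos _) (by positivity), one_mul]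
    rwa [div_le_iff₀ (by positivity), mul_comm (Real.exp _)] at h2
  have hcosh : (Real.cosh t)⁻¹ ≤ 2 * Real.exp (-1 * t) := by
    rw [neg_one_mul, Real.exp_neg, inv_le_comm₀ hc (by positivity), mul_inv, inv_inv,
      Real.cosh_eq]
    have := Real.exp_pos (-t)
    linarith
  calc Real.exp (-x * Real.cosh t) * Real.cosh t ^ j * Real.cosh (ν * t)
      ≤ (j + 2).factorial / (x * Real.cosh t) ^ (j + 2) * Real.cosh t ^ j * Real.cosh t := by
        gcongr
    _ = (j + 2).factorial / x ^ (j + 2) * (Real.cosh t)⁻¹ := by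
        rw [mul_pow]
        field_simp
        ring
    _ ≤ (j + 2).factorial / x ^ (j + 2) * (2 * Real.exp (-1 * t)) := by gcongr
    _ = _ := by ring

theorem integrableOn_besselMoment (h0 : 0 ≤ ν) (h1 : ν ≤ 1) (j : ℕ) {x : ℝ} (hx : 0 < x) :
    IntegrableOn (fun t => Real.exp (-x * Real.cosh t) * Real.cosh t ^ j * Real.cosh (ν * t))
      (Set.Ioi 0) := by
  refine Integrable.mono' ((integrableOn_exp_mul_Ioi (a := -1) (by norm_num) 0).const_mul
    ((j + 2).factorial / x ^ (j + 2) * 2)) (by fun_prop) ?_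
  filter_upwards [ae_restrict_mem measurableSet_Ioi] with t ht
  have := Real.cosh_pos t
  have := Real.cosh_pos (ν * t)
  rw [Real.norm_of_nonneg (by positivity)]
  exact besselMoment_integrand_le h0 h1 j hx (le_of_lt ht)

theorem hasDerivAt_besselMoment (h0 : 0 ≤ ν) (h1 : ν ≤ 1) (j : ℕ) {x : ℝ} (hx : 0 < x) :
    HasDerivAt (besselMoment ν j) (-besselMoment ν (j + 1) x) x := by
  have hx2 : 0 < x / 2 := by positivity
  have key := hasDerivAt_integral_of_dominated_loc_of_deriv_le
    (μ := volume.restrict (Set.Ioi (0 : ℝ))) (x₀ := x) (s := Set.Ioi (x / 2))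
    (F := fun x t => Real.exp (-x * Real.cosh t) * Real.cosh t ^ j * Real.cosh (ν * t))
    (F' := fun x t => -(Real.exp (-x * Real.cosh t) * Real.cosh t ^ (j + 1) * Real.cosh (ν * t)))
    (bound := fun t =>
      Real.exp (-(x / 2) * Real.cosh t) * Real.cosh t ^ (j + 1) * Real.cosh (ν * t))
    (Ioi_mem_nhds (by linarith)) (Eventually.of_forall fun y => by fun_prop)
    (integrableOn_besselMoment h0 h1 j hx) (by fun_prop) ?_
    (integrableOn_besselMoment h0 h1 (j + 1) hx2) ?_
  · exact HasDerivAt.congr_deriv key.2 (integral_neg _)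
  · refine Eventually.of_forall fun t y hy => ?_
    have := Real.cosh_pos t
    have := Real.cosh_pos (ν * t)
    rw [norm_neg, Real.norm_of_nonneg (by positivity)]
    have hy' : x / 2 ≤ y := le_of_lt hy
    gcongr
  · refine Eventually.of_forall fun t y _ => ?_
    have h2 : HasDerivAt (fun y => -y * Real.cosh t) (-1 * Real.cosh t) y :=
      ((hasDerivAt_id y).neg).mul_const _
    convert! ((h2.exp).mul_const (Real.cosh t ^ j)).mul_const (Real.cosh (ν * t)) using 1
    ring

/-- As moments `1` and `2` are `-K'` and `K''`, this is the modified Bessel equation. The combined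
integrand is the exact `t`-derivative of `G`, which vanishes at `0` and at infinity. -/
theorem besselMoment_ode (h0 : 0 ≤ ν) (h1 : ν ≤ 1) {x : ℝ} (hx : 0 < x) :
    x ^ 2 * besselMoment ν 2 x - x * besselMoment ν 1 x -
      (x ^ 2 + ν ^ 2) * besselMoment ν 0 x = 0 := by
  let G : ℝ → ℝ := fun t => -(x * Real.sinh t * Real.exp (-x * Real.cosh t) * Real.cosh (ν * t)) -
    ν * (Real.exp (-x * Real.cosh t) * Real.sinh (ν * t))
  have i0 := integrableOn_besselMoment h0 h1 0 hx
  have i1 := integrableOn_besselMoment h0 h1 1 hx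
  have i2 := integrableOn_besselMoment h0 h1 2 hx
  have hI := ((i2.const_mul (x ^ 2)).sub (i1.const_mul x)).sub (i0.const_mul (x ^ 2 + ν ^ 2))
  have hG : ∀ t ∈ Set.Ici (0 : ℝ), HasDerivAt G
      (x ^ 2 * (Real.exp (-x * Real.cosh t) * Real.cosh t ^ 2 * Real.cosh (ν * t)) -
        x * (Real.exp (-x * Real.cosh t) * Real.cosh t ^ 1 * Real.cosh (ν * t)) -
        (x ^ 2 + ν ^ 2) * (Real.exp (-x * Real.cosh t) * Real.cosh t ^ 0 * Real.cosh (ν * t)))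
      t := by
    intro t _
    have e1 : HasDerivAt (fun t => Real.exp (-x * Real.cosh t))
      (Real.exp (-x * Real.cosh t) * (-x * Real.sinh t)) t :=
      ((Real.hasDerivAt_cosh t).const_mul (-x)).exp
    have e2 : HasDerivAt (fun t => ν * t) ν t := by
      simpa using (hasDerivAt_id t).const_mul ν
    have e3 : HasDerivAt (fun t => x * Real.sinh t) (x * Real.cosh t) t :=
      (Real.hasDerivAt_sinh t).const_mul x
    have e := ((e3.mul e1).mul e2.cosh).neg.sub ((e1.mul e2.sinh).const_mul ν)
    convert! e using 1
    have hs := Real.cosh_sq t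
    simp only [Pi.mul_apply]
    linear_combination (x ^ 2 * Real.exp (-x * Real.cosh t) * Real.cosh (ν * t)) * hs
  have hlim : Tendsto G atTop (𝓝 0) := by
    let C : ℝ := x * ((1 + 2).factorial / x ^ (1 + 2) * 2) + ν * ((0 + 2).factorial / x ^ (0 + 2) * 2)
    have hb : Tendsto (fun t : ℝ => C * Real.exp (-1 * t)) atTop (𝓝 0) := by
      have : Tendsto (fun t : ℝ => Real.exp (-1 * t)) atTop (𝓝 0) := by
        simp only [neg_one_mul]
        exact Real.tendsto_exp_neg_atTop_nhds_zero
      simpa using this.const_mul C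
    refine squeeze_zero_norm' ?_ hb
    filter_upwards [Ici_mem_atTop 0] with t ht
    have ht' : 0 ≤ t := ht
    have b1 := besselMoment_integrand_le h0 h1 1 hx ht'
    have b0 := besselMoment_integrand_le h0 h1 0 hx ht'
    have s1 : Real.sinh t ≤ Real.cosh t := (Real.sinh_lt_cosh t).le
    have s2 : Real.sinh (ν * t) ≤ Real.cosh (ν * t) := (Real.sinh_lt_cosh _).le
    have p1 : 0 ≤ Real.sinh t := Real.sinh_nonneg_iff.mpr ht'
    have p2 : 0 ≤ Real.sinh (ν * t) := Real.sinh_nonneg_iff.mpr (by positivity)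
    have c1 := Real.cosh_pos t
    have c2 := Real.cosh_pos (ν * t)
    have hGn : ‖G t‖ = x * Real.sinh t * Real.exp (-x * Real.cosh t) * Real.cosh (ν * t) +
        ν * (Real.exp (-x * Real.cosh t) * Real.sinh (ν * t)) := by
      rw [show G t = -(x * Real.sinh t * Real.exp (-x * Real.cosh t) * Real.cosh (ν * t) +
        ν * (Real.exp (-x * Real.cosh t) * Real.sinh (ν * t))) from by simp only [G]; ring,
        norm_neg, Real.norm_of_nonneg (by positivity)]
    rw [hGn]
    calc x * Real.sinh t * Real.exp (-x * Real.cosh t) * Real.cosh (ν * t) +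
          ν * (Real.exp (-x * Real.cosh t) * Real.sinh (ν * t))
        ≤ x * Real.cosh t * Real.exp (-x * Real.cosh t) * Real.cosh (ν * t) +
          ν * (Real.exp (-x * Real.cosh t) * Real.cosh (ν * t)) := by gcongr
      _ = x * (Real.exp (-x * Real.cosh t) * Real.cosh t ^ 1 * Real.cosh (ν * t)) +
          ν * (Real.exp (-x * Real.cosh t) * Real.cosh t ^ 0 * Real.cosh (ν * t)) := by ring
      _ ≤ x * (((1 + 2).factorial / x ^ (1 + 2) * 2) * Real.exp (-1 * t)) +
          ν * (((0 + 2).factorial / x ^ (0 + 2) * 2) * Real.exp (-1 * t)) := by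
          gcongr
      _ = C * Real.exp (-1 * t) := by simp only [C]; ring
  have h2 := integral_Ioi_of_hasDerivAt_of_tendsto' hG hI hlim
  have i21 : IntegrableOn (fun t =>
      x ^ 2 * (Real.exp (-x * Real.cosh t) * Real.cosh t ^ 2 * Real.cosh (ν * t)) -
        x * (Real.exp (-x * Real.cosh t) * Real.cosh t ^ 1 * Real.cosh (ν * t))) (Set.Ioi 0) :=
    (i2.const_mul _).sub (i1.const_mul _)
  have hG0 : G 0 = 0 := by simp [G]
  rw [hG0, sub_zero] at h2
  rw [← h2, integral_sub i21 (i0.const_mul _),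
    integral_sub (i2.const_mul _) (i1.const_mul _), integral_const_mul, integral_const_mul,
    integral_const_mul]
  rfl

theorem besselK_pos (h0 : 0 ≤ ν) (h1 : ν ≤ 1) {x : ℝ} (hx : 0 < x) : 0 < besselK ν x := by
  have hpos : ∀ t, 0 < Real.exp (-x * Real.cosh t) * Real.cosh (ν * t) := fun t =>
    mul_pos (Real.exp_pos _) (Real.cosh_pos _)
  have hi := integrableOn_besselMoment h0 h1 0 hx
  simp only [pow_zero, mul_one] at hi
  rw [besselK, integral_pos_iff_support_of_nonneg (fun t => (hpos t).le) hi]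
  have : (Function.support fun t => Real.exp (-x * Real.cosh t) * Real.cosh (ν * t)) = Set.univ :=
    Set.eq_univ_of_forall fun t => (hpos t).ne'
  rw [this]
  simp

theorem exists_besselK_le (h0 : 0 ≤ ν) (h1 : ν < 1) : ∃ D : ℝ, ∀ x, 0 < x →
    besselK ν x ≤ D * (x ^ (-((1 + ν) / 2)) * Real.exp (-(x / 2))) := by
  -- The exponent must exceed `ν` for the `t`-integral to converge, and `x^(1-2p) = x^(-ν)` must be
  -- integrable at `0` for square integrability of `√x K_ν`. Half of `e^{-x cosh t}` is turned into
  -- the power of `x`; the other half keeps the decay `e^{-x/2}`.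
  set p := (1 + ν) / 2 with hp
  have hpν : ν - p < 0 := by rw [hp]; linarith
  have hp0 : 0 < p := by rw [hp]; linarith
  have hp1 : p ≤ 1 := by rw [hp]; linarith
  have hexp : ∀ z : ℝ, 0 < z → Real.exp (-z) ≤ z ^ (-p) := by
    intro z hz
    rw [Real.rpow_def_of_pos hz, Real.exp_le_exp]
    have h2 := Real.log_le_sub_one_of_pos hz
    rcases le_total 0 (Real.log z) with h3 | h3
    · nlinarith
    · nlinarith
  have hint := integrableOn_exp_mul_Ioi hpν 0
  refine ⟨∫ t in Set.Ioi (0 : ℝ), (4 : ℝ) ^ p * Real.exp ((ν - p) * t), fun x hx => ?_⟩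
  rw [← integral_mul_const, besselK]
  have hi := integrableOn_besselMoment h0 h1.le 0 hx
  simp only [pow_zero, mul_one] at hi
  refine setIntegral_mono_on hi ((hint.const_mul _).mul_const _) measurableSet_Ioi fun t ht => ?_
  have ht' : 0 ≤ t := le_of_lt ht
  have hc := Real.cosh_pos t
  have hc1 := Real.one_le_cosh t
  have e1 : Real.exp (-x * Real.cosh t) ≤
      Real.exp (-(x / 2)) * (x / 2 * Real.cosh t) ^ (-p) := by
    calc Real.exp (-x * Real.cosh t)
        ≤ Real.exp (-(x / 2)) * Real.exp (-(x / 2 * Real.cosh t)) := by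
          rw [← Real.exp_add, Real.exp_le_exp]
          nlinarith
      _ ≤ _ := by gcongr; exact hexp _ (by positivity)
  have e2 : (x / 2 * Real.cosh t) ^ (-p) ≤ (x / 4 * Real.exp t) ^ (-p) := by
    refine Real.rpow_le_rpow_of_nonpos (by positivity) ?_ (by linarith)
    rw [Real.cosh_eq]
    have := Real.exp_pos (-t)
    nlinarith
  have e3 : (x / 4 * Real.exp t) ^ (-p) = x ^ (-p) * (4 : ℝ) ^ p * Real.exp (-p * t) := by
    rw [Real.mul_rpow (by positivity) (Real.exp_pos _).le, div_eq_mul_inv,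
      Real.mul_rpow hx.le (by positivity), Real.inv_rpow (by norm_num),
      Real.rpow_neg (by norm_num : (0 : ℝ) ≤ 4), inv_inv, ← Real.exp_mul]
    ring_nf
  have e4 : Real.cosh (ν * t) ≤ Real.exp (ν * t) := by
    rw [Real.cosh_eq]
    have : Real.exp (-(ν * t)) ≤ Real.exp (ν * t) := by
      rw [Real.exp_le_exp]
      have : 0 ≤ ν * t := by positivity
      linarith
    linarith
  calc Real.exp (-x * Real.cosh t) * Real.cosh (ν * t)
      ≤ (Real.exp (-(x / 2)) * (x ^ (-p) * (4 : ℝ) ^ p * Real.exp (-p * t))) *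
        Real.exp (ν * t) := by
        have := Real.cosh_pos (ν * t)
        gcongr
        exact e1.trans (by rw [← e3]; gcongr)
    _ = _ := by
        rw [sub_mul, sub_eq_add_neg, Real.exp_add, ← neg_mul]
        ring

end Bessel

/-! ### The explicit solutions: equation, integrability, reflection and scaling -/

section DeficiencyFunctions

variable {α : ℝ}

/-- The potential of the operator `H_k + δ_{k0}`. -/
noncomputable def shiftedPotential (α : ℝ) (k : ℤ) (x : ℝ) : ℝ :=
  modePotential α k x + if k = 0 then 1 else 0

theorem fibreExpr_add_shift (α : ℝ) (k : ℤ) (f : ℝ → ℂ) (x : ℝ) :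
    fibreExpr α k f x + (if k = 0 then 1 else 0) * f x =
      -deriv (deriv f) x + (shiftedPotential α k x : ℂ) * f x := by
  rw [fibreExpr_eq, shiftedPotential]
  split_ifs <;> push_cast <;> ring

theorem contDiffOn_shiftedPotential (α : ℝ) (k : ℤ) :
    ContDiffOn ℝ ∞ (shiftedPotential α k) (Set.Ioi 0) := by
  have h : ContDiffOn ℝ ∞ (fun x : ℝ => (k : ℝ) ^ 2 * x ^ (2 * α) +
      α * (2 + α) / (4 * x ^ 2) + if k = 0 then 1 else 0) (Set.Ioi 0) := by
    intro x hx
    have hx0 : x ≠ 0 := (Set.mem_Ioi.mp hx).ne'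
    refine ((ContDiffAt.add ?_ ?_).add contDiffAt_const).contDiffWithinAt
    · exact contDiffAt_const.mul (Real.contDiffAt_rpow_const_of_ne hx0)
    · exact contDiffAt_const.div (by fun_prop) (by positivity)
  refine h.congr fun x hx => ?_
  rw [shiftedPotential, modePotential, abs_of_pos hx]

theorem shiftedPotential_nonneg (hα : 0 ≤ α) (k : ℤ) (x : ℝ) : 0 ≤ shiftedPotential α k x := by
  have := modePotential_nonneg hα k x
  rw [shiftedPotential]
  split_ifs <;> linarith

theorem deficiencyFun_neg (α : ℝ) (k : ℤ) (x : ℝ) :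
    deficiencyFun α k (-x) = deficiencyFun α k x := by
  simp [deficiencyFun]

theorem deficiencyFun_of_ne_zero {k : ℤ} (hk : k ≠ 0) {x : ℝ} (hx : 0 < x) :
    deficiencyFun α k x = Real.sqrt (Real.pi * (1 + α) / (2 * |(k : ℝ)|)) * x ^ (-(α / 2)) *
      Real.exp (-(|(k : ℝ)| / (1 + α)) * x ^ (1 + α)) := by
  rw [deficiencyFun, if_neg hk, abs_of_pos hx]

theorem deficiencyFun_zero {x : ℝ} (hx : 0 < x) :
    deficiencyFun α 0 x = Real.sqrt x * besselMoment ((1 + α) / 2) 0 x := by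
  rw [deficiencyFun, if_pos rfl, abs_of_pos hx, besselMoment_zero]

/-- The logarithmic derivative `ℓ = -α/(2x) - |k| x^α` satisfies the Riccati equation `ℓ' + ℓ² = q`:
the terms in `x^(α-1)` cancel and `α²/4 + α/2 = α(2+α)/4`. -/
theorem isPositiveSolution_deficiencyFun_of_ne_zero (hα : 0 ≤ α) {k : ℤ} (hk : k ≠ 0) :
    IsPositiveSolution (shiftedPotential α k) (deficiencyFun α k)
      (fun x => deficiencyFun α k x * (-(α / 2) / x - |(k : ℝ)| * x ^ α)) := by
  have hk0 : 0 < |(k : ℝ)| := abs_pos.mpr (Int.cast_ne_zero.mpr hk)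
  have hα1 : 0 < 1 + α := by linarith
  have hd : ∀ x, 0 < x → HasDerivAt (deficiencyFun α k)
      (deficiencyFun α k x * (-(α / 2) / x - |(k : ℝ)| * x ^ α)) x := by
    intro x hx
    have e1 := Real.hasDerivAt_rpow_const (p := -(α / 2)) (Or.inl hx.ne')
    have e2 := ((Real.hasDerivAt_rpow_const (p := 1 + α) (Or.inl hx.ne')).const_mul
      (-(|(k : ℝ)| / (1 + α)))).exp
    have e := (e1.const_mul (Real.sqrt (Real.pi * (1 + α) / (2 * |(k : ℝ)|)))).mul e2
    have h1 : deficiencyFun α k =ᶠ[𝓝 x] fun x =>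
        Real.sqrt (Real.pi * (1 + α) / (2 * |(k : ℝ)|)) * x ^ (-(α / 2)) *
        Real.exp (-(|(k : ℝ)| / (1 + α)) * x ^ (1 + α)) := by
      filter_upwards [Ioi_mem_nhds hx] with y hy using deficiencyFun_of_ne_zero hk hy
    refine (h1.hasDerivAt_iff.mpr e).congr_deriv ?_
    rw [deficiencyFun_of_ne_zero hk hx, Real.rpow_sub_one hx.ne', show 1 + α - 1 = α by ring]
    field_simp
    ring
  refine ⟨contDiffOn_shiftedPotential α k, fun x _ => shiftedPotential_nonneg hα k x,
    fun x hx => ?_, hd, fun x hx => ?_⟩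
  · rw [deficiencyFun_of_ne_zero hk hx]
    have := Real.pi_pos
    positivity
  · have e3 : HasDerivAt (fun x : ℝ => -(α / 2) / x - |(k : ℝ)| * x ^ α)
        ((α / 2) / x ^ 2 - |(k : ℝ)| * (α * x ^ (α - 1))) x := by
      have e4 : HasDerivAt (fun x : ℝ => -(α / 2) / x) ((α / 2) / x ^ 2) x := by
        convert! (hasDerivAt_inv hx.ne').const_mul (-(α / 2)) using 1
        ring
      exact e4.sub ((Real.hasDerivAt_rpow_const (p := α) (Or.inl hx.ne')).const_mul _)
    refine ((hd x hx).mul e3).congr_deriv ?_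
    rw [shiftedPotential, modePotential, if_neg hk, abs_of_pos hx, Real.rpow_sub_one hx.ne',
      two_mul α, Real.rpow_add hx, ← sq_abs (k : ℝ)]
    field_simp
    ring

/-- The factor `√x` turns the Bessel equation into `u'' = ((ν² - 1/4)/x² + 1) u`. For `ν = (1+α)/2`
one has `ν² - 1/4 = α(2+α)/4`, and the `1` is the shift by `𝟙₀`. -/
theorem isPositiveSolution_deficiencyFun_zero (hα : 0 ≤ α) (hα' : α < 1) :
    IsPositiveSolution (shiftedPotential α 0) (deficiencyFun α 0)
      (fun x => besselMoment ((1 + α) / 2) 0 x / (2 * Real.sqrt x) -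
        Real.sqrt x * besselMoment ((1 + α) / 2) 1 x) := by
  have h0 : 0 ≤ (1 + α) / 2 := by linarith
  have h1 : (1 + α) / 2 ≤ 1 := by linarith
  refine ⟨contDiffOn_shiftedPotential α 0, fun x _ => shiftedPotential_nonneg hα 0 x,
    fun x hx => ?_, fun x hx => ?_, fun x hx => ?_⟩
  · rw [deficiencyFun_zero hx, besselMoment_zero]
    exact mul_pos (Real.sqrt_pos.mpr hx) (besselK_pos h0 h1 hx)
  · have e := (Real.hasDerivAt_sqrt hx.ne').mul (hasDerivAt_besselMoment h0 h1 0 hx)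
    have h2 : deficiencyFun α 0 =ᶠ[𝓝 x] fun x =>
        Real.sqrt x * besselMoment ((1 + α) / 2) 0 x := by
      filter_upwards [Ioi_mem_nhds hx] with y hy using deficiencyFun_zero hy
    refine (h2.hasDerivAt_iff.mpr e).congr_deriv ?_
    ring
  · have hs : 0 < Real.sqrt x := Real.sqrt_pos.mpr hx
    have hsq : Real.sqrt x ^ 2 = x := Real.sq_sqrt hx.le
    have e0 := Real.hasDerivAt_sqrt hx.ne'
    have e := ((hasDerivAt_besselMoment h0 h1 0 hx).div (e0.const_mul 2) (by positivity)).sub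
      (e0.mul (hasDerivAt_besselMoment h0 h1 1 hx))
    refine e.congr_deriv ?_
    have ode := besselMoment_ode h0 h1 hx
    rw [deficiencyFun_zero hx, shiftedPotential, modePotential, if_pos rfl]
    norm_num only [Int.cast_zero]
    set s := Real.sqrt x
    rw [← hsq] at ode ⊢
    have hs0 := hs.ne'
    field_simp
    field_simp at ode
    linear_combination 4 * ode

theorem exists_isPositiveSolution_deficiencyFun (hα : 0 ≤ α) (hα' : α < 1) (k : ℤ) :
    ∃ Φ', IsPositiveSolution (shiftedPotential α k) (deficiencyFun α k) Φ' := by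
  by_cases hk : k = 0
  · subst hk
    exact ⟨_, isPositiveSolution_deficiencyFun_zero hα hα'⟩
  · exact ⟨_, isPositiveSolution_deficiencyFun_of_ne_zero hα hk⟩

/-- Near `0` the square is of order `x^(-α)` for `k ≠ 0` and at most of order `x^(-ν)` with `ν =
(1+α)/2` for `k = 0`. Both exponents exceed `-1` because `α < 1`. -/
theorem memLp_deficiencyFun_Ioi (hα : 0 ≤ α) (hα' : α < 1) (k : ℤ) :
    MemLp (deficiencyFun α k) 2 (volume.restrict (Set.Ioi 0)) := by
  obtain ⟨Φ', h⟩ := exists_isPositiveSolution_deficiencyFun hα hα' k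
  have hm : AEStronglyMeasurable (deficiencyFun α k) (volume.restrict (Set.Ioi 0)) :=
    h.continuousOn.aestronglyMeasurable measurableSet_Ioi
  rw [memLp_two_iff_integrable_sq hm]
  by_cases hk : k = 0
  · subst hk
    set ν := (1 + α) / 2 with hν
    have h0 : 0 ≤ ν := by rw [hν]; linarith
    have h1 : ν < 1 := by rw [hν]; linarith
    obtain ⟨D, hD⟩ := exists_besselK_le h0 h1
    have hi := (integrableOn_rpow_mul_exp_neg_mul_rpow (p := 1) (s := -ν) (b := 1) (by linarith)
      one_pos one_pos).const_mul (D ^ 2)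
    refine Integrable.mono' hi (hm.pow 2) ?_
    filter_upwards [ae_restrict_mem measurableSet_Ioi] with x hx
    have hx0 : 0 < x := hx
    have hK := (besselK_pos h0 h1.le hx0).le
    rw [Real.norm_of_nonneg (sq_nonneg _), deficiencyFun_zero hx0, besselMoment_zero, mul_pow,
      Real.sq_sqrt hx0.le]
    have hx1 : x * (x ^ (-((1 + ν) / 2)) * x ^ (-((1 + ν) / 2))) = x ^ (-ν) := by
      nth_rewrite 1 [← Real.rpow_one x]
      rw [← Real.rpow_add hx0, ← Real.rpow_add hx0]
      congr 1
      ring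
    have hx2 : Real.exp (-(x / 2)) * Real.exp (-(x / 2)) = Real.exp (-1 * x ^ (1 : ℝ)) := by
      rw [← Real.exp_add, Real.rpow_one]
      congr 1
      ring
    calc x * besselK ν x ^ 2 ≤ x * (D * (x ^ (-((1 + ν) / 2)) * Real.exp (-(x / 2)))) ^ 2 := by
          gcongr
          exact hD x hx0
      _ = D ^ 2 * ((x * (x ^ (-((1 + ν) / 2)) * x ^ (-((1 + ν) / 2)))) *
          (Real.exp (-(x / 2)) * Real.exp (-(x / 2)))) := by ring
      _ = _ := by rw [hx1, hx2]
  · have hk0 : 0 < |(k : ℝ)| := abs_pos.mpr (Int.cast_ne_zero.mpr hk)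
    have hα1 : 0 < 1 + α := by linarith
    have hi := (integrableOn_rpow_mul_exp_neg_mul_rpow (p := 1 + α) (s := -α)
      (b := 2 * (|(k : ℝ)| / (1 + α))) (by linarith) hα1 (by positivity)).const_mul
      (Real.sqrt (Real.pi * (1 + α) / (2 * |(k : ℝ)|)) ^ 2)
    refine hi.congr ?_
    filter_upwards [ae_restrict_mem measurableSet_Ioi] with x hx
    rw [deficiencyFun_of_ne_zero hk hx, mul_pow, mul_pow, ← Real.rpow_natCast (x ^ (-(α / 2))),
      ← Real.rpow_mul (le_of_lt hx), ← Real.exp_nat_mul]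
    push_cast
    ring_nf

theorem ae_iff_of_neg_of_pos {p : ℝ → Prop} (h1 : ∀ᵐ x : ℝ, x ∈ Set.Ioi (0 : ℝ) → p x)
    (h2 : ∀ᵐ x : ℝ, x ∈ Set.Ioi (0 : ℝ) → p (-x)) : ∀ᵐ x : ℝ, p x := by
  have h3 : ∀ᵐ x : ℝ, -x ∈ Set.Ioi (0 : ℝ) → p (- -x) :=
    (Measure.measurePreserving_neg volume).quasiMeasurePreserving.ae h2
  have h0 : ∀ᵐ x : ℝ, x ≠ 0 := by simp [ae_iff, measure_singleton]
  filter_upwards [h1, h3, h0] with x a b c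
  rcases c.lt_or_gt with hc | hc
  · simpa using b (by simpa using hc)
  · exact a hc

theorem deficiencyVec_of_pos (α : ℝ) (k : ℤ) (c : EuclideanSpace ℂ (Fin 2)) {x : ℝ} (hx : 0 < x) :
    deficiencyVec α k c x = c 1 * (deficiencyFun α k x : ℂ) := by
  rw [deficiencyVec, if_neg hx.not_gt]

theorem deficiencyVec_neg_of_pos (α : ℝ) (k : ℤ) (c : EuclideanSpace ℂ (Fin 2)) {x : ℝ}
    (hx : 0 < x) : deficiencyVec α k c (-x) = c 0 * (deficiencyFun α k x : ℂ) := by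
  rw [deficiencyVec, if_pos (by linarith), deficiencyFun_neg]

/-- The potential is even, so reflection reduces the left half-line to the right one. -/
theorem fibreExpr_comp_neg (α : ℝ) (k : ℤ) (f : ℝ → ℂ) (x : ℝ) :
    fibreExpr α k (fun x => f (-x)) x = fibreExpr α k f (-x) := by
  have h1 : deriv (fun x => f (-x)) = fun x => -deriv f (-x) := funext fun x => deriv_comp_neg f x
  rw [fibreExpr_eq, fibreExpr_eq, h1, deriv.fun_neg, deriv_comp_neg, neg_neg]
  simp [modePotential]

theorem IsFibreTest.comp_neg {f : ℝ → ℂ} (hf : IsFibreTest f) : IsFibreTest (fun x => f (-x)) := by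
  obtain ⟨K, hK, h0, h⟩ := hf.support
  refine ⟨hf.smooth.comp contDiff_neg, -K, hK.neg, by simpa using h0, fun x hx => h _ ?_⟩
  simpa using hx

theorem IsWeakSolution.comp_neg {k : ℤ} {u : ℝ → ℂ} (hu : IsWeakSolution α k u) :
    IsWeakSolution α k (fun x => u (-x)) := by
  intro f hf
  have h := hu _ hf.comp_neg
  rw [← integral_neg_eq_self] at h
  refine Eq.trans ?_ h
  refine integral_congr_ae (Eventually.of_forall fun x => ?_)
  simp only [fibreExpr_comp_neg, neg_neg]

theorem IsWeakSolution.exists_ae_eq_const_mul (hα : 0 ≤ α) (hα' : α < 1) {k : ℤ} {u : ℝ → ℂ}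
    (hu : IsWeakSolution α k u) (hu2 : MemLp u 2 volume) :
    ∃ c : ℂ, ∀ᵐ x : ℝ, x ∈ Set.Ioi (0 : ℝ) → u x = c * deficiencyFun α k x := by
  obtain ⟨Φ', h⟩ := exists_isPositiveSolution_deficiencyFun hα hα' k
  obtain ⟨c, hc⟩ := h.exists_ae_eq_const_mul (memLp_deficiencyFun_Ioi hα hα' k)
    -- The weak equation pairs tests with the conjugate of `u`; the coefficient is conjugated back
    -- afterwards.
    (w := fun x => (starRingEnd ℂ) (u x)) (hu2.star.restrict _) fun F hF => by
      rw [← hu F (isFibreTest_of_mem_halfLineTests hF)]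
      simp only [fibreExpr_add_shift]
  refine ⟨(starRingEnd ℂ) c, ?_⟩
  filter_upwards [hc] with x hx hx0
  have := congrArg (starRingEnd ℂ) (hx hx0)
  simpa using this

theorem memLp_deficiencyVec (hα : 0 ≤ α) (hα' : α < 1) (k : ℤ) (c : EuclideanSpace ℂ (Fin 2)) :
    MemLp (deficiencyVec α k c) 2 volume := by
  have h1 := (memLp_deficiencyFun_Ioi hα hα' k).ofReal (K := ℂ)
  have hr : MemLp (deficiencyVec α k c) 2 (volume.restrict (Set.Ioi 0)) := by
    refine (h1.const_mul (c 1)).ae_eq ?_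
    filter_upwards [ae_restrict_mem measurableSet_Ioi] with x hx
    exact (deficiencyVec_of_pos α k c hx).symm
  have hl : MemLp (deficiencyVec α k c) 2 (volume.restrict (Set.Iio 0)) := by
    have hmp : MeasurePreserving (fun x : ℝ => -x) (volume.restrict (Set.Iio 0))
        (volume.restrict (Set.Ioi 0)) := by
      have := (Measure.measurePreserving_neg (volume : Measure ℝ)).restrict_preimage
        (measurableSet_Ioi (a := (0 : ℝ)))
      simpa using this
    refine ((h1.const_mul (c 0)).comp_measurePreserving hmp).ae_eq ?_
    filter_upwards [ae_restrict_mem measurableSet_Iio] with x hx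
    have hx' : 0 < -x := by simpa using hx
    have := deficiencyVec_neg_of_pos α k c hx'
    rw [neg_neg] at this
    exact this.symm
  rw [← memLp_indicator_iff_restrict measurableSet_Ioi] at hr
  rw [← memLp_indicator_iff_restrict measurableSet_Iio] at hl
  refine (hr.add hl).ae_eq ?_
  have h0 : ∀ᵐ x : ℝ, x ≠ 0 := by simp [ae_iff, measure_singleton]
  filter_upwards [h0] with x hx
  rcases hx.lt_or_gt with h | h
  · simp [h, h.not_gt]
  · simp [h, h.not_gt]

theorem integral_eq_integral_Ioi_add {f : ℝ → ℂ} (hf : Integrable f) :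
    ∫ x, f x = (∫ x in Set.Ioi 0, f x) + ∫ x in Set.Ioi 0, f (-x) := by
  rw [integral_comp_neg_Ioi, neg_zero, ← intervalIntegral.integral_Iic_add_Ioi hf.integrableOn
    hf.integrableOn (b := 0), add_comm]

theorem isWeakSolution_deficiencyVec (hα : 0 ≤ α) (hα' : α < 1) (k : ℤ)
    (c : EuclideanSpace ℂ (Fin 2)) : IsWeakSolution α k (deficiencyVec α k c) := by
  obtain ⟨Φ', h⟩ := exists_isPositiveSolution_deficiencyFun hα hα' k
  have hΦ := memLp_deficiencyFun_Ioi hα hα' k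
  have hmem : ∀ f, IsFibreTest f →
      MemLp (fun x => fibreExpr α k f x + (if k = 0 then 1 else 0) * f x) 2 volume :=
    fun f hf => (hf.memLp_fibreExpr α k).add (hf.memLp.const_mul _)
  have key : ∀ f, IsFibreTest f → ∫ x in Set.Ioi 0, (deficiencyFun α k x : ℂ) *
      (fibreExpr α k f x + (if k = 0 then 1 else 0) * f x) = 0 := by
    intro f hf
    have h1 := hmem f hf
    simp only [fibreExpr_add_shift] at h1 ⊢
    exact h.integral_Ioi_mul_eq_zero hΦ hf h1
  intro f hf
  have hint : Integrable (fun x => (starRingEnd ℂ) (deficiencyVec α k c x) *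
      (fibreExpr α k f x + (if k = 0 then 1 else 0) * f x)) :=
    (memLp_deficiencyVec hα hα' k c).star.integrable_mul (hmem f hf)
  rw [integral_eq_integral_Ioi_add hint]
  have e1 : ∫ x in Set.Ioi 0, (starRingEnd ℂ) (deficiencyVec α k c x) *
      (fibreExpr α k f x + (if k = 0 then 1 else 0) * f x) =
      (starRingEnd ℂ) (c 1) * ∫ x in Set.Ioi 0, (deficiencyFun α k x : ℂ) *
      (fibreExpr α k f x + (if k = 0 then 1 else 0) * f x) := by
    rw [← integral_const_mul]
    refine setIntegral_congr_fun measurableSet_Ioi fun x hx => ?_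
    simp only [deficiencyVec_of_pos α k c hx, map_mul, Complex.conj_ofReal, mul_assoc]
  have e2 : ∫ x in Set.Ioi 0, (starRingEnd ℂ) (deficiencyVec α k c (-x)) *
      (fibreExpr α k f (-x) + (if k = 0 then 1 else 0) * f (-x)) =
      (starRingEnd ℂ) (c 0) * ∫ x in Set.Ioi 0, (deficiencyFun α k x : ℂ) *
      (fibreExpr α k (fun x => f (-x)) x + (if k = 0 then 1 else 0) * f (-x)) := by
    rw [← integral_const_mul]
    refine setIntegral_congr_fun measurableSet_Ioi fun x hx => ?_
    simp only [deficiencyVec_neg_of_pos α k c hx, map_mul, Complex.conj_ofReal, mul_assoc,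
      fibreExpr_comp_neg]
  rw [e1, e2, key f hf, key _ hf.comp_neg]
  simp

theorem isWeakSolution_iff (hα : 0 ≤ α) (hα' : α < 1) (k : ℤ) (u : Fibre) :
    IsWeakSolution α k u ↔ ∃ c, (u : ℝ → ℂ) =ᵐ[volume] deficiencyVec α k c := by
  constructor
  · intro hu
    have hu2 : MemLp u 2 volume := Lp.memLp u
    obtain ⟨c, hc⟩ := hu.exists_ae_eq_const_mul hα hα' hu2
    obtain ⟨d, hd⟩ := hu.comp_neg.exists_ae_eq_const_mul hα hα'
      (hu2.comp_measurePreserving (Measure.measurePreserving_neg volume))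
    refine ⟨!₂[d, c], ae_iff_of_neg_of_pos ?_ ?_⟩
    · filter_upwards [hc] with x hx hx0
      rw [hx hx0, deficiencyVec_of_pos α k _ hx0]
      simp
    · filter_upwards [hd] with x hx hx0
      rw [hx hx0, deficiencyVec_neg_of_pos α k _ hx0]
      simp
  · rintro ⟨c, hc⟩ f hf
    refine Eq.trans ?_ (isWeakSolution_deficiencyVec hα hα' k c f hf)
    refine integral_congr_ae ?_
    filter_upwards [hc] with x hx
    rw [hx]

theorem integral_norm_sq_deficiencyVec (hα : 0 ≤ α) (hα' : α < 1) (k : ℤ)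
    (c : EuclideanSpace ℂ (Fin 2)) :
    ∫ x, ‖deficiencyVec α k c x‖ ^ 2 = (∫ x in Set.Ioi 0, deficiencyFun α k x ^ 2) * ‖c‖ ^ 2 := by
  have hi := (memLp_deficiencyVec hα hα' k c).integrable_norm_pow (by simp)
  have h1 := integral_comp_neg_Ioi 0 (fun x => ‖deficiencyVec α k c x‖ ^ 2)
  rw [neg_zero] at h1
  rw [← intervalIntegral.integral_Iic_add_Ioi (b := 0) hi.integrableOn hi.integrableOn, ← h1,
    EuclideanSpace.norm_sq_eq, Fin.sum_univ_two, mul_add, ← integral_mul_const,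
    ← integral_mul_const]
  congr 1
  · refine setIntegral_congr_fun measurableSet_Ioi fun x hx => ?_
    simp only [deficiencyVec_neg_of_pos α k c hx, norm_mul, Complex.norm_real, mul_pow,
      Real.norm_eq_abs, sq_abs, mul_comm]
  · refine setIntegral_congr_fun measurableSet_Ioi fun x hx => ?_
    simp only [deficiencyVec_of_pos α k c hx, norm_mul, Complex.norm_real, mul_pow,
      Real.norm_eq_abs, sq_abs, mul_comm]

theorem integral_sq_deficiencyFun_pos (hα : 0 ≤ α) (hα' : α < 1) (k : ℤ) :
    0 < ∫ x in Set.Ioi 0, deficiencyFun α k x ^ 2 := by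
  obtain ⟨Φ', h⟩ := exists_isPositiveSolution_deficiencyFun hα hα' k
  have hi := (memLp_deficiencyFun_Ioi hα hα' k).integrable_sq
  rw [setIntegral_pos_iff_support_of_nonneg_ae (Eventually.of_forall fun x => sq_nonneg _) hi]
  have : Set.Ioi (0 : ℝ) ⊆ (Function.support fun x => deficiencyFun α k x ^ 2) ∩ Set.Ioi 0 :=
    fun x hx => ⟨(pow_pos (h.pos x hx) 2).ne', hx⟩
  exact lt_of_lt_of_le (by simp) (measure_mono this)

/-- Scaling: with `n = |k|`, `Φ_k(x)² = n^(-1/(1+α)) Φ_1(n^(1/(1+α)) x)²`, and the substitution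
contributes a second factor `n^(-1/(1+α))`. This is the origin of the weight. -/
theorem integral_sq_deficiencyFun (hα : 0 ≤ α) {k : ℤ} (hk : k ≠ 0) :
    ∫ x in Set.Ioi 0, deficiencyFun α k x ^ 2 =
      (∫ x in Set.Ioi 0, deficiencyFun α 1 x ^ 2) * |(k : ℝ)| ^ (-(2 / (1 + α))) := by
  have hk0 : 0 < |(k : ℝ)| := abs_pos.mpr (Int.cast_ne_zero.mpr hk)
  set n := |(k : ℝ)|
  have hα1 : 0 < 1 + α := by linarith
  have hb : 0 < n ^ (1 / (1 + α)) := Real.rpow_pos_of_pos hk0 _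
  have h1 := integral_comp_mul_left_Ioi (fun x => deficiencyFun α 1 x ^ 2) 0 hb
  rw [mul_zero, smul_eq_mul, inv_mul_eq_div, eq_div_iff hb.ne'] at h1
  have h2 : ∀ x ∈ Set.Ioi (0 : ℝ), deficiencyFun α k x ^ 2 =
      n ^ (-(1 / (1 + α))) * deficiencyFun α 1 (n ^ (1 / (1 + α)) * x) ^ 2 := by
    intro x hx
    have hx0 : 0 < x := hx
    have e1 : (n ^ (1 / (1 + α)) * x) ^ (1 + α) = n * x ^ (1 + α) := by
      rw [Real.mul_rpow hb.le hx0.le, ← Real.rpow_mul hk0.le, one_div_mul_cancel hα1.ne',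
        Real.rpow_one]
    have e2 : (n ^ (1 / (1 + α)) * x) ^ (-(α / 2)) =
        n ^ (-(α / 2) / (1 + α)) * x ^ (-(α / 2)) := by
      rw [Real.mul_rpow hb.le hx0.le, ← Real.rpow_mul hk0.le]
      congr 2
      ring
    have e3 : n ^ (-(1 / (1 + α))) * (n ^ (-(α / 2) / (1 + α))) ^ 2 = n⁻¹ := by
      rw [← Real.rpow_natCast, ← Real.rpow_mul hk0.le, ← Real.rpow_add hk0, ← Real.rpow_neg_one]
      congr 1
      field_simp
      push_cast
      ring
    rw [deficiencyFun_of_ne_zero hk hx0, deficiencyFun_of_ne_zero one_ne_zero (mul_pos hb hx0),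
      e1, e2]
    have hpi := Real.pi_pos
    simp only [mul_pow, Int.cast_one, abs_one]
    rw [Real.sq_sqrt (by positivity), Real.sq_sqrt (by positivity)]
    have e4 : Real.exp (-(|(k : ℝ)| / (1 + α)) * x ^ (1 + α)) =
        Real.exp (-(1 / (1 + α)) * (n * x ^ (1 + α))) := by
      congr 1
      ring
    have e5 : Real.pi * (1 + α) / (2 * n) = Real.pi * (1 + α) / (2 * 1) *
        (n ^ (-(1 / (1 + α))) * (n ^ (-(α / 2) / (1 + α))) ^ 2) := by
      rw [e3]
      field_simp
    rw [e4, e5]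
    ring
  have h3 : n ^ (-(2 / (1 + α))) * n ^ (1 / (1 + α)) = n ^ (-(1 / (1 + α))) := by
    rw [← Real.rpow_add hk0]
    congr 1
    ring
  rw [setIntegral_congr_fun measurableSet_Ioi h2, integral_const_mul, ← h1, ← h3]
  ring

end DeficiencyFunctions

/-! ### Parametrization of the deficiency space -/

section Parametrization

variable {α : ℝ}

theorem modeWeight_pos (α : ℝ) (k : ℤ) : 0 < modeWeight α k := by
  unfold modeWeight
  split_ifs with hk
  · exact one_pos
  · exact Real.rpow_pos_of_pos (abs_pos.mpr (Int.cast_ne_zero.mpr hk)) _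

/-- Every weight is positive, so elements of `WeightedSeq` are genuine sequences. -/
theorem ae_modeMeasure_iff {p : ℤ → Prop} : (∀ᵐ k ∂modeMeasure α, p k) ↔ ∀ k, p k := by
  unfold modeMeasure
  rw [Measure.ae_sum_iff]
  refine forall_congr' fun k => ?_
  rw [Measure.ae_ennreal_smul_measure_iff (by simpa using modeWeight_pos α k), ae_dirac_eq]
  rfl

theorem integrable_modeMeasure_iff {E : Type*} [NormedAddCommGroup E] {f : ℤ → E} :
    Integrable f (modeMeasure α) ↔ Summable fun k => modeWeight α k * ‖f k‖ := by
  unfold modeMeasure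
  rw [integrable_sum_dirac_iff (by simp)]
  simp_rw [ENNReal.toReal_ofReal (modeWeight_pos α _).le]

theorem norm_sq_eq_integral_norm_sq {X E : Type*} [MeasurableSpace X] {μ : Measure X}
    [NormedAddCommGroup E] [InnerProductSpace ℂ E] (f : Lp E 2 μ) :
    ‖f‖ ^ 2 = ∫ x, ‖f x‖ ^ 2 ∂μ := by
  have h := L2.inner_def (𝕜 := ℂ) f f
  simp only [inner_self_eq_norm_sq_to_K] at h
  have h2 := integral_ofReal (𝕜 := ℂ) (μ := μ) (f := fun x => ‖f x‖ ^ 2)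
  apply Complex.ofReal_injective
  simpa using h.trans (by simpa using h2)

theorem hasSum_modeWeight_mul_norm_sq (c : WeightedSeq α) :
    HasSum (fun k => modeWeight α k * ‖c k‖ ^ 2) (‖c‖ ^ 2) := by
  have h1 : Integrable (fun k => ‖c k‖ ^ 2) (modeMeasure α) :=
    (Lp.memLp c).integrable_norm_pow (by simp)
  rw [norm_sq_eq_integral_norm_sq]
  unfold modeMeasure at h1 ⊢
  convert! hasSum_integral_measure h1 with k
  simp [integral_smul_measure, ENNReal.toReal_ofReal (modeWeight_pos α k).le]

theorem memLp_modeMeasure {f : ℤ → EuclideanSpace ℂ (Fin 2)}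
    (hf : Summable fun k => modeWeight α k * ‖f k‖ ^ 2) : MemLp f 2 (modeMeasure α) := by
  rw [memLp_two_iff_integrable_sq_norm (Measurable.aestronglyMeasurable (by fun_prop)),
    integrable_modeMeasure_iff]
  simpa using hf

/-- The map `c ↦ deficiencyVec α k c` into the fibre. -/
noncomputable def deficiencyMap (hα : 0 ≤ α) (hα' : α < 1) (k : ℤ) :
    EuclideanSpace ℂ (Fin 2) →ₗ[ℂ] Fibre where
  toFun c := (memLp_deficiencyVec hα hα' k c).toLp _
  map_add' c d := by
    rw [← MemLp.toLp_add]
    congr 1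
    funext x
    simp only [deficiencyVec, Pi.add_apply, PiLp.add_apply]
    split_ifs <;> ring
  map_smul' a c := by
    rw [RingHom.id_apply, ← MemLp.toLp_const_smul]
    congr 1
    funext x
    simp only [deficiencyVec, Pi.smul_apply, PiLp.smul_apply, smul_eq_mul]
    split_ifs <;> ring

theorem coeFn_deficiencyMap (hα : 0 ≤ α) (hα' : α < 1) (k : ℤ) (c : EuclideanSpace ℂ (Fin 2)) :
    (deficiencyMap hα hα' k c : ℝ → ℂ) =ᵐ[volume] deficiencyVec α k c :=
  (memLp_deficiencyVec hα hα' k c).coeFn_toLp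

theorem norm_sq_deficiencyMap (hα : 0 ≤ α) (hα' : α < 1) (k : ℤ) (c : EuclideanSpace ℂ (Fin 2)) :
    ‖deficiencyMap hα hα' k c‖ ^ 2 =
      (∫ x in Set.Ioi 0, deficiencyFun α k x ^ 2) * ‖c‖ ^ 2 := by
  rw [← integral_norm_sq_deficiencyVec hα hα' k c, norm_sq_eq_integral_norm_sq]
  refine integral_congr_ae ?_
  filter_upwards [coeFn_deficiencyMap hα hα' k c] with x hx
  rw [hx]

theorem mem_deficiencySpace_iff_exists (hα : 0 ≤ α) (hα' : α < 1)
    {R : FibredSpace →L[ℂ] FibredSpace}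
    (hR : IsBirmanInverse (grushin α) zeroMode R (deficiencySpace α)) (ψ : FibredSpace) :
    ψ ∈ deficiencySpace α ↔ ∀ k, ∃ c, ψ k = deficiencyMap hα hα' k c := by
  rw [mem_deficiencySpace_iff_isWeakSolution _ hR]
  refine forall_congr' fun k => (isWeakSolution_iff hα hα' k _).trans (exists_congr fun c => ?_)
  exact ⟨fun h => Lp.ext (h.trans (coeFn_deficiencyMap hα hα' k c).symm),
    fun h => h ▸ coeFn_deficiencyMap hα hα' k c⟩

/-- The free fibre scaling `s` lets one construction serve twice: `s = 1` gives the prescribed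
homeomorphism, and the square root of weight over squared norm, with `lo = hi = 1`, gives a unitary
map. The upper bound makes the image square summable; the lower bound gives injectivity and makes
the coefficients of a given vector weighted square summable. -/
theorem exists_linearEquiv_deficiencySpace (hα : 0 ≤ α) (hα' : α < 1)
    {R : FibredSpace →L[ℂ] FibredSpace}
    (hR : IsBirmanInverse (grushin α) zeroMode R (deficiencySpace α)) {s : ℤ → ℝ}
    (hs : ∀ k, s k ≠ 0) {lo hi : ℝ} (hlo : 0 < lo)
    (hle : ∀ k, lo * modeWeight α k ≤ s k ^ 2 * ∫ x in Set.Ioi 0, deficiencyFun α k x ^ 2)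
    (hge : ∀ k, s k ^ 2 * ∫ x in Set.Ioi 0, deficiencyFun α k x ^ 2 ≤ hi * modeWeight α k) :
    ∃ J : WeightedSeq α ≃ₗ[ℂ] deficiencySpace α,
      (∀ c k, (J c : FibredSpace) k = deficiencyMap hα hα' k ((s k : ℂ) • c k)) ∧
      (∀ c, lo * ‖c‖ ^ 2 ≤ ‖J c‖ ^ 2) ∧ ∀ c, ‖J c‖ ^ 2 ≤ hi * ‖c‖ ^ 2 := by
  have hnorm : ∀ k (a : EuclideanSpace ℂ (Fin 2)),
      ‖deficiencyMap hα hα' k ((s k : ℂ) • a)‖ ^ 2 =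
        (s k ^ 2 * ∫ x in Set.Ioi 0, deficiencyFun α k x ^ 2) * ‖a‖ ^ 2 := by
    intro k a
    rw [norm_sq_deficiencyMap, norm_smul, mul_pow, Complex.norm_real, Real.norm_eq_abs, sq_abs]
    ring
  have hle' : ∀ k (a : EuclideanSpace ℂ (Fin 2)), lo * (modeWeight α k * ‖a‖ ^ 2) ≤
      ‖deficiencyMap hα hα' k ((s k : ℂ) • a)‖ ^ 2 := by
    intro k a
    rw [hnorm, ← mul_assoc]
    exact mul_le_mul_of_nonneg_right (hle k) (sq_nonneg _)
  have hge' : ∀ k (a : EuclideanSpace ℂ (Fin 2)),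
      ‖deficiencyMap hα hα' k ((s k : ℂ) • a)‖ ^ 2 ≤ hi * (modeWeight α k * ‖a‖ ^ 2) := by
    intro k a
    rw [hnorm, ← mul_assoc]
    exact mul_le_mul_of_nonneg_right (hge k) (sq_nonneg _)
  have hmem : ∀ c : WeightedSeq α,
      Memℓp (fun k => deficiencyMap hα hα' k ((s k : ℂ) • c k)) 2 := by
    intro c
    refine memℓp_gen ?_
    simp only [ENNReal.toReal_ofNat, Real.rpow_two]
    exact ((hasSum_modeWeight_mul_norm_sq c).summable.mul_left hi).of_nonneg_of_le
      (fun k => sq_nonneg _) fun k => hge' k (c k)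
  have hcoe_add : ∀ (c d : WeightedSeq α) k, (c + d) k = c k + d k := fun c d =>
    ae_modeMeasure_iff.mp (Lp.coeFn_add c d)
  have hcoe_smul : ∀ (a : ℂ) (c : WeightedSeq α) k, (a • c) k = a • c k := fun a c =>
    ae_modeMeasure_iff.mp (Lp.coeFn_smul a c)
  let J₀ : WeightedSeq α →ₗ[ℂ] deficiencySpace α :=
    { toFun := fun c => ⟨⟨_, hmem c⟩,
        (mem_deficiencySpace_iff_exists hα hα' hR _).mpr fun k => ⟨_, rfl⟩⟩
      map_add' := fun c d => by
        ext1
        ext1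
        funext k
        change deficiencyMap hα hα' k ((s k : ℂ) • (c + d) k) =
          deficiencyMap hα hα' k ((s k : ℂ) • c k) + deficiencyMap hα hα' k ((s k : ℂ) • d k)
        rw [hcoe_add, smul_add, _root_.map_add]
      map_smul' := fun a c => by
        ext1
        ext1
        funext k
        change deficiencyMap hα hα' k ((s k : ℂ) • (a • c) k) =
          a • deficiencyMap hα hα' k ((s k : ℂ) • c k)
        rw [hcoe_smul, smul_comm, _root_.map_smul] }
  have hJ₀ : ∀ c k, (J₀ c : FibredSpace) k = deficiencyMap hα hα' k ((s k : ℂ) • c k) :=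
    fun c k => rfl
  have hsum : ∀ ψ : FibredSpace, HasSum (fun k => ‖ψ k‖ ^ 2) (‖ψ‖ ^ 2) := by
    intro ψ
    simpa using lp.hasSum_norm (p := 2) (by simp) ψ
  have h1 : ∀ c, lo * ‖c‖ ^ 2 ≤ ‖J₀ c‖ ^ 2 := fun c =>
    hasSum_le (fun k => hle' k (c k)) ((hasSum_modeWeight_mul_norm_sq c).mul_left lo)
      (hsum (J₀ c))
  have h2 : ∀ c, ‖J₀ c‖ ^ 2 ≤ hi * ‖c‖ ^ 2 := fun c =>
    hasSum_le (fun k => hge' k (c k)) (hsum (J₀ c))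
      ((hasSum_modeWeight_mul_norm_sq c).mul_left hi)
  have hbij : Function.Bijective J₀ := by
    constructor
    · rw [injective_iff_map_eq_zero]
      intro c hc
      have h := h1 c
      rw [hc, norm_zero] at h
      have h0 : ‖c‖ ^ 2 ≤ 0 := by nlinarith
      exact norm_eq_zero.mp (pow_eq_zero_iff (two_ne_zero)|>.mp (le_antisymm h0 (sq_nonneg _)))
    · rintro ⟨ψ, hψ⟩
      choose d hd using (mem_deficiencySpace_iff_exists hα hα' hR ψ).mp hψ
      have hd' : ∀ k, ψ k = deficiencyMap hα hα' k ((s k : ℂ) • (s k : ℂ)⁻¹ • d k) := fun k => by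
        rw [smul_inv_smul₀ (Complex.ofReal_ne_zero.mpr (hs k)), hd]
      have hc : MemLp (fun k => (s k : ℂ)⁻¹ • d k) 2 (modeMeasure α) := by
        refine memLp_modeMeasure (((hsum ψ).summable.mul_left lo⁻¹).of_nonneg_of_le
          (fun k => mul_nonneg (modeWeight_pos α k).le (sq_nonneg _)) fun k => ?_)
        rw [← div_eq_inv_mul, le_div_iff₀' hlo, hd']
        exact hle' k _
      refine ⟨hc.toLp _, ?_⟩
      ext1
      ext1
      funext k
      rw [hJ₀, hd', ae_modeMeasure_iff.mp hc.coeFn_toLp k]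
  exact ⟨LinearEquiv.ofBijective J₀ hbij, hJ₀, h1, h2⟩

/-- By scaling the ratio of squared norm to weight takes only its values at `k = 0` and `k = 1`. -/
theorem exists_deficiency_bounds (hα : 0 ≤ α) (hα' : α < 1) : ∃ lo hi : ℝ, 0 < lo ∧ ∀ k,
    lo * modeWeight α k ≤ ∫ x in Set.Ioi 0, deficiencyFun α k x ^ 2 ∧
    ∫ x in Set.Ioi 0, deficiencyFun α k x ^ 2 ≤ hi * modeWeight α k := by
  refine ⟨min (∫ x in Set.Ioi 0, deficiencyFun α 0 x ^ 2)
    (∫ x in Set.Ioi 0, deficiencyFun α 1 x ^ 2), max (∫ x in Set.Ioi 0, deficiencyFun α 0 x ^ 2)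
    (∫ x in Set.Ioi 0, deficiencyFun α 1 x ^ 2), lt_min (integral_sq_deficiencyFun_pos hα hα' 0)
    (integral_sq_deficiencyFun_pos hα hα' 1), fun k => ?_⟩
  rcases eq_or_ne k 0 with rfl | hk
  · simp [modeWeight]
  · have h := modeWeight_pos α k
    rw [modeWeight, if_neg hk] at h ⊢
    rw [integral_sq_deficiencyFun hα hk]
    exact ⟨mul_le_mul_of_nonneg_right (min_le_right _ _) h.le,
      mul_le_mul_of_nonneg_right (le_max_right _ _) h.le⟩

theorem exists_continuousLinearEquiv_deficiencySpace (hα : 0 ≤ α) (hα' : α < 1)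
    {R : FibredSpace →L[ℂ] FibredSpace}
    (hR : IsBirmanInverse (grushin α) zeroMode R (deficiencySpace α)) :
    ∃ J : WeightedSeq α ≃L[ℂ] deficiencySpace α, ∀ (c : WeightedSeq α) (k : ℤ),
      ((J c : FibredSpace) k : ℝ → ℂ) =ᵐ[volume] deficiencyVec α k (c k) := by
  obtain ⟨lo, hi, hlo, hb⟩ := exists_deficiency_bounds hα hα'
  obtain ⟨J, hJ, h1, h2⟩ := exists_linearEquiv_deficiencySpace hα hα' hR (s := fun _ => 1)
    (fun _ => one_ne_zero) hlo (fun k => by simpa using (hb k).1) (fun k => by simpa using (hb k).2)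
  refine ⟨J.toContinuousLinearEquivOfBounds (Real.sqrt hi) (Real.sqrt lo)⁻¹ (fun c => ?_)
    (fun ψ => ?_), fun c k => ?_⟩
  · have := Real.sqrt_le_sqrt (h2 c)
    rwa [Real.sqrt_sq (norm_nonneg _), Real.sqrt_mul' _ (sq_nonneg _),
      Real.sqrt_sq (norm_nonneg _)] at this
  · have := Real.sqrt_le_sqrt (h1 (J.symm ψ))
    rw [Real.sqrt_sq (norm_nonneg _), Real.sqrt_mul' _ (sq_nonneg _),
      Real.sqrt_sq (norm_nonneg _), LinearEquiv.apply_symm_apply] at this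
    rwa [← div_eq_inv_mul, le_div_iff₀' (Real.sqrt_pos.mpr hlo)]
  · have := coeFn_deficiencyMap hα hα' k (c k)
    have h := hJ c k
    rw [Complex.ofReal_one, one_smul] at h
    rw [← h] at this
    exact this

theorem nonempty_linearIsometryEquiv_deficiencySpace (hα : 0 ≤ α) (hα' : α < 1)
    {R : FibredSpace →L[ℂ] FibredSpace}
    (hR : IsBirmanInverse (grushin α) zeroMode R (deficiencySpace α)) :
    Nonempty (WeightedSeq α ≃ₗᵢ[ℂ] deficiencySpace α) := by
  have hn := integral_sq_deficiencyFun_pos hα hα'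
  have hs : ∀ k, 0 < modeWeight α k / ∫ x in Set.Ioi 0, deficiencyFun α k x ^ 2 := fun k =>
    div_pos (modeWeight_pos α k) (hn k)
  have hsq : ∀ k, Real.sqrt (modeWeight α k / ∫ x in Set.Ioi 0, deficiencyFun α k x ^ 2) ^ 2 *
      ∫ x in Set.Ioi 0, deficiencyFun α k x ^ 2 = 1 * modeWeight α k := fun k => by
    rw [Real.sq_sqrt (hs k).le, div_mul_cancel₀ _ (hn k).ne', one_mul]
  obtain ⟨J, -, h1, h2⟩ := exists_linearEquiv_deficiencySpace hα hα' hR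
    (fun k => (Real.sqrt_pos.mpr (hs k)).ne') one_pos (fun k => (hsq k).ge) (fun k => (hsq k).le)
  refine ⟨⟨J, fun c => ?_⟩⟩
  have h3 := le_antisymm (h2 c) (h1 c)
  rw [one_mul] at h3
  exact (sq_eq_sq₀ (norm_nonneg _) (norm_nonneg _)).mp h3

end Parametrization

theorem mainTheorem6 (α : ℝ) (hα : 0 ≤ α) (hα' : α < 1) :
    (∃ J : WeightedSeq α ≃L[ℂ] deficiencySpace α,
      ∀ (c : WeightedSeq α) (k : ℤ),
        ((J c : FibredSpace) k : ℝ → ℂ) =ᵐ[volume] deficiencyVec α k (c k)) ∧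
    Nonempty (WeightedSeq α ≃ₗᵢ[ℂ] deficiencySpace α) ∧
    ∃ R : FibredSpace →L[ℂ] FibredSpace,
      IsBoundedInverse (zeroMode +ᵥ friedrichs (grushin α)) R ∧
      ∃ e : SelfAdjointInSubspace (deficiencySpace α) ≃
          {B : FibredSpace →ₗ.[ℂ] FibredSpace // grushin α ≤ B ∧ IsSelfAdjoint B},
        ∀ S : SelfAdjointInSubspace (deficiencySpace α),
          (∀ ψ : FibredSpace, ψ ∈ (e S).1.domain ↔
            ∃ (φ : (grushin α).closure.domain) (v : S.op.domain) (w : FibredSpace),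
              w ∈ deficiencySpace α ∧
              (∀ u : S.op.domain, inner ℂ ((u : S.space) : FibredSpace) w = 0) ∧
              ψ = φ + R ((S.op v : FibredSpace) + w) + ((v : S.space) : FibredSpace)) ∧
          (∀ (φ : (grushin α).closure.domain) (v : S.op.domain) (w : FibredSpace),
            w ∈ deficiencySpace α →
            (∀ u : S.op.domain, inner ℂ ((u : S.space) : FibredSpace) w = 0) →
            ∀ ψ : (e S).1.domain,
              (ψ : FibredSpace) =
                φ + R ((S.op v : FibredSpace) + w) + ((v : S.space) : FibredSpace) →
              (e S).1 ψ + zeroMode ψ =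
                ((grushin α).closure φ + zeroMode φ) + (S.op v : FibredSpace) + w) := by

  obtain ⟨m, hm, hb⟩ := exists_lower_bound_grushin hα
  obtain ⟨R, hR, hB⟩ := exists_birman_correspondence (grushin α) zeroMode
    (dense_grushin_domain α) (grushin_isFormalAdjoint α) zeroMode_isSymmetric hm hb
  exact ⟨exists_continuousLinearEquiv_deficiencySpace hα hα' hB,
    nonempty_linearIsometryEquiv_deficiencySpace hα hα' hB, R, hR, hB.exists_equiv_extensions⟩
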